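/- **Setting.** A database $\mathcal D=(\Sigma,V,E,\mathrm{src},\mathrm{tgt},\mathrm{lbl})$ consists of finite sets $\Sigma$ (labels), $V$ (vertices), $E$ (edges) and maps $\mathrm{src},\mathrm{tgt}:E\to V$, $\mathrm{lbl}:E\to 2^{\Sigma}$; its size is $|\mathcal D|=|V|+|E|+\sum_{e\in E}|\mathrm{lbl}(e)|$. A walk $w=\langle v_0,e_0,v_1,\dots,e_{k-1},v_k\rangle$ ($k\ge 0$) satisfies $\mathrm{src}(e_i)=v_i$ and $\mathrm{tgt}(e_i)=v_{i+1}$ for all $i<k$; its length is $k$, and it goes from $v_0$ to $v_k$. A nondeterministic automaton $\mathcal A=(\Sigma,Q,\Delta,I,F)$ (without $\varepsilon$-transitions) has size $|\mathcal A|=|\Sigma|+|Q|+|\Delta|+|I|+|F|$. It matches $w$ if some word $a_0\cdots a_{k-1}$ with $a_i\in\mathrm{lbl}(e_i)$ for all $i$ belongs to $L(\mathcal A)$. For $s,t\in V$, let $\lambda$ be the minimal length of a walk from $s$ to $t$ that matches $\mathcal A$ ($\lambda=0$ if there is none). The problem *Distinct Shortest Walks*$(\mathcal D,\mathcal A,s,t)$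 is to enumerate without duplicates all walks of length $\lambda$ from $s$ to $t$ that match $\mathcal A$. **Model.** Programs run on a word RAM (registers and arrays of words; addition, truncated subtraction, multiplication and comparisons modulo $2^b$ at unit cost) with words of $b\ge c\,(\lfloor\log_2(|\mathcal D|+|\mathcal A|)\rfloor+1)$ bits. Vertices, edges, labels and states are numbered from $0$. The input provides in unit time: the numbers $|V|,|E|,|\Sigma|,|Q|$ and the vertices $s,t$; for each vertex, the lengths and entries of the arrays of its incoming and of its outgoing edges; for each edge, its source, its target, its position in the array of incoming edges of its target, and the length and entries of the list of its labels; for each state $q$ and label $a$, the length and entries of the list $\Delta(q,a)$; for each state, whether it is initial and whether it is final. The arrays and lists are without repetitions, in arbitrary order. **Theorem.** There are a constant $c$ and two programs, *Preprocess* and *NextOutput*, such that for every database $\mathcal D$, automaton $\mathcal A$ over the same $\Sigma$, vertices $s,t$, memory representation and word length as above, the following holds. *Preprocess* reads the input and computes data structures (arrays). There is an enumeration $w_1,\dots,w_N$ without duplicates of all answers to *Distinct Shortest Walks*$(\mathcal D,\mathcal A,s,t)$ such that *NextOutput*, given only read-only access to the precomputed arrays and to the previous output $w_i$ (nothing, if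 $i=0$), writes $w_{i+1}$ if $i<N$ and reports that there is no further answer if $i=N$, for all $0\le i\le N$ and whatever the initial content of its own registers and working arrays. In particular the precomputed structures are never modified and no other information passes from one output to the next: the enumeration is memoryless. Moreover, - preprocessing together with the first call of *NextOutput* takes at most $c\cdot|\mathcal D|\cdot\max(1,|\mathcal A|)$ steps, and - every call of *NextOutput* takes at most $c\cdot\max(1,\lambda)\cdot\max(1,|\mathcal A|)$ steps. That is, the problem can be enumerated by a memoryless algorithm with preprocessing time $O(|\mathcal D|\times|\mathcal A|)$ and delay $O(\lambda\times|\mathcal A|)$. -/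

import Mathlib

/-! ## Databases, walks, matching -/

/-- A multi-labelled multi-edge directed graph: every edge has a source, a target and a finite
set of labels. `L`, `V`, `E` are the sets of labels, vertices and edges. -/
structure Database (L V E : Type*) where
  src : E → V
  tgt : E → V
  lbl : E → Finset L

/-- The size `|V| + |E| + ∑ e, |lbl e|` of a database. -/
def Database.size {L V E : Type*} [Fintype V] [Fintype E] (D : Database L V E) : ℕ :=
  Fintype.card V + Fintype.card E + ∑ e, (D.lbl e).card

/-- The edges `e₀, e₁, …` are consecutive and the first of them starts in the given vertex. -/
def Database.IsWalk {L V E : Type*} (D : Database L V E) : V → List E → Prop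
  | _, [] => True
  | v, e :: es => D.src e = v ∧ D.IsWalk (D.tgt e) es

/-- A walk `⟨v₀, e₀, v₁, …, e₍ₖ₋₁₎, vₖ⟩`, given by `v₀` and its edges: the vertices
`v₁, …, vₖ` are the targets of the edges. -/
@[ext]
structure Walk {L V E : Type*} (D : Database L V E) where
  src : V
  edges : List E
  isWalk : D.IsWalk src edges

namespace Walk

variable {L V E : Type*} {D : Database L V E}

/-- The number of edges. -/
def len (w : Walk D) : ℕ := w.edges.length

/-- The last vertex. -/
def tgt (w : Walk D) : V := w.edges.foldl (fun _ e => D.tgt e) w.src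

/-- The set of words `a₀ a₁ ⋯ a₍ₖ₋₁₎` with `aᵢ ∈ lbl(eᵢ)` for all `i`. -/
def lbl (w : Walk D) : Set (List L) :=
  {x | List.Forall₂ (fun a e => a ∈ D.lbl e) x w.edges}

/-- The automaton `A` matches the walk: some word of `lbl(w)` is in the language of `A`. -/
def Matches {Q : Type*} (A : NFA L Q) (w : Walk D) : Prop :=
  ∃ x ∈ w.lbl, x ∈ A.accepts

end Walk

/-- The size `|Σ| + |Q| + |Δ| + |I| + |F|` of an automaton. -/
noncomputable def automatonSize {L Q : Type*} [Fintype L] [Fintype Q] (A : NFA L Q) : ℕ :=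
  Fintype.card L + Fintype.card Q + {x : Q × L × Q | x.2.2 ∈ A.step x.1 x.2.1}.ncard
    + A.start.ncard + A.accept.ncard

/-- The set of all walks from `s` to `t` that match `A`. -/
def matchingWalks {L V E Q : Type*} (D : Database L V E) (A : NFA L Q) (s t : V) :
    Set (Walk D) :=
  {w | w.Matches A ∧ w.src = s ∧ w.tgt = t}

/-- The length `λ` of a shortest walk from `s` to `t` that matches `A`
(`0` if there is no such walk). -/
noncomputable def shortestLength {L V E Q : Type*} (D : Database L V E) (A : NFA L Q)
    (s t : V) : ℕ :=
  sInf (Walk.len '' matchingWalks D A s t)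

/-- The set of all shortest walks from `s` to `t` that match `A`. -/
def shortestWalks {L V E Q : Type*} (D : Database L V E) (A : NFA L Q) (s t : V) :
    Set (Walk D) :=
  {w ∈ matchingWalks D A s t | w.len = shortestLength D A s t}

/-! ## A word RAM

Programs work on registers and on arrays of `w`-bit words, have read-only access to an input,
and write on an output tape. Registers and arrays are named by constants of the program, so that
a program uses only finitely many of them. -/

/-- The operations of the machine; comparisons have value `0` or `1`. -/
inductive Op
  | add | sub | mul | eq | lt

def Op.apply : Op → ℕ → ℕ → ℕ
  | add, x, y => x + y
  | sub, x, y => x - y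
  | mul, x, y => x * y
  | eq, x, y => if x = y then 1 else 0
  | lt, x, y => if x < y then 1 else 0

/-- Expressions. The type `ι` names the accessors of the read-only input; an accessor has (up to)
three arguments. -/
inductive Expr (ι : Type)
  | lit (n : ℕ)
  | reg (x : ℕ)
  | read (a : ℕ) (i : Expr ι)
  | input (k : ι) (i j l : Expr ι)
  | op (o : Op) (e₁ e₂ : Expr ι)

/-- Programs. -/
inductive Prog (ι : Type)
  | skip
  | assign (x : ℕ) (e : Expr ι)
  | store (a : ℕ) (i e : Expr ι)
  | emit (e : Expr ι)
  | seq (p q : Prog ι)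
  | ite (e : Expr ι) (p q : Prog ι)
  | loop (e : Expr ι) (p : Prog ι)

/-- Registers, arrays, and what has been written on the output tape. -/
@[ext]
structure State where
  reg : ℕ → ℕ
  mem : ℕ → ℕ → ℕ
  out : List ℕ

/-- All registers and cells are `0`, nothing has been output. -/
def State.zero : State := ⟨fun _ => 0, fun _ _ => 0, []⟩

/-- Give register `x` the value `v`. -/
def State.setReg (σ : State) (x v : ℕ) : State :=
  { σ with reg := Function.update σ.reg x v }

/-- Give cell `i` of array `a` the value `v`. -/
def State.setCell (σ : State) (a i v : ℕ) : State :=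
  { σ with mem := Function.update σ.mem a (Function.update (σ.mem a) i v) }

/-- Append `v` on the output tape. -/
def State.write (σ : State) (v : ℕ) : State :=
  { σ with out := σ.out ++ [v] }

/-- A read-only input: the value of each accessor on each triple of arguments. -/
abbrev Input (ι : Type) : Type := ι → ℕ → ℕ → ℕ → ℕ

/-- Value of an expression on a machine with words of `w` bits; results are taken modulo `2 ^ w`
(subtraction is truncated at `0`). -/
def Expr.eval {ι : Type} (w : ℕ) (inp : Input ι) (σ : State) : Expr ι → ℕ
  | lit n => n % 2 ^ w
  | reg x => σ.reg x
  | read a i => σ.mem a (i.eval w inp σ)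
  | input k i j l => inp k (i.eval w inp σ) (j.eval w inp σ) (l.eval w inp σ) % 2 ^ w
  | op o e₁ e₂ => o.apply (e₁.eval w inp σ) (e₂.eval w inp σ) % 2 ^ w

/-- The time to evaluate an expression: one step for each node. -/
def Expr.cost {ι : Type} : Expr ι → ℕ
  | lit _ => 1
  | reg _ => 1
  | read _ i => i.cost + 1
  | input _ i j l => i.cost + j.cost + l.cost + 1
  | op _ e₁ e₂ => e₁.cost + e₂.cost + 1

/-- `Exec w inp p σ σ' n`: started in the state `σ`, the program `p` halts in the state `σ'`
after exactly `n` steps. -/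
inductive Exec {ι : Type} (w : ℕ) (inp : Input ι) : Prog ι → State → State → ℕ → Prop
  | skip (σ : State) : Exec w inp .skip σ σ 1
  | assign (x : ℕ) (e : Expr ι) (σ : State) :
      Exec w inp (.assign x e) σ
        (σ.setReg x (e.eval w inp σ)) (e.cost + 1)
  | store (a : ℕ) (i e : Expr ι) (σ : State) :
      Exec w inp (.store a i e) σ
        (σ.setCell a (i.eval w inp σ) (e.eval w inp σ))
        (i.cost + e.cost + 1)
  | emit (e : Expr ι) (σ : State) :
      Exec w inp (.emit e) σ (σ.write (e.eval w inp σ)) (e.cost + 1)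
  | seq {p q : Prog ι} {σ₁ σ₂ σ₃ : State} {n₁ n₂ : ℕ} :
      Exec w inp p σ₁ σ₂ n₁ → Exec w inp q σ₂ σ₃ n₂ → Exec w inp (.seq p q) σ₁ σ₃ (n₁ + n₂)
  | ite_true {e : Expr ι} {p q : Prog ι} {σ σ' : State} {n : ℕ} :
      e.eval w inp σ ≠ 0 → Exec w inp p σ σ' n → Exec w inp (.ite e p q) σ σ' (e.cost + 1 + n)
  | ite_false {e : Expr ι} {p q : Prog ι} {σ σ' : State} {n : ℕ} :
      e.eval w inp σ = 0 → Exec w inp q σ σ' n → Exec w inp (.ite e p q) σ σ' (e.cost + 1 + n)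
  | loop_done {e : Expr ι} {p : Prog ι} {σ : State} :
      e.eval w inp σ = 0 → Exec w inp (.loop e p) σ σ (e.cost + 1)
  | loop_step {e : Expr ι} {p : Prog ι} {σ₁ σ₂ σ₃ : State} {n₁ n₂ : ℕ} :
      e.eval w inp σ₁ ≠ 0 → Exec w inp p σ₁ σ₂ n₁ → Exec w inp (.loop e p) σ₂ σ₃ n₂ →
      Exec w inp (.loop e p) σ₁ σ₃ (e.cost + 1 + n₁ + n₂)

/-! ## Memory representation of databases and automata -/

/-- A memory representation of `D` and `A`: an array of the edges ending (starting) in each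
vertex, an array of the labels of each edge, and a list of the states in `Δ(q, a)` for each
state `q` and label `a`, in any order and without repetitions. -/
structure MemoryRepresentation {L V E Q : Type*} (D : Database L V E) (A : NFA L Q) where
  incoming : V → List E
  outgoing : V → List E
  labels : E → List L
  delta : Q → L → List Q
  incoming_nodup : ∀ v, (incoming v).Nodup
  outgoing_nodup : ∀ v, (outgoing v).Nodup
  labels_nodup : ∀ e, (labels e).Nodup
  delta_nodup : ∀ q a, (delta q a).Nodup
  mem_incoming : ∀ v e, e ∈ incoming v ↔ D.tgt e = v
  mem_outgoing : ∀ v e, e ∈ outgoing v ↔ D.src e = v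
  mem_labels : ∀ e a, a ∈ labels e ↔ a ∈ D.lbl e
  mem_delta : ∀ q a p, p ∈ delta q a ↔ p ∈ A.step q a

/-- The accessors through which a program reads a database, an automaton and two vertices. -/
inductive Accessor
  | numVertices | numEdges | numLabels | numStates
  | source | target
  | indeg | incoming | outdeg | outgoing
  | src | tgt | tgtIdx | lblCard | lbl
  | deltaCard | delta | isInitial | isFinal

/-- The entry at position `i` of a list of numbers, `0` if there is none. -/
def entry {n : ℕ} (l : List (Fin n)) (i : ℕ) : ℕ := (l[i]?).elim 0 Fin.val

open Classical in
/-- The input given to a program. Vertices, edges, labels and states are numbered from `0`.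
For instance `incoming v i` is the `i`-th edge of the array of edges ending in `v`, `tgtIdx e` is
the position of `e` in the array of edges ending in `tgt e`, `lbl e i` is the `i`-th label of `e`
and `delta q a i` is the `i`-th state of `Δ(q, a)`. Accessors have value `0` on arguments that are
out of range. -/
noncomputable def MemoryRepresentation.input {k n m r : ℕ} {D : Database (Fin k) (Fin n) (Fin m)}
    {A : NFA (Fin k) (Fin r)} (R : MemoryRepresentation D A) (s t : Fin n) : Input Accessor
  | .numVertices, _, _, _ => n
  | .numEdges, _, _, _ => m
  | .numLabels, _, _, _ => k
  | .numStates, _, _, _ => r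
  | .source, _, _, _ => s
  | .target, _, _, _ => t
  | .indeg, v, _, _ => if h : v < n then (R.incoming ⟨v, h⟩).length else 0
  | .incoming, v, i, _ => if h : v < n then entry (R.incoming ⟨v, h⟩) i else 0
  | .outdeg, v, _, _ => if h : v < n then (R.outgoing ⟨v, h⟩).length else 0
  | .outgoing, v, i, _ => if h : v < n then entry (R.outgoing ⟨v, h⟩) i else 0
  | .src, e, _, _ => if h : e < m then D.src ⟨e, h⟩ else 0
  | .tgt, e, _, _ => if h : e < m then D.tgt ⟨e, h⟩ else 0
  | .tgtIdx, e, _, _ =>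
      if h : e < m then (R.incoming (D.tgt ⟨e, h⟩)).idxOf ⟨e, h⟩ else 0
  | .lblCard, e, _, _ => if h : e < m then (R.labels ⟨e, h⟩).length else 0
  | .lbl, e, i, _ => if h : e < m then entry (R.labels ⟨e, h⟩) i else 0
  | .deltaCard, q, a, _ =>
      if h : q < r ∧ a < k then (R.delta ⟨q, h.1⟩ ⟨a, h.2⟩).length else 0
  | .delta, q, a, i =>
      if h : q < r ∧ a < k then entry (R.delta ⟨q, h.1⟩ ⟨a, h.2⟩) i else 0
  | .isInitial, q, _, _ => if ∃ h : q < r, (⟨q, h⟩ : Fin r) ∈ A.start then 1 else 0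
  | .isFinal, q, _, _ => if ∃ h : q < r, (⟨q, h⟩ : Fin r) ∈ A.accept then 1 else 0

/-- A walk as a sequence of numbers `v₀, e₀, v₁, …, e₍ₖ₋₁₎, vₖ`. -/
def Walk.encode {k n m : ℕ} {D : Database (Fin k) (Fin n) (Fin m)} (w : Walk D) : List ℕ :=
  (w.src : ℕ) :: w.edges.flatMap (fun e : Fin m => [(e : ℕ), (D.tgt e : ℕ)])

/-! ## Memoryless enumeration -/

/-- What the program that computes the next output may read: the arrays left by the
preprocessing, and the length and the entries of the previous output. -/
inductive CallAccessor
  | precomputed (a : ℕ)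
  | prevLength
  | prev

/-- The read-only input of a call: the precomputed arrays `M` and the previous output `u`. -/
def callInput (M : ℕ → ℕ → ℕ) (u : List ℕ) : Input CallAccessor
  | .precomputed a, i, _, _ => M a i
  | .prevLength, _, _, _ => u.length
  | .prev, i, _, _ => u.getD i 0

/-- The answer that precedes position `i` of an enumeration, `none` for `i = 0`. -/
def previous {α : Type*} (l : List α) : ℕ → Option α
  | 0 => none
  | i + 1 => l[i]?

/-- On machines with words of `w` bits, the programs `prep` and `next` enumerate the set `S`
without duplicates and without memory. The preprocessing `prep` reads the input and computes
arrays, which are never modified later. Each call of `next` reads only these arrays and the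
previous output (an empty sequence for the first call), works on registers and arrays of its own
whose initial content is arbitrary, and writes the next output (an empty sequence if there is
none). Each call takes at most `delay` steps, and the preprocessing and the first call together
take at most `prepTime` steps. The function `enc` encodes answers as nonempty sequences. -/
def MemorylessEnumerates {ι : Type} {α : Type*} (w : ℕ) (inp : Input ι) (prep : Prog ι)
    (next : Prog CallAccessor) (S : Set α) (enc : α → List ℕ) (prepTime delay : ℕ) : Prop :=
  ∃ (σ₀ : State) (n₀ : ℕ) (l : List α),
    Exec w inp prep State.zero σ₀ n₀ ∧ σ₀.out = [] ∧
    l.Nodup ∧ (∀ x, x ∈ l ↔ x ∈ S) ∧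
    ∀ i ≤ l.length, ∀ σ : State, σ.out = [] →
      ∃ (σ' : State) (n : ℕ),
        Exec w (callInput σ₀.mem ((previous l i).elim [] enc)) next σ σ' n ∧
        σ'.out = (l[i]?).elim [] enc ∧
        n ≤ delay ∧
        (i = 0 → n₀ + n ≤ prepTime)

/-!
The product of the database and the automaton is searched breadth-first from the pairs `(s, q)`
with `q` initial; this gives distances `d`. An edge of the product is *good* if it joins
consecutive distances (`Good`). Shortest matching walks are the paths of good edges to the final
states at distance `λ` of `t`, but a walk may be the projection of exponentially many such
paths. To list each walk once, it is read backwards, from `t`, and the set of all states that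
may be taken at the current vertex is kept (`Usable`, `back`). The answers are then exactly the
branches of a tree of depth `λ` whose nodes are pairs of a vertex and a set of states, and in
this tree no branch is a dead end (`Live.exists_usable`, `mem_shortestWalks`).

The branches are enumerated in decreasing lexicographic order. The branch after a given one is
obtained at the deepest node where it can be replaced by an edge with a smaller number, followed
by the greatest possible edges (`succ`, `follows_enum`). The sets of states are recomputed from
the root along the previous output, so that nothing but this output has to be remembered. For
the greatest edge `e' < b` that is usable at `(v, S)` one takes the maximum over `q ∈ S` of the
greatest `e' < b` by which shortest paths enter `(v, q)` (`code_pick_exists`). The only bounds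
`b` that occur are `|E|` and, along the previous output, an edge `e` with target `v`; so tables
with `|V| |Q|` and `|E| |Q|` entries suffice. For each edge, the list of the pairs of states
that it joins in good edges is also precomputed; its length is at most the number of
transitions, and each level of the tree costs time `O(|A|)`.

As `λ` may be nearly as large as `|V| |Q|`, the preprocessing has no time to compute sets of
states along a walk, and cannot find the lexicographically first branch. Instead, it finds some
answer by following parents in the product, and the enumeration is the cyclic rotation of the
lexicographic one that starts there (`Follows.rotate`). A call reports the end when it arrives
at this answer again.

Programs are verified with a Hoare logic for total correctness with time bounds (`Runs`).
Arithmetic on words is exact as long as no subexpression overflows (`Fits`, `eval_eq_val`).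
-/

/-! ### Reasoning about programs of the word RAM -/

namespace WordRAM

variable {ι : Type}

-- Numerals and arithmetic operators denote expressions of programs.
instance : Add (Expr ι) := ⟨.op .add⟩
instance : Sub (Expr ι) := ⟨.op .sub⟩
instance : Mul (Expr ι) := ⟨.op .mul⟩
instance (n : ℕ) : OfNat (Expr ι) n := ⟨.lit n⟩

/-- The number of different words of `w` bits. -/
def cap (w : ℕ) : ℕ := 2 ^ w

/-- Sequential composition of programs. -/
infixr:60 " ;; " => Prog.seq

/-- The value of an expression in exact arithmetic, without reduction modulo `2 ^ w`. -/
def val (inp : Input ι) (σ : State) : Expr ι → ℕ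
  | .lit n => n
  | .reg x => σ.reg x
  | .read a i => σ.mem a (val inp σ i)
  | .input k i j l => inp k (val inp σ i) (val inp σ j) (val inp σ l)
  | .op o e₁ e₂ => o.apply (val inp σ e₁) (val inp σ e₂)

/-- No subexpression overflows on words of `w` bits. -/
def Fits (w : ℕ) (inp : Input ι) (σ : State) : Expr ι → Prop
  | .lit n => n < cap w
  | .reg _ => True
  | .read _ i => Fits w inp σ i
  | .input k i j l => Fits w inp σ i ∧ Fits w inp σ j ∧ Fits w inp σ l ∧
      inp k (val inp σ i) (val inp σ j) (val inp σ l) < cap w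
  | .op o e₁ e₂ => Fits w inp σ e₁ ∧ Fits w inp σ e₂ ∧
      o.apply (val inp σ e₁) (val inp σ e₂) < cap w

theorem eval_eq_val {w : ℕ} {inp : Input ι} {σ : State} {e : Expr ι} (h : Fits w inp σ e) :
    e.eval w inp σ = val inp σ e := by
  induction e with
  | lit n => exact Nat.mod_eq_of_lt h
  | reg x => rfl
  | read a i ih => simp only [Expr.eval, val, ih h]
  | input k i j l ih₁ ih₂ ih₃ =>
    simp only [Expr.eval, val, ih₁ h.1, ih₂ h.2.1, ih₃ h.2.2.1]
    exact Nat.mod_eq_of_lt h.2.2.2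
  | op o e₁ e₂ ih₁ ih₂ =>
    simp only [Expr.eval, val, ih₁ h.1, ih₂ h.2.1]
    exact Nat.mod_eq_of_lt h.2.2

section simp_lemmas
variable (w : ℕ) (inp : Input ι) (σ : State) (e f : Expr ι)

@[simp] theorem val_ofNat (n : ℕ) : val inp σ (no_index (OfNat.ofNat n) : Expr ι) = n := rfl
@[simp] theorem val_reg (x : ℕ) : val inp σ (.reg x) = σ.reg x := rfl
@[simp] theorem val_read (a : ℕ) : val inp σ (.read a e) = σ.mem a (val inp σ e) := rfl
@[simp] theorem val_input (k : ι) (i j l : Expr ι) :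
    val inp σ (.input k i j l) = inp k (val inp σ i) (val inp σ j) (val inp σ l) := rfl
@[simp] theorem val_add : val inp σ (e + f) = val inp σ e + val inp σ f := rfl
@[simp] theorem val_sub : val inp σ (e - f) = val inp σ e - val inp σ f := rfl
@[simp] theorem val_mul : val inp σ (e * f) = val inp σ e * val inp σ f := rfl
@[simp] theorem val_eq :
    val inp σ (.op .eq e f) = if val inp σ e = val inp σ f then 1 else 0 := rfl
@[simp] theorem val_lt :
    val inp σ (.op .lt e f) = if val inp σ e < val inp σ f then 1 else 0 := rfl

@[simp] theorem fits_ofNat (n : ℕ) : Fits w inp σ (no_index (OfNat.ofNat n) : Expr ι) ↔ n < cap w :=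
  Iff.rfl
@[simp] theorem fits_reg (x : ℕ) : Fits w inp σ (.reg x) := trivial
@[simp] theorem fits_read (a : ℕ) : Fits w inp σ (.read a e) ↔ Fits w inp σ e := Iff.rfl
@[simp] theorem fits_input (k : ι) (i j l : Expr ι) :
    Fits w inp σ (.input k i j l) ↔ Fits w inp σ i ∧ Fits w inp σ j ∧ Fits w inp σ l ∧
      inp k (val inp σ i) (val inp σ j) (val inp σ l) < cap w := Iff.rfl
@[simp] theorem fits_add : Fits w inp σ (e + f) ↔
    Fits w inp σ e ∧ Fits w inp σ f ∧ val inp σ e + val inp σ f < cap w := Iff.rfl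
@[simp] theorem fits_sub : Fits w inp σ (e - f) ↔
    Fits w inp σ e ∧ Fits w inp σ f ∧ val inp σ e - val inp σ f < cap w := Iff.rfl
@[simp] theorem fits_mul : Fits w inp σ (e * f) ↔
    Fits w inp σ e ∧ Fits w inp σ f ∧ val inp σ e * val inp σ f < cap w := Iff.rfl
@[simp] theorem fits_eq : Fits w inp σ (.op .eq e f) ↔ Fits w inp σ e ∧ Fits w inp σ f ∧
    (if val inp σ e = val inp σ f then 1 else 0) < cap w := Iff.rfl
@[simp] theorem fits_lt : Fits w inp σ (.op .lt e f) ↔ Fits w inp σ e ∧ Fits w inp σ f ∧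
    (if val inp σ e < val inp σ f then 1 else 0) < cap w := Iff.rfl

@[simp] theorem ite_lt_cap (p : Prop) [Decidable p] :
    (if p then 1 else 0) < cap w ↔ (p → 1 < cap w) := by
  have : 0 < cap w := Nat.two_pow_pos w
  split_ifs with h <;> simp [h, this]

@[simp] theorem cost_ofNat (n : ℕ) : (no_index (OfNat.ofNat n) : Expr ι).cost = 1 := rfl
@[simp] theorem cost_reg (x : ℕ) : (Expr.reg x : Expr ι).cost = 1 := rfl
@[simp] theorem cost_read (a : ℕ) : (Expr.read a e).cost = e.cost + 1 := rfl
@[simp] theorem cost_input (k : ι) (i j l : Expr ι) :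
    (Expr.input k i j l).cost = i.cost + j.cost + l.cost + 1 := rfl
@[simp] theorem cost_add : (e + f).cost = e.cost + f.cost + 1 := rfl
@[simp] theorem cost_sub : (e - f).cost = e.cost + f.cost + 1 := rfl
@[simp] theorem cost_mul : (e * f).cost = e.cost + f.cost + 1 := rfl
@[simp] theorem cost_op (o : Op) : (Expr.op o e f).cost = e.cost + f.cost + 1 := rfl

@[simp] theorem setReg_reg (x v y : ℕ) :
    (σ.setReg x v).reg y = if y = x then v else σ.reg y := by
  simp [State.setReg, Function.update_apply]
@[simp] theorem setReg_mem (x v : ℕ) : (σ.setReg x v).mem = σ.mem := rfl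
@[simp] theorem setReg_out (x v : ℕ) : (σ.setReg x v).out = σ.out := rfl
@[simp] theorem setCell_reg (a i v : ℕ) : (σ.setCell a i v).reg = σ.reg := rfl
@[simp] theorem setCell_out (a i v : ℕ) : (σ.setCell a i v).out = σ.out := rfl
@[simp] theorem setCell_mem (a i v b j : ℕ) :
    (σ.setCell a i v).mem b j = if b = a then (if j = i then v else σ.mem a j) else σ.mem b j := by
  unfold State.setCell
  by_cases h : b = a
  · subst h; simp [Function.update_apply]
  · simp [h]
@[simp] theorem write_reg (v : ℕ) : (σ.write v).reg = σ.reg := rfl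
@[simp] theorem write_mem (v : ℕ) : (σ.write v).mem = σ.mem := rfl
@[simp] theorem write_out (v : ℕ) : (σ.write v).out = σ.out ++ [v] := rfl

end simp_lemmas

/-- The registers that a program may change. -/
def assigns : Prog ι → List ℕ
  | .skip => []
  | .assign x _ => [x]
  | .store _ _ _ => []
  | .emit _ => []
  | .seq p q => assigns p ++ assigns q
  | .ite _ p q => assigns p ++ assigns q
  | .loop _ p => assigns p

/-- The arrays that a program may change. -/
def stores : Prog ι → List ℕ
  | .skip => []
  | .assign _ _ => []
  | .store a _ _ => [a]
  | .emit _ => []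
  | .seq p q => stores p ++ stores q
  | .ite _ p q => stores p ++ stores q
  | .loop _ p => stores p

/-- Whether a program may write on the output tape. -/
def emits : Prog ι → Bool
  | .skip => false
  | .assign _ _ => false
  | .store _ _ _ => false
  | .emit _ => true
  | .seq p q => emits p || emits q
  | .ite _ p q => emits p || emits q
  | .loop _ p => emits p

/-- The two states differ at most in those places that `p` may change. -/
structure Frame (p : Prog ι) (σ σ' : State) : Prop where
  reg : ∀ x, x ∉ assigns p → σ'.reg x = σ.reg x
  mem : ∀ a, a ∉ stores p → σ'.mem a = σ.mem a
  out : emits p = false → σ'.out = σ.out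

theorem Frame.refl (p : Prog ι) (σ : State) : Frame p σ σ :=
  ⟨fun _ _ => rfl, fun _ _ => rfl, fun _ => rfl⟩

theorem Frame.trans {p : Prog ι} {σ₁ σ₂ σ₃ : State} (h : Frame p σ₁ σ₂) (h' : Frame p σ₂ σ₃) :
    Frame p σ₁ σ₃ :=
  ⟨fun x hx => (h'.reg x hx).trans (h.reg x hx), fun x hx => (h'.mem x hx).trans (h.mem x hx),
    fun hx => (h'.out hx).trans (h.out hx)⟩

theorem Frame.mono {p q : Prog ι} {σ σ' : State} (h : Frame p σ σ')
    (h₁ : ∀ x ∈ assigns p, x ∈ assigns q) (h₂ : ∀ x ∈ stores p, x ∈ stores q)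
    (h₃ : emits q = false → emits p = false) : Frame q σ σ' :=
  ⟨fun x hx => h.reg x fun hp => hx (h₁ x hp), fun x hx => h.mem x fun hp => hx (h₂ x hp),
    fun hx => h.out (h₃ hx)⟩

/-- What an execution cannot change is read off from the text of the program; invariants of loops
only have to mention the rest. -/
theorem Frame.of_exec {w : ℕ} {inp : Input ι} {p : Prog ι} {σ σ' : State} {n : ℕ}
    (h : Exec w inp p σ σ' n) : Frame p σ σ' := by
  induction h with
  | skip σ => exact .refl _ _
  | assign x e σ =>
    refine ⟨fun y hy => ?_, fun _ _ => rfl, fun _ => rfl⟩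
    simp only [assigns, List.mem_singleton] at hy
    simp [hy]
  | store a i e σ =>
    refine ⟨fun y hy => rfl, fun b hb => ?_, fun _ => rfl⟩
    simp only [stores, List.mem_singleton] at hb
    funext j
    simp [hb]
  | emit e σ => exact ⟨fun _ _ => rfl, fun _ _ => rfl, fun h => by simp [emits] at h⟩
  | seq _ _ ih₁ ih₂ =>
    refine (ih₁.mono ?_ ?_ ?_).trans (ih₂.mono ?_ ?_ ?_) <;> simp +contextual [assigns, stores, emits]
  | ite_true _ _ ih => refine ih.mono ?_ ?_ ?_ <;> simp +contextual [assigns, stores, emits]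
  | ite_false _ _ ih => refine ih.mono ?_ ?_ ?_ <;> simp +contextual [assigns, stores, emits]
  | loop_done _ => exact .refl _ _
  | loop_step _ _ _ ih₁ ih₂ =>
    refine (ih₁.mono ?_ ?_ ?_).trans ih₂ <;> simp +contextual [assigns, stores, emits]

/-- Total correctness with a time bound: started in `σ`, the program `p` halts after at most `T`
steps in a state that satisfies `Q`. -/
def Runs (w : ℕ) (inp : Input ι) (p : Prog ι) (σ : State) (T : ℕ) (Q : State → Prop) : Prop :=
  ∃ σ' n, Exec w inp p σ σ' n ∧ n ≤ T ∧ Q σ'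

section rules
variable {w : ℕ} {inp : Input ι} {p q : Prog ι} {σ : State} {T T' : ℕ} {Q Q' : State → Prop}
  {e : Expr ι}

/-- The rule of consequence; the postcondition may be combined with the frame. -/
theorem Runs.mono (h : Runs w inp p σ T Q) (hT : T ≤ T')
    (hQ : ∀ σ', Frame p σ σ' → Q σ' → Q' σ') : Runs w inp p σ T' Q' := by
  obtain ⟨σ', n, he, hn, hq⟩ := h
  exact ⟨σ', n, he, hn.trans hT, hQ σ' (.of_exec he) hq⟩

theorem Runs.time (h : Runs w inp p σ T Q) (hT : T ≤ T') : Runs w inp p σ T' Q :=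
  h.mono hT fun _ _ => id

theorem Runs.skip (h : Q σ) : Runs w inp .skip σ 1 Q := ⟨σ, 1, .skip σ, le_rfl, h⟩

theorem Runs.assign {x : ℕ} (he : Fits w inp σ e) (h : Q (σ.setReg x (val inp σ e))) :
    Runs w inp (.assign x e) σ (e.cost + 1) Q :=
  ⟨_, _, .assign x e σ, le_rfl, by rwa [eval_eq_val he]⟩

theorem Runs.store {a : ℕ} {i : Expr ι} (hi : Fits w inp σ i) (he : Fits w inp σ e)
    (h : Q (σ.setCell a (val inp σ i) (val inp σ e))) :
    Runs w inp (.store a i e) σ (i.cost + e.cost + 1) Q :=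
  ⟨_, _, .store a i e σ, le_rfl, by rwa [eval_eq_val he, eval_eq_val hi]⟩

theorem Runs.emit (he : Fits w inp σ e) (h : Q (σ.write (val inp σ e))) :
    Runs w inp (.emit e) σ (e.cost + 1) Q :=
  ⟨_, _, .emit e σ, le_rfl, by rwa [eval_eq_val he]⟩

theorem Runs.seq (hp : Runs w inp p σ T Q)
    (hq : ∀ σ', Frame p σ σ' → Q σ' → Runs w inp q σ' T' Q') :
    Runs w inp (p ;; q) σ (T + T') Q' := by
  obtain ⟨σ₁, n₁, h₁, hn₁, hq₁⟩ := hp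
  obtain ⟨σ₂, n₂, h₂, hn₂, hq₂⟩ := hq σ₁ (.of_exec h₁) hq₁
  exact ⟨σ₂, _, .seq h₁ h₂, by omega, hq₂⟩

theorem Runs.assign_seq {x : ℕ} (he : Fits w inp σ e)
    (hq : Runs w inp q (σ.setReg x (val inp σ e)) T Q) :
    Runs w inp (.assign x e ;; q) σ (e.cost + 1 + T) Q :=
  Runs.seq (Q := fun σ' => σ' = σ.setReg x (val inp σ e)) (.assign he rfl)
    fun _ _ h => h ▸ hq

theorem Runs.store_seq {a : ℕ} {i : Expr ι} (hi : Fits w inp σ i) (he : Fits w inp σ e)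
    (hq : Runs w inp q (σ.setCell a (val inp σ i) (val inp σ e)) T Q) :
    Runs w inp (.store a i e ;; q) σ (i.cost + e.cost + 1 + T) Q :=
  Runs.seq (Q := fun σ' => σ' = σ.setCell a (val inp σ i) (val inp σ e)) (.store hi he rfl)
    fun _ _ h => h ▸ hq

theorem Runs.emit_seq (he : Fits w inp σ e)
    (hq : Runs w inp q (σ.write (val inp σ e)) T Q) :
    Runs w inp (.emit e ;; q) σ (e.cost + 1 + T) Q :=
  Runs.seq (Q := fun σ' => σ' = σ.write (val inp σ e)) (.emit he rfl) fun _ _ h => h ▸ hq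

theorem Runs.ite (he : Fits w inp σ e) (hp : val inp σ e ≠ 0 → Runs w inp p σ T Q)
    (hq : val inp σ e = 0 → Runs w inp q σ T' Q) :
    Runs w inp (.ite e p q) σ (e.cost + 1 + max T T') Q := by
  by_cases h : val inp σ e = 0
  · obtain ⟨σ', n, hx, hn, h'⟩ := hq h
    exact ⟨σ', _, .ite_false (by rwa [eval_eq_val he]) hx, by omega, h'⟩
  · obtain ⟨σ', n, hx, hn, h'⟩ := hp h
    exact ⟨σ', _, .ite_true (by rwa [eval_eq_val he]) hx, by omega, h'⟩

/-- While loops: the potential `Φ` of the ghost state `g` pays for the iterations, and thereby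
also shows that the loop terminates. -/
theorem Runs.loop {G : Type*} {Inv : G → State → Prop} {Φ T : G → ℕ} {g : G} (h : Inv g σ)
    (he : ∀ g σ', Inv g σ' → Fits w inp σ' e)
    (hs : ∀ g σ', Inv g σ' → Frame p σ σ' → val inp σ' e ≠ 0 →
      Runs w inp p σ' (T g) (fun σ'' => ∃ g', Inv g' σ'' ∧ T g + e.cost + 1 + Φ g' ≤ Φ g)) :
    Runs w inp (.loop e p) σ (Φ g + e.cost + 1)
      (fun σ' => ∃ g', Inv g' σ' ∧ val inp σ' e = 0) := by
  suffices H : ∀ N g σ', Φ g ≤ N → Inv g σ' → Frame p σ σ' →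
      Runs w inp (.loop e p) σ' (Φ g + e.cost + 1)
        (fun σ' => ∃ g', Inv g' σ' ∧ val inp σ' e = 0) from
    H (Φ g) g σ le_rfl h (.refl _ _)
  intro N
  induction N with
  | zero =>
    intro g σ' hN hi hf
    by_cases hv : val inp σ' e = 0
    · exact ⟨σ', _, .loop_done (by rwa [eval_eq_val (he g σ' hi)]), by omega, g, hi, hv⟩
    · obtain ⟨_, _, _, _, _, _, h⟩ := hs g σ' hi hf hv
      omega
  | succ N ih =>
    intro g σ' hN hi hf
    by_cases hv : val inp σ' e = 0
    · exact ⟨σ', _, .loop_done (by rwa [eval_eq_val (he g σ' hi)]), by omega, g, hi, hv⟩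
    · obtain ⟨σ₂, n₂, hx₂, hn₂, g', hi', hg'⟩ := hs g σ' hi hf hv
      obtain ⟨σ₃, n₃, hx₃, hn₃, h₃⟩ := ih g' σ₂ (by omega) hi' (hf.trans (.of_exec hx₂))
      exact ⟨σ₃, _, .loop_step (by rwa [eval_eq_val (he g σ' hi)]) hx₂ hx₃, by omega, h₃⟩

/-- `for x < e do p` -/
def forLt (x : ℕ) (e : Expr ι) (p : Prog ι) : Prog ι :=
  .assign x 0 ;; .loop (.op .lt (.reg x) e) (p ;; .assign x (.reg x + 1))

/-- For loops; `T i` bounds the time of the `i`-th execution of the body, and `7` further steps are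
spent on the test and on the increment of the counter. -/
theorem Runs.forLt {x B : ℕ} {Inv : ℕ → State → Prop} {T : ℕ → ℕ} (hB : B < cap w)
    (h0 : Inv 0 (σ.setReg x 0))
    (he : ∀ i σ', i ≤ B → Frame (WordRAM.forLt x e p) σ σ' → Inv i σ' →
      Fits w inp σ' e ∧ val inp σ' e = B)
    (hs : ∀ i σ', i < B → Frame (WordRAM.forLt x e p) σ σ' → Inv i σ' → σ'.reg x = i →
      Runs w inp p σ' (T i) (fun σ'' => Inv (i + 1) (σ''.setReg x (i + 1))))
    (hx : x ∉ assigns p) :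
    Runs w inp (WordRAM.forLt x e p) σ
      (∑ i ∈ Finset.range B, (T i + e.cost + 7) + e.cost + 5) (fun σ' => Inv B σ') := by
  have h0w : 0 < cap w := Nat.two_pow_pos w
  have hfr : Frame (WordRAM.forLt x e p) σ (σ.setReg x 0) := by
    refine ⟨fun y hy => ?_, fun _ _ => rfl, fun _ => rfl⟩
    have : y ≠ x := by rintro rfl; simp [WordRAM.forLt, assigns] at hy
    simp [this]
  have key := Runs.loop (w := w) (inp := inp) (p := p ;; .assign x (.reg x + 1))
    (e := .op .lt (.reg x) e) (σ := σ.setReg x 0)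
    (Inv := fun i σ' => i ≤ B ∧ σ'.reg x = i ∧ Inv i σ' ∧ Frame (WordRAM.forLt x e p) σ σ')
    (Φ := fun i => ∑ j ∈ Finset.Ico i B, (T j + e.cost + 7)) (T := fun i => T i + 4) (g := 0)
    ⟨Nat.zero_le _, by simp, h0, hfr⟩
    (by
      rintro i σ' ⟨hi, hxi, hI, hf⟩
      obtain ⟨h₁, h₂⟩ := he i σ' hi hf hI
      simp only [fits_lt, fits_reg, h₁, true_and]
      split
      · omega
      · exact h0w)
    (by
      rintro i σ' ⟨hi, hxi, hI, hf⟩ - hv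
      obtain ⟨h₁, h₂⟩ := he i σ' hi hf hI
      simp only [val_lt, val_reg, hxi, h₂, ne_eq, ite_eq_right_iff, one_ne_zero, imp_false,
        not_not] at hv
      refine Runs.seq ((hs i σ' hv hf hI hxi).mono le_rfl
        (Q' := fun σ'' => σ''.reg x = i ∧ Inv (i + 1) (σ''.setReg x (i + 1)) ∧
          Frame (WordRAM.forLt x e p) σ σ'') ?_) ?_
      · intro σ'' hf' h
        refine ⟨(hf'.reg x hx).trans hxi, h, hf.trans (hf'.mono ?_ ?_ ?_)⟩ <;>
          simp +contextual [WordRAM.forLt, assigns, stores, emits]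
      · rintro σ'' - ⟨h1, h2, h3⟩
        refine Runs.assign (by simp [h1]; omega) ⟨i + 1, ⟨hv, by simp [h1], by simpa [h1] using h2,
          h3.trans ?_⟩, ?_⟩
        · refine ⟨fun y hy => ?_, fun _ _ => rfl, fun _ => rfl⟩
          have : y ≠ x := by rintro rfl; simp [WordRAM.forLt, assigns] at hy
          simp [this]
        · simp only [cost_op, cost_reg]
          rw [Finset.sum_eq_sum_Ico_succ_bot hv]
          omega)
  refine (Runs.assign_seq (by simpa using h0w) (T := ∑ i ∈ Finset.range B, (T i + e.cost + 7) +
    e.cost + 3) ?_).mono (by simp only [cost_ofNat]; omega) fun _ _ => id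
  refine key.mono (by simp only [Finset.range_eq_Ico, cost_op, cost_reg]; omega) ?_
  rintro σ' - ⟨i, ⟨hi, hxi, hI, hf⟩, hv⟩
  obtain ⟨h₁, h₂⟩ := he i σ' hi hf hI
  simp only [val_lt, val_reg, hxi, h₂, ite_eq_right_iff, one_ne_zero, imp_false, not_lt] at hv
  obtain rfl : i = B := by omega
  exact hI

/-- The default value `0` does not occur, as all positions are in range. -/
theorem sum_range_getElem {α : Type*} (T : α → ℕ) (h : ℕ → ℕ) (l : List α) :
    ∑ i ∈ Finset.range l.length, h (if hi : i < l.length then T l[i] else 0) =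
      (l.map fun y => h (T y)).sum := by
  induction l with
  | nil => simp
  | cons a l ih => simp [Finset.sum_range_succ', ← ih, add_comm]

/-- A for loop over the positions of a list that performs a fold over the list. -/
theorem Runs.forFold {G α : Type*} {Rep : G → State → Prop} {f : G → α → G} {l : List α} {g : G}
    {T : α → ℕ} {x : ℕ} (hl : l.length < cap w) (h0 : Rep g σ)
    (hR : ∀ g σ v, Rep g σ → Rep g (σ.setReg x v))
    (he : ∀ g σ', Frame (WordRAM.forLt x e p) σ σ' → Rep g σ' →
      Fits w inp σ' e ∧ val inp σ' e = l.length)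
    (hs : ∀ i (hi : i < l.length) g σ', Frame (WordRAM.forLt x e p) σ σ' → Rep g σ' →
      σ'.reg x = i → Runs w inp p σ' (T l[i]) (Rep (f g l[i])))
    (hx : x ∉ assigns p) :
    Runs w inp (WordRAM.forLt x e p) σ
      ((l.map fun y => T y + e.cost + 7).sum + e.cost + 5) (Rep (l.foldl f g)) := by
  have := Runs.forLt (w := w) (inp := inp) (σ := σ) (e := e) (p := p) (x := x) (B := l.length)
    (Inv := fun i => Rep ((l.take i).foldl f g))
    (T := fun i => if h : i < l.length then T l[i] else 0)
    hl (hR _ _ _ (by simpa using h0)) (fun i σ' _ hf h => he _ σ' hf h)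
    (fun i σ' hi hf h hxi => by
      refine ((hs i hi _ σ' hf h hxi).mono (by simp [hi]) ?_)
      intro σ'' _ h
      refine hR _ _ _ ?_
      rw [List.take_succ_eq_append_getElem hi, List.foldl_append]
      exact h) hx
  rw [List.take_length] at this
  refine this.time (le_of_eq ?_)
  rw [sum_range_getElem (fun y => T y) (fun y => y + e.cost + 7) l]

end rules

/-- A for loop over the positions of a list `l` that extends a list `g` by the lists `h y`,
for `y` in `l`. -/
theorem Runs.forAppend {ι : Type} {w : ℕ} {inp : Input ι} {p : Prog ι} {σ : State} {e : Expr ι}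
    {α β : Type*} {Rep : List β → State → Prop} {h : α → List β} {l : List α}
    {g : List β} {T : α → ℕ} {x : ℕ} (hl : l.length < cap w) (h0 : Rep g σ)
    (hR : ∀ g σ v, Rep g σ → Rep g (σ.setReg x v))
    (he : ∀ g σ', Frame (WordRAM.forLt x e p) σ σ' → Rep g σ' →
      Fits w inp σ' e ∧ val inp σ' e = l.length)
    (hs : ∀ i (hi : i < l.length) g' σ', Frame (WordRAM.forLt x e p) σ σ' →
      (g' ++ h l[i]).length ≤ (g ++ l.flatMap h).length → Rep g' σ' →
      σ'.reg x = i → Runs w inp p σ' (T l[i]) (Rep (g' ++ h l[i])))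
    (hx : x ∉ assigns p) :
    Runs w inp (WordRAM.forLt x e p) σ
      ((l.map fun y => T y + e.cost + 7).sum + e.cost + 5) (Rep (g ++ l.flatMap h)) := by
  have := Runs.forLt (w := w) (inp := inp) (σ := σ) (e := e) (p := p) (x := x) (B := l.length)
    (Inv := fun i => Rep (g ++ (l.take i).flatMap h))
    (T := fun i => if h : i < l.length then T l[i] else 0)
    hl (hR _ _ _ (by simpa using h0)) (fun i σ' _ hf h => he _ σ' hf h)
    (fun i σ' hi hf h' hxi => by
      have h1 : g ++ (l.take (i + 1)).flatMap h = (g ++ (l.take i).flatMap h) ++ h l[i] := by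
        rw [List.take_succ_eq_append_getElem hi, List.flatMap_append]
        simp
      refine ((hs i hi _ σ' hf ?_ h' hxi).mono (by simp [hi]) ?_)
      · rw [← h1]
        nth_rw 2 [← List.take_append_drop (i + 1) l]
        rw [List.flatMap_append]
        simp only [List.length_append]
        omega
      · intro σ'' _ h''
        refine hR _ _ _ ?_
        rwa [h1]) hx
  rw [List.take_length] at this
  refine this.time (le_of_eq ?_)
  rw [sum_range_getElem (fun y => T y) (fun y => y + e.cost + 7) l]

end WordRAM

/-! ### Depth-first enumeration of the leaves of a tree -/

namespace TreeEnum

/-- `Follows f l z`: the function `f` maps every entry of `l` to the next one, and the last entry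
to `z`. -/
def Follows {β : Type*} (f : β → Option β) : List β → Option β → Prop
  | [], _ => True
  | a :: l, z => f a = l.head?.or z ∧ Follows f l z

section Follows
variable {β γ : Type*} {f g : β → Option β}

theorem follows_append {l₁ l₂ : List β} {z : Option β} :
    Follows f (l₁ ++ l₂) z ↔ Follows f l₁ (l₂.head?.or z) ∧ Follows f l₂ z := by
  induction l₁ with
  | nil => simp [Follows]
  | cons a l ih => cases l <;> simp_all [Follows, and_assoc]

theorem Follows.getElem {l : List β} {z : Option β} (h : Follows f l z) (i : ℕ)
    (hi : i < l.length) : f l[i] = (l[i + 1]?).or z := by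
  induction l generalizing i with
  | nil => simp at hi
  | cons a l ih =>
    cases i with
    | zero => simpa [List.head?_eq_getElem?] using h.1
    | succ i => simpa using ih h.2 i (by simpa using hi)

theorem Follows.congr {l : List β} {z z' : Option β} (h : Follows f l z)
    (hg : ∀ a ∈ l, ∀ b, f a = some b → g a = some b) (hz : ∀ a ∈ l, f a = z → g a = z') :
    Follows g l z' := by
  induction l with
  | nil => trivial
  | cons a l ih =>
    refine ⟨?_, ih h.2 (fun b hb => hg b (by simp [hb])) fun b hb => hz b (by simp [hb])⟩
    cases l with
    | nil => simpa using hz a (by simp) (by simpa using h.1)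
    | cons b l => simpa using hg a (by simp) b (by simpa using h.1)

theorem Follows.map {f : γ → Option γ} {c : γ → β} {l : List γ} {z : Option β}
    (h : Follows f l none) (hg : ∀ a ∈ l, g (c a) = ((f a).map c).or z) :
    Follows g (l.map c) z := by
  induction l with
  | nil => trivial
  | cons a l ih =>
    refine ⟨?_, ih h.2 fun b hb => hg b (by simp [hb])⟩
    rw [hg a (by simp), h.1]
    cases l <;> simp

/-- Cyclic enumerations may start anywhere: if `l` is enumerated by `f`, and `x` is in `l`, then a
rotation of `l` that starts with `x` is enumerated by the function which continues with the first
entry of `l` after the last one, and this leads back to `x` in the end. -/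
theorem Follows.rotate {l : List β} {a x : β} (h : Follows f l none) (ha : l.head? = some a)
    (hx : x ∈ l) : ∃ l', List.Perm l' l ∧ l'.head? = some x ∧
      Follows (fun y => some ((f y).getD a)) l' (some x) := by
  obtain ⟨l₁, l₂, rfl⟩ := List.append_of_mem hx
  obtain ⟨h₁, h₂⟩ := follows_append.1 h
  refine ⟨x :: l₂ ++ l₁, List.perm_append_comm, by simp, follows_append.2 ⟨?_, ?_⟩⟩
  · refine h₂.congr (fun b _ c hc => by simp [hc]) (fun b _ hb => ?_)
    cases l₁ <;> simp_all
  · exact h₁.congr (fun b _ c hc => by simp [hc]) (fun b _ hb => by simp_all)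

end Follows

variable {m : ℕ}

open Classical in
/-- The numbers below `b` that satisfy `p`, in decreasing order. -/
noncomputable def below (p : Fin m → Prop) : ℕ → List (Fin m)
  | 0 => []
  | b + 1 => if h : ∃ h : b < m, p ⟨b, h⟩ then ⟨b, h.1⟩ :: below p b else below p b

theorem mem_below {p : Fin m → Prop} {b : ℕ} {e : Fin m} : e ∈ below p b ↔ (e : ℕ) < b ∧ p e := by
  induction b with
  | zero => simp [below]
  | succ b ih =>
    rw [below]
    split_ifs with h
    · rw [List.mem_cons, ih]
      constructor
      · rintro (rfl | h')
        · exact ⟨by simp, h.2⟩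
        · exact ⟨by omega, h'.2⟩
      · rintro ⟨h1, h2⟩
        by_cases hb : (e : ℕ) = b
        · exact .inl (Fin.ext hb)
        · exact .inr ⟨by omega, h2⟩
    · rw [ih]
      constructor
      · exact fun h => ⟨by omega, h.2⟩
      · rintro ⟨h1, h2⟩
        refine ⟨?_, h2⟩
        by_contra hb
        obtain rfl : (e : ℕ) = b := by omega
        exact h ⟨e.2, h2⟩

theorem nodup_below (p : Fin m → Prop) (b : ℕ) : (below p b).Nodup := by
  induction b with
  | zero => simp [below]
  | succ b ih =>
    rw [below]
    split_ifs
    · exact List.nodup_cons.2 ⟨by simp [mem_below], ih⟩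
    · exact ih

/-- The greatest number below `b` that satisfies `p`. -/
noncomputable def pick (p : Fin m → Prop) (b : ℕ) : Option (Fin m) := (below p b).head?

/-- Encoding of an optional number by a number: `0` stands for `none`. -/
def code : Option (Fin m) → ℕ
  | none => 0
  | some e => e + 1

theorem code_le (o : Option (Fin m)) : code o ≤ m := by
  cases o with
  | none => exact Nat.zero_le _
  | some e => exact e.2

theorem pick_succ_of {p : Fin m → Prop} {e : Fin m} (h : p e) :
    pick p (e + 1) = some e := by
  rw [pick, below, dif_pos ⟨e.2, h⟩]
  rfl

theorem pick_succ_of_not {p : Fin m → Prop} {e : Fin m} (h : ¬ p e) :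
    pick p (e + 1) = pick p e := by
  rw [pick, below, dif_neg fun h' => h h'.2]
  rfl

theorem pick_eq_none {p : Fin m → Prop} {b : ℕ} :
    pick p b = none ↔ ∀ e : Fin m, (e : ℕ) < b → ¬ p e := by
  simp [pick, List.eq_nil_iff_forall_not_mem, mem_below]

theorem pick_some {p : Fin m → Prop} {b : ℕ} {e : Fin m} (h : pick p b = some e) :
    (e : ℕ) < b ∧ p e := mem_below.1 (List.mem_of_mem_head? h)

theorem code_pick_le (p : Fin m → Prop) (b : ℕ) : code (pick p b) ≤ b := by
  cases h : pick p b with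
  | none => exact Nat.zero_le _
  | some e => exact (pick_some h).1

/-- The greatest number in a finite union of sets is the maximum of their greatest numbers. -/
theorem code_pick_exists {ι : Type*} (S : Finset ι) (p : ι → Fin m → Prop) (b : ℕ) :
    code (pick (fun e => ∃ i ∈ S, p i e) b) = S.sup fun i => code (pick (p i) b) := by
  induction b with
  | zero =>
    refine Eq.symm (Nat.le_zero.1 (Finset.sup_le fun i _ => ?_))
    exact code_pick_le _ _
  | succ b ih =>
    by_cases hb : b < m
    swap
    · have (q : Fin m → Prop) : pick q (b + 1) = pick q b := by
        rw [pick, below, dif_neg fun h => hb h.1]; rfl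
      simp only [this, ih]
    by_cases h : ∃ i ∈ S, p i ⟨b, hb⟩
    · rw [pick_succ_of (e := ⟨b, hb⟩) h]
      refine le_antisymm ?_ (Finset.sup_le fun i _ => code_pick_le _ _)
      obtain ⟨i, hi, hp⟩ := h
      refine le_trans (le_of_eq ?_) (Finset.le_sup hi)
      rw [pick_succ_of (e := ⟨b, hb⟩) hp]
    · rw [pick_succ_of_not (e := ⟨b, hb⟩) h, ih]
      refine Finset.sup_congr rfl fun i hi => ?_
      rw [pick_succ_of_not (e := ⟨b, hb⟩) fun hp => h ⟨i, hi, hp⟩]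

section Tree
variable {α : Type*} (ok : α → Fin m → Prop) (child : α → Fin m → α)

/-- The branches of length `j` that start in the node `a`, as sequences of edge numbers, in
decreasing lexicographic order. The edges that leave `a` are those with `ok a e`. -/
noncomputable def enum : ℕ → α → List (List (Fin m))
  | 0, _ => [[]]
  | j + 1, a => (below (ok a) m).flatMap fun e => (enum j (child a e)).map (e :: ·)

/-- The first branch: each of its edges is the greatest possible one. -/
noncomputable def first : ℕ → α → List (Fin m)
  | 0, _ => []
  | j + 1, a => match pick (ok a) m with
    | none => []
    | some e => e :: first j (child a e)

/-- The branch after a given one: the last edge that can be replaced by one with a smaller number is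
replaced by the greatest such edge, and then the branch is completed by `first`. -/
noncomputable def succ : ℕ → α → List (Fin m) → Option (List (Fin m))
  | j + 1, a, e :: w => ((succ j (child a e) w).map (e :: ·)).or
      ((pick (ok a) e).map fun e' => e' :: first ok child j (child a e'))
  | _, _, _ => none

variable {ok child}

theorem mem_enum_succ {j : ℕ} {a : α} {u : List (Fin m)} : u ∈ enum ok child (j + 1) a ↔
    ∃ e w, u = e :: w ∧ ok a e ∧ w ∈ enum ok child j (child a e) := by
  simp only [enum, List.mem_flatMap, mem_below, List.mem_map]
  constructor
  · rintro ⟨e, ⟨-, h⟩, w, hw, rfl⟩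
    exact ⟨e, w, rfl, h, hw⟩
  · rintro ⟨e, w, rfl, h, hw⟩
    exact ⟨e, ⟨e.2, h⟩, w, hw, rfl⟩

theorem length_of_mem_enum {j : ℕ} {a : α} {u : List (Fin m)} (h : u ∈ enum ok child j a) :
    u.length = j := by
  induction j generalizing a u with
  | zero => simp_all [enum]
  | succ j ih =>
    obtain ⟨e, w, rfl, -, hw⟩ := mem_enum_succ.1 h
    simp [ih hw]

theorem nodup_enum (j : ℕ) (a : α) : (enum ok child j a).Nodup := by
  induction j generalizing a with
  | zero => simp [enum]
  | succ j ih =>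
    refine List.nodup_flatMap.2 ⟨fun e _ => (ih _).map fun u v h => (List.cons.inj h).2, ?_⟩
    refine (nodup_below _ _).imp fun {e e'} hne => ?_
    intro u hu hu'
    obtain ⟨v, -, rfl⟩ := List.mem_map.1 hu
    obtain ⟨v', -, h⟩ := List.mem_map.1 hu'
    exact hne (List.cons.inj h).1.symm

-- `live j a` excludes dead ends: the node `a` has a branch of length `j`, and all usable edges keep
-- this property.
variable {live : ℕ → α → Prop} (h1 : ∀ j a, live (j + 1) a → ∃ e, ok a e)
  (h2 : ∀ j a e, live (j + 1) a → ok a e → live j (child a e))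
include h1 h2

theorem head_enum {j : ℕ} {a : α} (h : live j a) :
    (enum ok child j a).head? = some (first ok child j a) := by
  induction j generalizing a with
  | zero => rfl
  | succ j ih =>
    obtain ⟨e₀, h₀⟩ := h1 j a h
    rw [enum, first]
    cases hp : pick (ok a) m with
    | none => exact absurd h₀ (pick_eq_none.1 hp e₀ e₀.2)
    | some e =>
      have he := (pick_some hp).2
      rw [pick] at hp
      obtain ⟨t, ht⟩ := List.head?_eq_some_iff.1 hp
      simp [ht, ih (h2 j a e h he)]

theorem head_flatMap {j : ℕ} {a : α} (h : live (j + 1) a) (b : ℕ) :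
    ((below (ok a) b).flatMap fun e => (enum ok child j (child a e)).map (e :: ·)).head? =
      (pick (ok a) b).map fun e => e :: first ok child j (child a e) := by
  cases hp : pick (ok a) b with
  | none =>
    rw [pick, List.head?_eq_none_iff] at hp
    simp [hp]
  | some e =>
    have he := (pick_some hp).2
    rw [pick] at hp
    obtain ⟨t, ht⟩ := List.head?_eq_some_iff.1 hp
    simp [ht, head_enum h1 h2 (h2 j a e h he)]

/-- The function `succ` enumerates the branches, in the order of `enum`. -/
theorem follows_enum {j : ℕ} {a : α} (h : live j a) :
    Follows (succ ok child j a) (enum ok child j a) none := by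
  induction j generalizing a with
  | zero => exact ⟨rfl, trivial⟩
  | succ j ih =>
    -- Only the children of `a` with numbers below `b` are considered, for induction on `b`.
    have key (b : ℕ) : Follows (succ ok child (j + 1) a) ((below (ok a) b).flatMap fun e =>
        (enum ok child j (child a e)).map (e :: ·)) none := by
      induction b with
      | zero => trivial
      | succ b ihb =>
        rw [below]
        split_ifs with hb
        · rw [List.flatMap_cons, follows_append, head_flatMap h1 h2 h]
          refine ⟨(ih (h2 j a _ h hb.2)).map fun u _ => ?_, ihb⟩
          simp [succ]
        · exact ihb
    exact key m

/-- The node reached from `a` along a sequence of edges. -/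
def nodeAt (child : α → Fin m → α) (a : α) (w : List (Fin m)) : α := w.foldl child a

omit h1 h2 in
theorem ok_of_mem_enum {j : ℕ} {a : α} {u : List (Fin m)} (h : u ∈ enum ok child j a) (i : ℕ)
    (hi : i < u.length) : ok (nodeAt child a (u.take i)) u[i] := by
  induction j generalizing a u i with
  | zero =>
    obtain rfl : u = [] := by simpa [enum] using h
    simp at hi
  | succ j ih =>
    obtain ⟨e, w, rfl, he, hw⟩ := mem_enum_succ.1 h
    cases i with
    | zero => exact he
    | succ i => exact ih hw i (by simpa using hi)

omit h1 in
theorem live_nodeAt {j : ℕ} {a : α} {u : List (Fin m)} (h : live j a)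
    (hu : u ∈ enum ok child j a) (i : ℕ) (hi : i ≤ j) :
    live (j - i) (nodeAt child a (u.take i)) := by
  induction j generalizing a u i with
  | zero => simpa [nodeAt, Nat.le_zero.1 hi] using h
  | succ j ih =>
    obtain ⟨e, w, rfl, he, hw⟩ := mem_enum_succ.1 hu
    cases i with
    | zero => exact h
    | succ i => simpa [nodeAt] using ih (h2 j a e h he) hw i (by omega)

theorem first_getElem {j : ℕ} {a : α} (h : live j a) (i : ℕ)
    (hi : i < (first ok child j a).length) :
    pick (ok (nodeAt child a ((first ok child j a).take i))) m = some (first ok child j a)[i] := by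
  induction j generalizing a i with
  | zero => simp [first] at hi
  | succ j ih =>
    obtain ⟨e₀, h₀⟩ := h1 j a h
    cases hp : pick (ok a) m with
    | none => exact absurd h₀ (pick_eq_none.1 hp e₀ e₀.2)
    | some e =>
      have hf : first ok child (j + 1) a = e :: first ok child j (child a e) := by
        simp only [first, hp]
      simp only [hf] at hi ⊢
      cases i with
      | zero => exact hp
      | succ i => exact ih (h2 j a e h (pick_some hp).2) i (by simpa using hi)

omit h1 h2

/-- One step of the search for the deepest node of a branch at which the branch may be replaced
by a later one: `i` is the depth, `a` the node, and `bi`, `be` are the depth and the code of the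
next edge at the deepest such node so far (`be = 0` if there is none). -/
noncomputable def scanStep (ok : α → Fin m → Prop) (child : α → Fin m → α)
    (g : ℕ × α × ℕ × ℕ) (e : Fin m) : ℕ × α × ℕ × ℕ :=
  (g.1 + 1, child g.2.1 e, if code (pick (ok g.2.1) e) ≠ 0 then
    (g.1, code (pick (ok g.2.1) e)) else g.2.2)

theorem foldl_scanStep_fst (w : List (Fin m)) (g : ℕ × α × ℕ × ℕ) :
    (w.foldl (scanStep ok child) g).1 = g.1 + w.length := by
  induction w generalizing g with
  | nil => rfl
  | cons e w ih => simp [ih, scanStep]; omega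

theorem foldl_scanStep_node (w : List (Fin m)) (g : ℕ × α × ℕ × ℕ) :
    (w.foldl (scanStep ok child) g).2.1 = nodeAt child g.2.1 w := by
  induction w generalizing g with
  | nil => rfl
  | cons e w ih => simp [ih, scanStep, nodeAt]

/-- The result of the search along `w` is the depth at which `succ` replaces an edge of `w`, and the
code of the new edge; the initial value `g` is kept if `w` is the last branch. -/
theorem foldl_scanStep (w : List (Fin m)) (i : ℕ) (a : α) (g : ℕ × ℕ) :
    (succ ok child w.length a w = none ∧ (w.foldl (scanStep ok child) (i, a, g)).2.2 = g) ∨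
    ∃ b e, (w.foldl (scanStep ok child) (i, a, g)).2.2 = (i + b, code (some e)) ∧ b < w.length ∧
      succ ok child w.length a w = some (w.take b ++ e ::
        first ok child (w.length - b - 1) (child (nodeAt child a (w.take b)) e)) := by
  induction w generalizing i a g with
  | nil => exact .inl ⟨rfl, rfl⟩
  | cons e w ih =>
    rw [List.foldl_cons, scanStep]
    obtain ⟨h, h'⟩ | ⟨b, e', h, hb, h'⟩ := ih (i + 1) (child a e)
      (if code (pick (ok a) e) ≠ 0 then (i, code (pick (ok a) e)) else g)
    · rw [h']
      cases hp : pick (ok a) e with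
      | none => exact .inl ⟨by simp [succ, h, hp], by simp [code]⟩
      | some e' => exact .inr ⟨0, e', by simp [code], by simp, by simp [succ, h, hp, nodeAt]⟩
    · refine .inr ⟨b + 1, e', ?_, by simpa using hb, ?_⟩
      · rw [h, add_assoc, add_comm 1]
      · simp [succ, h', nodeAt]

include h1 h2 in
/-- Each edge of the branch that follows `w` cyclically can be computed from the node reached so
far and from the result of the search along `w`. -/
theorem edge_of_scan {a : α} {w : List (Fin m)} {i bi be : ℕ} {u : List (Fin m)}
    (h : live w.length a) (hs : (w.foldl (scanStep ok child) (0, a, 0, 0)).2.2 = (bi, be))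
    (hu : u = (succ ok child w.length a w).getD (first ok child w.length a))
    (hmem : u ∈ enum ok child w.length a) (hi : i < w.length) (hi' : i < u.length) :
    (u[i] : ℕ) = if i < bi then (w[i] : ℕ) else if i = bi ∧ be ≠ 0 then be - 1 else
      code (pick (ok (nodeAt child a (u.take i))) m) - 1 := by
  obtain ⟨h₁, h₂⟩ | ⟨b, e, h₁, hb, h₂⟩ :=
    foldl_scanStep (ok := ok) (child := child) w 0 a (0, 0)
  · rw [h₁, Option.getD_none] at hu
    rw [hs, Prod.mk.injEq] at h₂
    subst hu
    simp [h₂, first_getElem h1 h2 h i hi', code]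
  · rw [h₂, Option.getD_some] at hu
    rw [hs, Prod.mk.injEq, zero_add] at h₁
    obtain ⟨rfl, rfl⟩ := h₁
    have hlive := live_nodeAt h2 h hmem (bi + 1) (by omega)
    have htake : u.take (bi + 1) = w.take bi ++ [e] := by
      rw [hu, List.take_append, List.take_take]
      simp [hb.le]
    have hlen : (w.take bi).length = bi := by simp [hb.le]
    obtain hlt | rfl | hgt := lt_trichotomy i bi
    · simp only [hu, hlt, if_true]
      rw [List.getElem_append_left (by omega)]
      simp
    · simp only [hu, lt_irrefl, if_false]
      rw [List.getElem_append_right (by omega)]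
      simp [code, hlen]
    -- Beyond the depth `bi`, the branch `u` continues with the first branch `F` of a subtree.
    · have hn : nodeAt child a (u.take (bi + 1)) = child (nodeAt child a (w.take bi)) e := by
        simp [htake, nodeAt]
      rw [hn, Nat.sub_add_eq] at hlive
      obtain ⟨d, rfl⟩ : ∃ d, i = bi + 1 + d := ⟨i - (bi + 1), by omega⟩
      set F := first ok child (w.length - bi - 1) (child (nodeAt child a (w.take bi)) e) with hF
      have hu2 : u = (w.take bi ++ [e]) ++ F := by simp [hu]
      have hd : d < F.length := by
        have := hi'
        rw [hu2] at this
        simp at this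
        omega
      have h3 := first_getElem h1 h2 hlive d hd
      have h4 : nodeAt child a (u.take (bi + 1 + d)) =
          nodeAt child (child (nodeAt child a (w.take bi)) e) (F.take d) := by
        rw [hu2, List.take_append]
        simp [nodeAt, hlen, List.take_of_length_le]
      have h5 : u[bi + 1 + d] = F[d] := by
        simp only [hu2]
        rw [List.getElem_append_right (by simp; omega)]
        simp [hlen]
      rw [if_neg (by omega), if_neg (by omega), h4, h3, h5]
      simp [code, hF]

end Tree

end TreeEnum

/-! ### Shortest walks as branches of a tree -/

namespace DistinctWalks

open TreeEnum

variable {k n m r : ℕ} (D : Database (Fin k) (Fin n) (Fin m)) (A : NFA (Fin k) (Fin r))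

/-- The automaton may go from `q'` to `q` while the walk passes the edge `e`. -/
def Trans (e : Fin m) (q' q : Fin r) : Prop := ∃ a ∈ D.lbl e, q ∈ A.step q' a

/-- Some walk of length `j` from `s` to the vertex `x.1` takes the automaton to the state `x.2`;
that is, `x` is reached after `j` steps in the product of the database and the automaton. -/
def Reach (s : Fin n) : ℕ → Fin n × Fin r → Prop
  | 0, x => x.1 = s ∧ x.2 ∈ A.start
  | j + 1, x => ∃ e q', Reach s j (D.src e, q') ∧ D.tgt e = x.1 ∧ Trans D A e q' x.2

/-- The function `d` is the distance from the initial pairs in the product, plus `1`; it is `0` on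
unreachable pairs. -/
def IsDist (s : Fin n) (d : Fin n × Fin r → ℕ) : Prop :=
  ∀ x j, d x = j + 1 ↔ Reach D A s j x ∧ ∀ i < j, ¬ Reach D A s i x

/-- The edge `e` and the states `q'`, `q` form an edge of the product that is on a shortest path
from the initial pairs. -/
def Good (d : Fin n × Fin r → ℕ) (e : Fin m) (q' q : Fin r) : Prop :=
  d (D.src e, q') ≠ 0 ∧ d (D.tgt e, q) = d (D.src e, q') + 1 ∧ Trans D A e q' q

/-- Some shortest path to `(v, q)` in the product ends with the edge `e`. -/
def Enters (d : Fin n × Fin r → ℕ) (v : Fin n) (q : Fin r) (e : Fin m) : Prop :=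
  D.tgt e = v ∧ ∃ q', Good D A d e q' q

/-- The nodes of the search tree are pairs of a vertex and a set of states. An edge may be used if
it is the end of a shortest path to one of these states. -/
def Usable (d : Fin n × Fin r → ℕ) (a : Fin n × Finset (Fin r)) (e : Fin m) : Prop :=
  ∃ q ∈ a.2, Enters D A d a.1 q e

open Classical in
/-- The states from which the states of `S` are reached on shortest paths through `e`. -/
noncomputable def pred (d : Fin n × Fin r → ℕ) (e : Fin m) (S : Finset (Fin r)) :
    Finset (Fin r) :=
  {q' | ∃ q ∈ S, Good D A d e q' q}

/-- The search tree goes backwards, from the target of an edge to its source. -/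
noncomputable def back (d : Fin n × Fin r → ℕ) (a : Fin n × Finset (Fin r)) (e : Fin m) :
    Fin n × Finset (Fin r) :=
  (D.src e, pred D A d e a.2)

/-- All states of the node are at distance `j`. -/
def Live (d : Fin n × Fin r → ℕ) (j : ℕ) (a : Fin n × Finset (Fin r)) : Prop :=
  a.2.Nonempty ∧ ∀ q ∈ a.2, d (a.1, q) = j + 1

/-- The sequence `es` is a walk from `s` to `v`, and one of its words leads the automaton to `q`. -/
def RunTo (s : Fin n) (es : List (Fin m)) (v : Fin n) (q : Fin r) : Prop :=
  D.IsWalk s es ∧ es.foldl (fun _ e => D.tgt e) s = v ∧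
    ∃ x, List.Forall₂ (fun a e => a ∈ D.lbl e) x es ∧ q ∈ A.eval x

variable {D A} {s : Fin n} {d : Fin n × Fin r → ℕ}

theorem isWalk_concat {es : List (Fin m)} {e : Fin m} {v : Fin n} :
    D.IsWalk v (es ++ [e]) ↔
      D.IsWalk v es ∧ D.src e = es.foldl (fun _ e => D.tgt e) v := by
  induction es generalizing v with
  | nil => simp [Database.IsWalk]
  | cons f es ih => simp [Database.IsWalk, ih, and_assoc]

theorem runTo_nil {v : Fin n} {q : Fin r} : RunTo D A s [] v q ↔ v = s ∧ q ∈ A.start := by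
  simp [RunTo, Database.IsWalk, eq_comm]

theorem runTo_concat {es : List (Fin m)} {e : Fin m} {v : Fin n} {q : Fin r} :
    RunTo D A s (es ++ [e]) v q ↔
      D.tgt e = v ∧ ∃ q', RunTo D A s es (D.src e) q' ∧ Trans D A e q' q := by
  simp only [RunTo, isWalk_concat, List.foldl_append, List.foldl_cons, List.foldl_nil]
  constructor
  · rintro ⟨⟨h1, h2⟩, h3, x, hx, hq⟩
    obtain ⟨y, z, hy, hz, rfl⟩ : ∃ y z, List.Forall₂ (fun a e => a ∈ D.lbl e) y es ∧
        List.Forall₂ (fun a e => a ∈ D.lbl e) z [e] ∧ x = y ++ z := by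
      have := List.forall₂_iff_zip.1 hx
      exact ⟨_, _, List.forall₂_take_append _ _ _ hx, List.forall₂_drop_append _ _ _ hx,
        (List.take_append_drop _ _).symm⟩
    obtain ⟨a, z', ha, hz', rfl⟩ := List.forall₂_cons_right_iff.1 hz
    obtain rfl := List.forall₂_nil_right_iff.1 hz'
    rw [NFA.eval_append_singleton, NFA.mem_stepSet] at hq
    obtain ⟨q', hq', hq⟩ := hq
    exact ⟨h3, q', ⟨h1, h2.symm, y, hy, hq'⟩, a, ha, hq⟩
  · rintro ⟨h3, q', ⟨h1, h2, y, hy, hq'⟩, a, ha, hq⟩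
    refine ⟨⟨h1, h2.symm⟩, h3, y ++ [a], List.rel_append hy (.cons ha .nil), ?_⟩
    rw [NFA.eval_append_singleton, NFA.mem_stepSet]
    exact ⟨q', hq', hq⟩

theorem reach_iff {j : ℕ} {x : Fin n × Fin r} :
    Reach D A s j x ↔ ∃ es : List (Fin m), es.length = j ∧ RunTo D A s es x.1 x.2 := by
  induction j generalizing x with
  | zero => simp [Reach, runTo_nil]
  | succ j ih =>
    constructor
    · rintro ⟨e, q', h, ht, hq⟩
      obtain ⟨es, hl, hr⟩ := ih.1 h
      exact ⟨es ++ [e], by simp [hl], runTo_concat.2 ⟨ht, q', hr, hq⟩⟩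
    · rintro ⟨es, hl, h⟩
      obtain rfl | ⟨es, e, rfl⟩ := List.eq_nil_or_concat' es
      · simp at hl
      · obtain ⟨ht, q', h, hq⟩ := runTo_concat.1 h
        exact ⟨e, q', ih.2 ⟨es, by simpa using hl, h⟩, ht, hq⟩

/-- On a path of the product whose length is the distance of its end, the distances increase by
`1` along each edge. -/
theorem IsDist.good (hd : IsDist D A s d) {e : Fin m} {q' q : Fin r} {j : ℕ}
    (h : Reach D A s j (D.src e, q')) (ht : Trans D A e q' q) (hq : d (D.tgt e, q) = j + 2) :
    Good D A d e q' q := by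
  have : d (D.src e, q') = j + 1 := by
    refine (hd _ _).2 ⟨h, fun i hi hr => ?_⟩
    exact ((hd _ _).1 hq).2 (i + 1) (by omega) ⟨e, q', hr, rfl, ht⟩
  exact ⟨by omega, by omega, ht⟩

/-- The search tree has no dead ends: shortest paths can be prolonged backwards to the initial
pairs. -/
theorem Live.exists_usable (hd : IsDist D A s d) {j : ℕ} {a : Fin n × Finset (Fin r)}
    (h : Live d (j + 1) a) : ∃ e, Usable D A d a e := by
  obtain ⟨q, hq⟩ := h.1
  have := h.2 q hq
  obtain ⟨e, q', hr, ht, htr⟩ := ((hd _ _).1 this).1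
  simp only at ht
  exact ⟨e, q, hq, ht, q', hd.good hr htr (by rw [ht]; exact this)⟩

theorem Live.back {j : ℕ} {a : Fin n × Finset (Fin r)} {e : Fin m} (h : Live d (j + 1) a)
    (he : Usable D A d a e) : Live d j (back D A d a e) := by
  obtain ⟨q, hq, ht, q', hg⟩ := he
  refine ⟨⟨q', by simpa [DistinctWalks.back, pred] using ⟨q, hq, hg⟩⟩, fun p hp => ?_⟩
  obtain ⟨q₁, hq₁, hg₁⟩ : ∃ q ∈ a.2, Good D A d e p q := by
    simpa [DistinctWalks.back, pred] using hp
  have h1 := h.2 q₁ hq₁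
  have h2 := hg₁.2.1
  rw [ht] at h2
  simp only [DistinctWalks.back]
  omega

/-- The branches of a live node are the walks, backwards, that lead to one of its states. Each walk
is one branch, however many runs of the automaton it has, as a node keeps all states. -/
theorem mem_enum_iff (hd : IsDist D A s d) {j : ℕ} {a : Fin n × Finset (Fin r)}
    (h : Live d j a) {u : List (Fin m)} : u ∈ enum (Usable D A d) (back D A d) j a ↔
      u.length = j ∧ ∃ q ∈ a.2, RunTo D A s u.reverse a.1 q := by
  induction j generalizing a u with
  | zero =>
    simp only [enum, List.mem_singleton, List.length_eq_zero_iff]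
    constructor
    · rintro rfl
      obtain ⟨q, hq⟩ := h.1
      exact ⟨rfl, q, hq, runTo_nil.2 ((hd _ _).1 (h.2 q hq)).1⟩
    · exact fun h => h.1
  | succ j ih =>
    rw [mem_enum_succ]
    constructor
    · rintro ⟨e, w, rfl, he, hw⟩
      obtain ⟨hl, q', hq', hr⟩ := (ih (h.back he)).1 hw
      obtain ⟨q₁, hq₁, hg₁⟩ : ∃ q ∈ a.2, Good D A d e q' q := by
        simpa [DistinctWalks.back, pred] using hq'
      obtain ⟨-, -, ht, -⟩ := he
      exact ⟨by simp [hl], q₁, hq₁, by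
        rw [List.reverse_cons]; exact runTo_concat.2 ⟨ht, q', hr, hg₁.2.2⟩⟩
    · rintro ⟨hl, q, hq, hr⟩
      cases u with
      | nil => simp at hl
      | cons e w =>
        rw [List.reverse_cons, runTo_concat] at hr
        obtain ⟨ht, q', hr, htr⟩ := hr
        have hlw : w.length = j := by simpa using hl
        have hg : Good D A d e q' q := hd.good (reach_iff.2 ⟨_, by simpa using hlw, hr⟩) htr
          (by rw [ht]; exact h.2 q hq)
        have hu : Usable D A d a e := ⟨q, hq, ht, q', hg⟩
        exact ⟨e, w, rfl, hu, (ih (h.back hu)).2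
          ⟨hlw, q', by simpa [DistinctWalks.back, pred] using ⟨q, hq, hg⟩, hr⟩⟩

theorem mem_matchingWalks {t : Fin n} {w : Walk D} : w ∈ matchingWalks D A s t ↔
    w.src = s ∧ ∃ q ∈ A.accept, RunTo D A s w.edges t q := by
  obtain ⟨v, es, hw⟩ := w
  simp only [matchingWalks, Set.mem_ofPred_eq, Walk.Matches, Walk.lbl, Walk.tgt, RunTo,
    NFA.mem_accepts]
  constructor
  · rintro ⟨⟨x, hx, q, hq, hx'⟩, rfl, ht⟩
    exact ⟨rfl, q, hq, hw, ht, x, hx, hx'⟩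
  · rintro ⟨rfl, q, hq, -, ht, x, hx, hx'⟩
    exact ⟨⟨x, hx, q, hq, hx'⟩, rfl, ht⟩

theorem shortestWalks_eq_empty (hd : IsDist D A s d) {t : Fin n}
    (h : ∀ f ∈ A.accept, d (t, f) = 0) : shortestWalks D A s t = ∅ := by
  refine Set.eq_empty_of_forall_notMem fun w hw => ?_
  obtain ⟨-, q, hq, hr⟩ := mem_matchingWalks.1 hw.1
  have hex : ∃ j, Reach D A s j (t, q) := ⟨_, reach_iff.2 ⟨_, rfl, hr⟩⟩
  classical
  have := (hd (t, q) (Nat.find hex)).2 ⟨Nat.find_spec hex, fun i hi => Nat.find_min hex hi⟩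
  rw [h q hq] at this
  omega

/-- The final states at distance `l` of `t`. -/
noncomputable def finals (A : NFA (Fin k) (Fin r)) (d : Fin n × Fin r → ℕ) (t : Fin n) (l : ℕ) :
    Finset (Fin r) :=
  open Classical in {f | f ∈ A.accept ∧ d (t, f) = l + 1}

theorem live_finals {t : Fin n} {l : ℕ} (h : ∃ f ∈ A.accept, d (t, f) = l + 1) :
    Live d l (t, finals A d t l) := by
  obtain ⟨f, hf, h⟩ := h
  exact ⟨⟨f, by simp [finals, hf, h]⟩, fun q hq => by simp_all [finals]⟩

theorem shortestLength_eq (hd : IsDist D A s d) {t : Fin n} {l : ℕ}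
    (h : ∃ f ∈ A.accept, d (t, f) = l + 1)
    (hl : ∀ f ∈ A.accept, d (t, f) ≠ 0 → l + 1 ≤ d (t, f)) :
    shortestLength D A s t = l := by
  obtain ⟨f, hf, hdf⟩ := h
  refine IsLeast.csInf_eq ⟨?_, ?_⟩
  · obtain ⟨es, hlen, hr⟩ := reach_iff.1 ((hd _ _).1 hdf).1
    exact ⟨⟨s, es, hr.1⟩, mem_matchingWalks.2 ⟨rfl, f, hf, hr⟩, hlen⟩
  · rintro _ ⟨w, hw, rfl⟩
    obtain ⟨-, q, hq, hr⟩ := mem_matchingWalks.1 hw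
    have hex : ∃ j, Reach D A s j (t, q) := ⟨_, reach_iff.2 ⟨_, rfl, hr⟩⟩
    classical
    have h1 := (hd (t, q) (Nat.find hex)).2 ⟨Nat.find_spec hex, fun i hi => Nat.find_min hex hi⟩
    have h2 := hl q hq (by omega)
    have h3 : Nat.find hex ≤ w.len := Nat.find_min' hex (reach_iff.2 ⟨_, rfl, hr⟩)
    omega

/-- The answers, with their edges backwards, are the branches of the search tree. -/
theorem mem_shortestWalks (hd : IsDist D A s d) {t : Fin n} {l : ℕ}
    (h : ∃ f ∈ A.accept, d (t, f) = l + 1)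
    (hl : ∀ f ∈ A.accept, d (t, f) ≠ 0 → l + 1 ≤ d (t, f)) {w : Walk D} :
    w ∈ shortestWalks D A s t ↔ w.src = s ∧
      w.edges.reverse ∈ enum (Usable D A d) (back D A d) l (t, finals A d t l) := by
  rw [shortestWalks, Set.mem_ofPred_eq, mem_matchingWalks, shortestLength_eq hd h hl,
    mem_enum_iff hd (live_finals h)]
  simp only [List.length_reverse, List.reverse_reverse, Walk.len]
  constructor
  · rintro ⟨⟨h1, q, hq, hr⟩, rfl⟩
    refine ⟨h1, rfl, q, ?_, hr⟩
    have : Reach D A s w.edges.length (t, q) := reach_iff.2 ⟨_, rfl, hr⟩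
    simp only [finals, Finset.mem_filter, Finset.mem_univ, true_and]
    refine ⟨hq, (hd _ _).2 ⟨this, fun i hi hi' => ?_⟩⟩
    classical
    have hex : ∃ j, Reach D A s j (t, q) := ⟨_, hi'⟩
    have h1 := (hd (t, q) (Nat.find hex)).2 ⟨Nat.find_spec hex, fun i hi => Nat.find_min hex hi⟩
    have h2 := hl q hq (by omega)
    have h3 : Nat.find hex ≤ i := Nat.find_min' hex hi'
    omega
  · rintro ⟨h1, h2, q, hq, hr⟩
    simp only [finals, Finset.mem_filter] at hq
    exact ⟨⟨h1, q, hq.2.1, hr⟩, h2⟩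

end DistinctWalks

/-! ### The program that computes the next answer -/

namespace DistinctWalks

open TreeEnum WordRAM

/-- Precomputed arrays: parameters `λ + 1` (or `0`), `|Q|`, `t`, `s`. -/
abbrev tParam : ℕ := 0
/-- Precomputed array: the source of each edge. -/
abbrev tSrc : ℕ := 1
/-- Precomputed array: the target of each edge. -/
abbrev tTgt : ℕ := 2
/-- Precomputed array: the final states at distance `λ` of `t`. -/
abbrev tFin : ℕ := 3
/-- Precomputed array: the last edge that enters a pair, at position `v * |Q| + q`. -/
abbrev tLast : ℕ := 4
/-- Precomputed array: the last edge before `e` that enters a pair, at position `e * |Q| + q`. -/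
abbrev tPrv : ℕ := 5
/-- Precomputed array: where the list of pairs of an edge starts in `tFrom` and `tTo`. -/
abbrev tStart : ℕ := 6
/-- Precomputed array: where the list of pairs of an edge ends in `tFrom` and `tTo`. -/
abbrev tEnd : ℕ := 7
/-- Precomputed array: the first components of the pairs. -/
abbrev tFrom : ℕ := 8
/-- Precomputed array: the second components of the pairs. -/
abbrev tTo : ℕ := 9
/-- Precomputed array: the edges of the first answer, backwards. -/
abbrev tFirst : ℕ := 10

variable {k n m r : ℕ} (D : Database (Fin k) (Fin n) (Fin m)) (A : NFA (Fin k) (Fin r))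

/-- What the arrays `M` contain after the preprocessing if there is an answer. All relevant
numbers are at most `B`, and `P e` is a list of the pairs `(q', q)` with `Good D A d e q' q`; it has
at most `C` entries. The sequence `w₁` is the first answer, backwards. -/
structure Tables (s t : Fin n) (d : Fin n × Fin r → ℕ) (l B C : ℕ) (w₁ : List (Fin m))
    (P : Fin m → List (Fin r × Fin r)) (M : ℕ → ℕ → ℕ) : Prop where
  param0 : M tParam 0 = l + 1
  param1 : M tParam 1 = r
  param2 : M tParam 2 = t
  param3 : M tParam 3 = s
  src : ∀ e : Fin m, M tSrc e = D.src e
  tgt : ∀ e : Fin m, M tTgt e = D.tgt e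
  fin : ∀ q : Fin r, M tFin q = if q ∈ finals A d t l then 1 else 0
  last : ∀ (v : Fin n) (q : Fin r), M tLast (v * r + q) = code (pick (Enters D A d v q) m)
  prv : ∀ (e : Fin m) (q : Fin r),
    M tPrv (e * r + q) = code (pick (Enters D A d (D.tgt e) q) e)
  tend : ∀ e : Fin m, M tEnd e = M tStart e + (P e).length
  tendB : ∀ e : Fin m, M tEnd e ≤ B
  lengthP : ∀ e : Fin m, (P e).length ≤ C
  tfrom : ∀ (e : Fin m) (i : ℕ) (h : i < (P e).length), M tFrom (M tStart e + i) = (P e)[i].1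
  tto : ∀ (e : Fin m) (i : ℕ) (h : i < (P e).length), M tTo (M tStart e + i) = (P e)[i].2
  memP : ∀ (e : Fin m) (q' q : Fin r), (q', q) ∈ P e ↔ Good D A d e q' q
  lengthF : w₁.length = l
  first : ∀ (i : ℕ) (h : i < w₁.length), M tFirst i = w₁[i]

/-- The numbers that the programs compute are at most `B`, and `B` fits in a word. -/
structure Bounds (n m r l B w : ℕ) : Prop where
  nr : n * r ≤ B
  mr : m * r ≤ B
  n : n ≤ B
  m : m ≤ B
  r : r ≤ B
  l : 2 * l + 2 ≤ B
  small : 16 ≤ B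
  cap : B < cap w

/-- The `i`-th entry of a precomputed array. -/
abbrev pre (a : ℕ) (i : Expr CallAccessor) : Expr CallAccessor := .input (.precomputed a) i 0 0

/-- Register: the depth in the tree. -/
abbrev xI : ℕ := 0
/-- Register: the current edge. -/
abbrev xE : ℕ := 1
/-- Register: the vertex of the current node. -/
abbrev xV : ℕ := 2
/-- Register: a state. -/
abbrev xQ : ℕ := 3
/-- Register: the maximum computed by `candidate`. -/
abbrev xC : ℕ := 4
/-- Register: auxiliary. -/
abbrev xX : ℕ := 5
/-- Register: the depth where the previous answer is changed. -/
abbrev xBI : ℕ := 6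
/-- Register: the code of the new edge at this depth, `0` if there is none. -/
abbrev xBE : ℕ := 7
/-- Register: whether the new branch is to be written. -/
abbrev xFlag : ℕ := 8
/-- Register: a position in the list of pairs of an edge. -/
abbrev xJ : ℕ := 9

/-- Working array: the edges of the next answer, backwards. -/
abbrev aWalk : ℕ := 0
/-- Working array: the set of states of the current node. -/
abbrev aCur : ℕ := 1
/-- Working array: the set of states of the next node. -/
abbrev aNew : ℕ := 2

/-- Goes from the current node to the next one, along the edge `xE`. -/
def stepRow : Prog CallAccessor :=
  forLt xQ (pre tParam 1) (.store aNew (.reg xQ) 0) ;;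
  forLt xJ (pre tEnd (.reg xE) - pre tStart (.reg xE))
    (.assign xX (pre tStart (.reg xE) + .reg xJ) ;;
      .ite (.read aCur (pre tTo (.reg xX))) (.store aNew (pre tFrom (.reg xX)) 1) .skip) ;;
  forLt xQ (pre tParam 1) (.store aCur (.reg xQ) (.read aNew (.reg xQ)))

/-- The maximal entry of the row with the number `x` of the table `tbl`, for the states of the
current node. -/
def candidate (tbl x : ℕ) : Prog CallAccessor :=
  .assign xC 0 ;;
  forLt xQ (pre tParam 1)
    (.ite (.read aCur (.reg xQ))
      (.assign xX (pre tbl (.reg x * pre tParam 1 + .reg xQ)) ;;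
        .ite (.op .lt (.reg xC) (.reg xX)) (.assign xC (.reg xX)) .skip)
      .skip)

/-- The array `a` represents the set `S`. -/
def RowIs (σ : State) (a : ℕ) (S : Finset (Fin r)) : Prop :=
  ∀ q : Fin r, σ.mem a q ≠ 0 ↔ q ∈ S

variable {D A} {s t : Fin n} {d : Fin n × Fin r → ℕ} {l B C w : ℕ} {w₁ : List (Fin m)}
  {P : Fin m → List (Fin r × Fin r)} {M : ℕ → ℕ → ℕ} {u : List ℕ} {σ : State}

@[simp] theorem callInput_precomputed (a i j x : ℕ) :
    callInput M u (.precomputed a) i j x = M a i := rfl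
@[simp] theorem callInput_prevLength (i j x : ℕ) :
    callInput M u .prevLength i j x = u.length := rfl
@[simp] theorem callInput_prev (i j x : ℕ) : callInput M u .prev i j x = u.getD i 0 := rfl

theorem idx_lt {n r : ℕ} (v : Fin n) (q : Fin r) : (v : ℕ) * r + q < n * r := by
  calc (v : ℕ) * r + q < v * r + r := by omega
    _ = (v + 1) * r := by ring
    _ ≤ n * r := Nat.mul_le_mul_right _ v.2

theorem runs_stepRow (hT : Tables D A s t d l B C w₁ P M) (hB : Bounds n m r l B w)
    {S : Finset (Fin r)} (hS : RowIs σ aCur S) {e : Fin m} (he : σ.reg xE = e) :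
    Runs w (callInput M u) stepRow σ (50 * (r + C + 1))
      fun σ' => RowIs σ' aCur (pred D A d e S) := by
  have hc := hB.cap
  have hr := hB.r
  have hsm := hB.small
  have hE := hT.tendB e
  have hE' := hT.tend e
  have hC := hT.lengthP e
  have hm := hB.m
  have h1 : Runs w (callInput M u) (forLt xQ (pre tParam 1) (.store aNew (.reg xQ) 0)) σ
      (∑ i ∈ Finset.range r, (3 + 4 + 7) + 4 + 5)
      fun σ' => ∀ q : Fin r, (q : ℕ) < r → σ'.mem aNew q = 0 := by
    refine Runs.forLt (Inv := fun i σ' => ∀ q : Fin r, (q : ℕ) < i → σ'.mem aNew q = 0)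
      (T := fun _ => 3) (by omega) (by simp) ?_ ?_ (by decide)
    · intro i σ' _ _ _
      simp [hT.param1]
      omega
    · intro i σ' hi _ h hx
      refine Runs.store (by simp) (by simp; omega) fun q hq => ?_
      simp only [setReg_mem, setCell_mem, hx, val_reg, val_ofNat, if_true]
      split_ifs with h1
      · rfl
      · exact h q (by omega)
  refine (h1.seq fun σ₁ hf₁ hz => Runs.seq (Q := fun σ' => RowIs σ' aNew (pred D A d e S))
    (T := ∑ i ∈ Finset.range (P e).length, (27 + 9 + 7) + 9 + 5) ?_ fun σ₂ _ h₂ =>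
    (Runs.forLt (B := r) (T := fun _ => 4) (Inv := fun i σ' => RowIs σ' aNew (pred D A d e S) ∧
      ∀ q : Fin r, (q : ℕ) < i → (σ'.mem aCur q ≠ 0 ↔ q ∈ pred D A d e S)) (by omega)
      (by simpa [RowIs] using h₂) ?_ ?_ (by decide))).mono (T' := 50 * (r + C + 1)) ?_ ?_
  · have he₁ : σ₁.reg xE = e := (hf₁.reg _ (by decide)).trans he
    have hS₁ : RowIs σ₁ aCur S := by
      simpa only [RowIs, hf₁.mem aCur (by decide)] using hS
    have hz' : ∀ q : Fin r, σ₁.mem aNew q = 0 := fun q => hz q q.2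
    refine (Runs.forLt (B := (P e).length) (T := fun _ => 27) (Inv := fun i σ' =>
      ∀ q' : Fin r, σ'.mem aNew q' ≠ 0 ↔ ∃ x ∈ (P e).take i, x.1 = q' ∧ x.2 ∈ S)
      (by omega) (by simp [hz']) ?_ ?_ (by decide)).mono le_rfl ?_
    · intro i σ' _ hf _
      have : σ'.reg 1 = e := (hf.reg xE (by decide)).trans he₁
      simp [this]
      omega
    · intro i σ' hi hf h hx
      have hE₁ : σ'.reg 1 = e := (hf.reg xE (by decide)).trans he₁
      have hS₂ : RowIs σ' aCur S := by
        simpa only [RowIs, hf.mem aCur (by decide)] using hS₁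
      have h8 := hT.tfrom e i hi
      have h9 := hT.tto e i hi
      have hlt1 := (P e)[i].1.2
      have hlt2 := (P e)[i].2.2
      have hS₃ := hS₂ (P e)[i].2
      have htake : (P e).take (i + 1) = (P e).take i ++ [(P e)[i]] :=
        List.take_succ_eq_append_getElem hi
      refine (Runs.assign_seq (by simp [hE₁, hx]; omega) (Runs.ite
        (by simp [hE₁, hx, h9]; omega) (fun hv => Runs.store (by simp [hE₁, hx, h8]; omega)
          (by simp; omega) ?_) (fun hv => Runs.skip ?_))).time ?_
      · simp only [val_read, val_input, val_reg, setReg_reg, val_add, hE₁, hx,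
          callInput_precomputed, if_true, h9, setReg_mem] at hv
        rw [hS₃] at hv
        intro q'
        simp only [setReg_mem, setCell_mem, if_true, val_input, callInput_precomputed, val_reg,
          setReg_reg, val_add, hE₁, hx, h8, htake, List.mem_append, List.mem_singleton]
        by_cases hq : (q' : ℕ) = (P e)[i].1
        · simp only [hq, if_true]
          refine iff_of_true (by simp) ⟨_, .inr rfl, (Fin.ext hq).symm, hv⟩
        · simp only [hq, if_false]
          rw [h q']
          constructor
          · rintro ⟨x, hx, hx'⟩
            exact ⟨x, .inl hx, hx'⟩
          · rintro ⟨x, hx | rfl, hx'⟩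
            · exact ⟨x, hx, hx'⟩
            · exact absurd (congrArg Fin.val hx'.1).symm hq
      · simp only [val_read, val_input, val_reg, setReg_reg, val_add, hE₁, hx,
          callInput_precomputed, if_true, h9, setReg_mem] at hv
        have hv' : (P e)[i].2 ∉ S := fun h => absurd hv (hS₃.2 h)
        intro q'
        simp only [setReg_mem]
        rw [h q']
        constructor
        · rintro ⟨x, hx, hx'⟩
          exact ⟨x, by rw [htake]; exact List.mem_append_left _ hx, hx'⟩
        · rintro ⟨x, hx, hx'⟩
          rw [htake, List.mem_append, List.mem_singleton] at hx
          obtain hx | rfl := hx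
          · exact ⟨x, hx, hx'⟩
          · exact absurd hx'.2 hv'
      · simp
    · intro σ' _ h q'
      rw [h q', List.take_length]
      simp only [pred, Finset.mem_filter, Finset.mem_univ, true_and]
      constructor
      · rintro ⟨x, hx, rfl, hx'⟩
        exact ⟨x.2, hx', (hT.memP e x.1 x.2).1 hx⟩
      · rintro ⟨q, hq, hg⟩
        exact ⟨(q', q), (hT.memP e q' q).2 hg, rfl, hq⟩
  · intro i σ' _ _ _
    simp [hT.param1]
    omega
  · rintro i σ' hi - ⟨h, h'⟩ hx
    refine Runs.store (by simp) (by simp) ⟨?_, fun q hq => ?_⟩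
    · simpa [RowIs] using h
    · simp only [setReg_mem, setCell_mem, val_reg, val_read, if_true, hx]
      split_ifs with h1
      · rw [← h1]; exact h q
      · exact h' q (by omega)
  · simp only [Finset.sum_const, Finset.card_range, smul_eq_mul, cost_input, cost_ofNat]
    omega
  · rintro σ' - ⟨-, h⟩ q
    exact h q q.2

/-- The greatest number over a set of states, in time `O(|Q|)`. -/
theorem runs_candidate (hT : Tables D A s t d l B C w₁ P M) (hB : Bounds n m r l B w)
    {S : Finset (Fin r)} (hS : RowIs σ aCur S) {tbl x b : ℕ} {f : Fin r → ℕ}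
    (hx : σ.reg x = b) (hx' : x ∉ [xC, xQ, xX]) (hf : ∀ q : Fin r, M tbl (b * r + q) = f q)
    (hfB : ∀ q, f q ≤ B) (hb : ∀ q : Fin r, b * r + q < B) :
    Runs w (callInput M u) (candidate tbl x) σ (50 * (r + 1))
      fun σ' => σ'.reg xC = S.sup f := by
  have hc := hB.cap
  have hr := hB.r
  have hsm := hB.small
  simp only [List.mem_cons, List.not_mem_nil, or_false, not_or] at hx'
  -- `F i` is the maximum over the states with numbers below `i`.
  obtain ⟨F, hF⟩ : ∃ F : ℕ → ℕ, F = fun i => (S.filter fun q : Fin r => (q : ℕ) < i).sup f :=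
    ⟨_, rfl⟩
  have hF0 : F 0 = 0 := by simp [hF]
  have hFs (i : ℕ) (hi : i < r) : F (i + 1) = if ⟨i, hi⟩ ∈ S then max (f ⟨i, hi⟩) (F i) else F i := by
    have hset : (S.filter fun q : Fin r => (q : ℕ) < i + 1) =
        if ⟨i, hi⟩ ∈ S then insert ⟨i, hi⟩ (S.filter fun q : Fin r => (q : ℕ) < i)
        else S.filter fun q : Fin r => (q : ℕ) < i := by
      ext q
      have : q = ⟨i, hi⟩ ↔ (q : ℕ) = i := by rw [Fin.ext_iff]
      split_ifs with hiS
      · simp only [Finset.mem_filter, Finset.mem_insert, this]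
        constructor
        · rintro ⟨h1, h2⟩
          by_cases h3 : (q : ℕ) = i
          · exact .inl h3
          · exact .inr ⟨h1, by omega⟩
        · rintro (h1 | ⟨h1, h2⟩)
          · exact ⟨by rwa [this.2 h1], by omega⟩
          · exact ⟨h1, by omega⟩
      · simp only [Finset.mem_filter]
        refine and_congr_right fun h1 => ?_
        have : (q : ℕ) ≠ i := fun h3 => hiS (by rwa [← this.2 h3])
        omega
    simp only [hF, hset]
    split_ifs
    · rw [Finset.sup_insert]
    · rfl
  refine (Runs.assign_seq (by simp; omega) (Runs.forLt (B := r) (T := fun _ => 25)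
    (Inv := fun i σ' => σ'.reg xC = F i) (by omega) (by simp [hF0]) ?_ ?_
    (by simp [assigns]))).mono ?_ ?_
  · intro i σ' _ _ _
    simp [hT.param1]
    omega
  · intro i σ' hi hfr h hxi
    have hx₁ : σ'.reg x = b := by
      rw [hfr.reg x (by simpa [forLt, assigns] using ⟨hx'.2.1, hx'.2.2, hx'.1, hx'.2.1⟩)]
      simp [hx'.1, hx]
    have hS₁ : RowIs σ' aCur S := by
      have := hfr.mem aCur (by simp [forLt, stores])
      simpa only [RowIs, this, setReg_mem] using hS
    have hS₂ := hS₁ ⟨i, hi⟩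
    have hf₂ := hf ⟨i, hi⟩
    have hb₂ := hb ⟨i, hi⟩
    have hfB₂ := hfB ⟨i, hi⟩
    have hbr : b * r < cap w := by omega
    have hset := hFs i hi
    simp only at hS₂ hf₂ hb₂ hfB₂
    refine (Runs.ite (T := 18) (by simp) (fun hv => ?_) (fun hv => Runs.skip ?_)).time ?_
    · simp only [val_read, val_reg, hxi] at hv
      rw [hS₂] at hv
      simp only [hv, if_true] at hset
      refine (Runs.assign_seq (by simp [hx₁, hxi, hT.param1, hf₂]; omega) (Runs.ite
        (by simp; omega) (fun hv => Runs.assign (by simp) ?_)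
        (fun hv => Runs.skip ?_))).time ?_
      · simp only [val_lt, val_reg, setReg_reg] at hv
        simp [hx₁, hxi, hT.param1, hf₂, hset, h] at hv ⊢
        omega
      · simp only [val_lt, val_reg, setReg_reg] at hv
        simp [hx₁, hxi, hT.param1, hf₂, hset, h] at hv ⊢
        exact hv
      · simp
    · simp only [val_read, val_reg, hxi] at hv
      have hv' : ⟨i, hi⟩ ∉ S := fun h => absurd hv (hS₂.2 h)
      simp only [hv', if_false] at hset
      simp [hset, h]
    · simp
  · simp only [Finset.sum_const, Finset.card_range, smul_eq_mul, cost_input, cost_ofNat]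
    omega
  · intro σ' _ h
    simp [h, hF]

end DistinctWalks

namespace DistinctWalks

open TreeEnum WordRAM

/-- The length `λ` of the answers. -/
abbrev lam : Expr CallAccessor := pre tParam 0 - 1

/-- The edge number `xI` of the previous answer, counted backwards. -/
abbrev prevEdge : Expr CallAccessor := .input .prev (2 * (lam - .reg xI) - 1) 0 0

/-- Makes the final states at distance `λ` of the target the current set of states. -/
def initRow : Prog CallAccessor :=
  forLt xQ (pre tParam 1) (.store aCur (.reg xQ) (pre tFin (.reg xQ)))

/-- Searches the deepest node of the previous answer at which it may be replaced by a later
branch. -/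
def scan : Prog CallAccessor :=
  initRow ;; .assign xBI 0 ;; .assign xBE 0 ;;
  forLt xI lam
    (.assign xE prevEdge ;; candidate tPrv xE ;;
      .ite (.reg xC) (.assign xBI (.reg xI) ;; .assign xBE (.reg xC)) .skip ;; stepRow)

/-- Computes the next edge of the new branch: the edge of the previous answer before the depth
`xBI`, the new edge at this depth, and the greatest usable edge after it. If no change is possible,
`xBE` is `0` and the new branch consists of greatest usable edges only. -/
def chooseEdge : Prog CallAccessor :=
  .ite (.op .lt (.reg xI) (.reg xBI)) (.assign xE prevEdge)
    (.ite (.op .eq (.reg xI) (.reg xBI) * .reg xBE) (.assign xE (.reg xBE - 1))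
      (candidate tLast xV ;; .assign xE (.reg xC - 1)))

/-- Computes the branch that follows the previous answer cyclically. -/
def build : Prog CallAccessor :=
  initRow ;; .assign xV (pre tParam 2) ;;
  forLt xI lam
    (chooseEdge ;; .store aWalk (.reg xI) (.reg xE) ;; stepRow ;;
      .assign xV (pre tSrc (.reg xE)))

/-- Compares the new branch with the first answer. -/
def compare : Prog CallAccessor :=
  .assign xFlag 0 ;;
  forLt xI lam
    (.ite (.op .eq (.read aWalk (.reg xI)) (pre tFirst (.reg xI))) .skip (.assign xFlag 1))

/-- Copies the first answer. -/
def copyFirst : Prog CallAccessor :=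
  .assign xFlag 1 ;; forLt xI lam (.store aWalk (.reg xI) (pre tFirst (.reg xI)))

/-- Writes the new answer. -/
def emitAll : Prog CallAccessor :=
  .emit (pre tParam 3) ;;
  forLt xI lam
    (.assign xE (.read aWalk (lam - 1 - .reg xI)) ;; .emit (.reg xE) ;;
      .emit (pre tTgt (.reg xE)))

/-- The program that computes the next answer. If there is no answer at all, cell `0` of `tParam` is
`0`; in the first call, the previous output is empty. -/
def nextProg : Prog CallAccessor :=
  .ite (pre tParam 0)
    (.ite (.input .prevLength 0 0 0) (scan ;; build ;; compare) copyFirst ;;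
      .ite (.reg xFlag) emitAll .skip)
    .skip

variable {k n m r : ℕ} {D : Database (Fin k) (Fin n) (Fin m)} {A : NFA (Fin k) (Fin r)}
  {s t : Fin n} {d : Fin n × Fin r → ℕ} {l B C w : ℕ} {w₁ : List (Fin m)}
  {P : Fin m → List (Fin r × Fin r)} {M : ℕ → ℕ → ℕ} {u : List ℕ} {σ : State}

theorem runs_initRow (hT : Tables D A s t d l B C w₁ P M) (hB : Bounds n m r l B w) :
    Runs w (callInput M u) initRow σ (20 * (r + 1))
      fun σ' => RowIs σ' aCur (finals A d t l) := by
  have hc := hB.cap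
  have hr := hB.r
  have hsm := hB.small
  refine (Runs.forLt (B := r) (T := fun _ => 6) (Inv := fun i σ' =>
    ∀ q : Fin r, (q : ℕ) < i → (σ'.mem aCur q ≠ 0 ↔ q ∈ finals A d t l))
    (by omega) (by simp) ?_ ?_ (by decide)).mono ?_ ?_
  · intro i σ' _ _ _
    simp [hT.param1]
    omega
  · rintro i σ' hi - h hx
    have h1 := hT.fin ⟨i, hi⟩
    simp only at h1
    refine Runs.store (by simp) (by simp [hx, h1]; omega) fun q hq => ?_
    simp only [setReg_mem, setCell_mem, val_reg, val_input, callInput_precomputed, if_true, hx, h1]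
    split_ifs with h2 h3
    · exact iff_of_true one_ne_zero (by rwa [show q = ⟨i, hi⟩ from Fin.ext h2])
    · exact iff_of_false (by simp) (by rwa [show q = ⟨i, hi⟩ from Fin.ext h2])
    · exact h q (by omega)
  · simp only [Finset.sum_const, Finset.card_range, smul_eq_mul, cost_input, cost_ofNat]
    omega
  · exact fun σ' _ h q => h q q.2

theorem fits_lam (hT : Tables D A s t d l B C w₁ P M) (hB : Bounds n m r l B w) :
    Fits w (callInput M u) σ lam ∧ val (callInput M u) σ lam = l := by
  have hc := hB.cap
  have hl := hB.l
  have hsm := hB.small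
  simp [hT.param0]
  omega

section Scan

variable {b : List (Fin m)}

/-- The sequence `u` encodes a walk with the edges `b`, backwards: edges are at odd positions of
`u`. -/
def Encodes (u : List ℕ) (b : List (Fin m)) : Prop :=
  ∀ (i : ℕ) (h : i < b.length), u.getD (2 * (b.length - i) - 1) 0 = b[i]

theorem fits_prevEdge (hT : Tables D A s t d l B C w₁ P M) (hB : Bounds n m r l B w)
    (hu : Encodes u b) (hb : b.length = l) {i : ℕ} (hi : i < b.length) (hx : σ.reg xI = i) :
    Fits w (callInput M u) σ prevEdge ∧ val (callInput M u) σ prevEdge = b[i] := by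
  have hc := hB.cap
  have hl := hB.l
  have hm := hB.m
  have hsm := hB.small
  have h := hu i hi
  rw [hb] at h
  have := (b[i]).2
  simp only [fits_input, fits_sub, fits_mul, fits_ofNat, val_ofNat, callInput_precomputed,
    hT.param0, val_input, val_sub, fits_reg, val_reg, hx, true_and, val_mul, callInput_prev,
    Nat.add_sub_cancel, h, and_true]
  omega

/-- The program performs the search `scanStep` along the previous answer. -/
theorem runs_scan (hT : Tables D A s t d l B C w₁ P M) (hB : Bounds n m r l B w)
    (hu : Encodes u b) (hb : b ∈ enum (Usable D A d) (back D A d) l (t, finals A d t l)) :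
    Runs w (callInput M u) scan σ (200 * ((l + 1) * (r + C + 1))) fun σ' =>
      (σ'.reg xBI, σ'.reg xBE) = (b.foldl (scanStep (Usable D A d) (back D A d))
        (0, (t, finals A d t l), 0, 0)).2.2 := by
  have hc := hB.cap
  have hl := hB.l
  have hm := hB.m
  have hmr := hB.mr
  have hsm := hB.small
  have hlen := length_of_mem_enum hb
  -- `G i` is the state of the search after `i` edges.
  obtain ⟨G, hG⟩ : ∃ G : ℕ → ℕ × (Fin n × Finset (Fin r)) × ℕ × ℕ,
      G = fun i => (b.take i).foldl (scanStep (Usable D A d) (back D A d))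
        (0, (t, finals A d t l), 0, 0) := ⟨_, rfl⟩
  have hG0 : G 0 = (0, (t, finals A d t l), 0, 0) := by simp [hG]
  have hGs (i : ℕ) (hi : i < b.length) :
      G (i + 1) = scanStep (Usable D A d) (back D A d) (G i) b[i] := by
    simp only [hG, List.take_succ_eq_append_getElem hi, List.foldl_append, List.foldl_cons,
      List.foldl_nil]
  refine ((runs_initRow hT hB).seq fun σ₁ _ h₁ => Runs.assign_seq (by simp; omega)
    (Runs.assign_seq (by simp; omega) (Runs.forLt (B := l)
      (T := fun _ => 140 * (r + C + 1))
      (Inv := fun i σ' => RowIs σ' aCur (G i).2.1.2 ∧ (σ'.reg xBI, σ'.reg xBE) = (G i).2.2)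
      (by omega) (by simpa [hG0, RowIs] using h₁) ?_ ?_ (by decide)))).mono ?_ ?_
  · exact fun i σ' _ _ _ => fits_lam hT hB
  · rintro i σ' hi - ⟨hR, hbb⟩ hx
    rw [← hlen] at hi
    have hf := fits_prevEdge (σ := σ') hT hB hu hlen hi hx
    have hok := ok_of_mem_enum hb i hi
    have hGn : (G i).2.1 = nodeAt (back D A d) (t, finals A d t l) (b.take i) := by
      rw [hG, foldl_scanStep_node]
    have hG1 : (G i).1 = i := by
      rw [hG, foldl_scanStep_fst]; simp [hi.le]
    rw [← hGn] at hok
    -- The edge enters the current vertex, so that its row of `tPrv` belongs to the current node.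
    have htgt : D.tgt b[i] = (G i).2.1.1 := by
      obtain ⟨q, -, h, -⟩ := hok
      exact h
    have hbound := (b[i]).2
    refine (Runs.assign_seq hf.1 (Runs.seq (runs_candidate (x := xE) (S := (G i).2.1.2) (b := b[i])
      (f := fun q => code (pick (Enters D A d (D.tgt b[i]) q) b[i])) hT hB
      (by simpa [RowIs] using hR)
      ?_ (by simp) (fun q => hT.prv _ q)
      (fun q => (code_le _).trans hm) (fun q => (idx_lt b[i] q).trans_le hmr))
      fun σ₂ hf₂ h₂ => Runs.seq (T := 7)
        (Q := fun σ₃ => (σ₃.reg xBI, σ₃.reg xBE) = (G (i + 1)).2.2)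
        ?_ fun σ₃ hf₃ h₃ =>
        (runs_stepRow (S := (G i).2.1.2) (e := b[i]) hT hB ?_ ?_).mono le_rfl ?_)).time ?_
    · simpa using hf.2
    · have hI : σ₂.reg xI = i := by
        rw [hf₂.reg _ (by decide)]
        simp [hx]
      have hBB : (σ₂.reg xBI, σ₂.reg xBE) = (G i).2.2 := by
        rw [hf₂.reg _ (by decide), hf₂.reg _ (by decide)]
        simpa using hbb
      rw [htgt, ← code_pick_exists] at h₂
      have hsc : (G (i + 1)).2.2 = if σ₂.reg xC ≠ 0 then (i, σ₂.reg xC) else (G i).2.2 := by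
        rw [hGs i hi, scanStep, hG1, h₂]
        rfl
      refine (Runs.ite (T' := 1) (by simp) (fun hv => Runs.assign_seq (by simp)
        (Runs.assign (by simp) ?_)) (fun hv => Runs.skip ?_)).time ?_
      · simp only [val_reg] at hv
        simp [hsc, hv, hI]
      · simp only [val_reg] at hv
        simpa [hsc, hv] using hBB
      · simp
    · have h1 := hf₃.mem aCur (by decide)
      have h2 := hf₂.mem aCur (by decide)
      simpa [RowIs, h1, h2] using hR
    · rw [hf₃.reg _ (by decide), hf₂.reg _ (by decide)]
      simp [hf.2]
    · intro σ₄ hf₄ h₄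
      refine ⟨?_, ?_⟩
      · simpa [RowIs, hGs i hi, scanStep, back] using h₄
      · rw [← h₃, ← hf₄.reg xBI (by decide), ← hf₄.reg xBE (by decide)]
        simp
    · simp only [cost_input, cost_ofNat, cost_mul, cost_sub, cost_reg]
      omega
  · simp only [Finset.sum_const, Finset.card_range, smul_eq_mul, cost_input, cost_ofNat, cost_sub]
    nlinarith
  · rintro σ' - ⟨-, h⟩
    simp only [h, hG, List.take_of_length_le hlen.le]

end Scan

end DistinctWalks

namespace DistinctWalks

open TreeEnum WordRAM

variable {k n m r : ℕ} {D : Database (Fin k) (Fin n) (Fin m)} {A : NFA (Fin k) (Fin r)}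
  {s t : Fin n} {d : Fin n × Fin r → ℕ} {l B C w : ℕ} {w₁ : List (Fin m)}
  {P : Fin m → List (Fin r × Fin r)} {M : ℕ → ℕ → ℕ} {u : List ℕ} {σ : State}
  {b z : List (Fin m)}

theorem runs_chooseEdge (hT : Tables D A s t d l B C w₁ P M) (hB : Bounds n m r l B w)
    (hu : Encodes u b) (hb : b.length = l) {a : Fin n × Finset (Fin r)} (hR : RowIs σ aCur a.2)
    (hV : σ.reg xV = a.1) {i bi be : ℕ} (hi : i < b.length) (hx : σ.reg xI = i)
    (hbi : σ.reg xBI = bi) (hbe : σ.reg xBE = be) (hbeB : be ≤ B) {e : Fin m}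
    (he : (e : ℕ) = if i < bi then (b[i] : ℕ) else if i = bi ∧ be ≠ 0 then be - 1 else
      code (pick (Usable D A d a) m) - 1) :
    Runs w (callInput M u) chooseEdge σ (80 * (r + 1)) fun σ' => σ'.reg xE = e := by
  have hc := hB.cap
  have hm := hB.m
  have hnr := hB.nr
  have hsm := hB.small
  have hf := fits_prevEdge (σ := σ) hT hB hu hb hi hx
  refine (Runs.ite (T := 20) (T' := 20 + 50 * (r + 1)) (by simp [hx, hbi]; omega)
    (fun hv => (Runs.assign hf.1 ?_).time ?_)
    fun hv => (Runs.ite (T := 10) (T' := 10 + 50 * (r + 1)) ?_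
      (fun hv' => (Runs.assign ?_ ?_).time ?_)
      fun hv' => (Runs.seq (runs_candidate (x := xV) (S := a.2) (b := a.1)
        (f := fun q => code (pick (Enters D A d a.1 q) m)) hT hB
        hR (by simp [hV]) (by simp) (fun q => hT.last _ q)
        (fun q => (code_le _).trans hm) (fun q => (idx_lt a.1 q).trans_le hnr))
        fun σ₂ _ h₂ => Runs.assign ?_ ?_).time ?_).time ?_).time ?_
  · simp only [val_lt, val_reg, hx, hbi, ne_eq, ite_eq_right_iff, one_ne_zero, imp_false,
      not_not] at hv
    rw [if_pos hv] at he
    simp [hf.2, he]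
  · simp
  · simp only [fits_mul, fits_eq, fits_reg, val_eq, val_reg, hx, hbi, hbe, true_and, ite_lt_cap]
    split_ifs <;> omega
  · simp [hbe]; omega
  · simp only [val_lt, val_reg, hx, hbi, ite_eq_right_iff, one_ne_zero, imp_false] at hv
    simp only [val_mul, val_eq, val_reg, hx, hbi, hbe] at hv'
    have : i = bi ∧ be ≠ 0 := by
      split_ifs at hv' with h
      · exact ⟨h, by omega⟩
      · simp at hv'
    rw [if_neg hv, if_pos this] at he
    simp [he, hbe]
  · simp
  · rw [← code_pick_exists] at h₂
    have := code_le (pick (Usable D A d a) m)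
    simp only [fits_sub, fits_reg, fits_ofNat, val_reg, val_ofNat, h₂, true_and]
    have h3 : code (pick (fun e => ∃ i ∈ a.2, Enters D A d a.1 i e) m) ≤ m := code_le _
    omega
  · simp only [val_lt, val_reg, hx, hbi, ite_eq_right_iff, one_ne_zero, imp_false] at hv
    simp only [val_mul, val_eq, val_reg, hx, hbi, hbe] at hv'
    have : ¬ (i = bi ∧ be ≠ 0) := by
      rintro ⟨h, h'⟩
      simp [h, h'] at hv'
    rw [if_neg hv, if_neg this] at he
    rw [← code_pick_exists] at h₂
    simp [he, h₂]
    rfl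
  · simp; omega
  · simp; omega
  · simp; omega

/-- If the result of the search determines the branch `z` as in `edge_of_scan`, then `z` is
computed. -/
theorem runs_build (hT : Tables D A s t d l B C w₁ P M) (hB : Bounds n m r l B w)
    (hu : Encodes u b) (hb : b.length = l) {bi be : ℕ}
    (hbi : σ.reg xBI = bi) (hbe : σ.reg xBE = be) (hbeB : be ≤ B) (hz : z.length = l)
    (he : ∀ (i : ℕ) (hi : i < b.length) (hi' : i < z.length), (z[i] : ℕ) =
      if i < bi then (b[i] : ℕ) else if i = bi ∧ be ≠ 0 then be - 1 else
        code (pick (Usable D A d (nodeAt (back D A d) (t, finals A d t l) (z.take i))) m) - 1) :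
    Runs w (callInput M u) build σ (300 * ((l + 1) * (r + C + 1))) fun σ' =>
      ∀ (i : ℕ) (h : i < z.length), σ'.mem aWalk i = z[i] := by
  have hc := hB.cap
  have hl := hB.l
  have hn := hB.n
  have hsm := hB.small
  have ht := t.2
  -- `G i` is the node reached by the new branch after `i` edges.
  obtain ⟨G, hG⟩ : ∃ G : ℕ → Fin n × Finset (Fin r),
      G = fun i => nodeAt (back D A d) (t, finals A d t l) (z.take i) := ⟨_, rfl⟩
  have hG0 : G 0 = (t, finals A d t l) := by simp [hG, nodeAt]
  have hGs (i : ℕ) (hi : i < z.length) : G (i + 1) = back D A d (G i) z[i] := by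
    simp only [hG, nodeAt, List.take_succ_eq_append_getElem hi, List.foldl_append, List.foldl_cons,
      List.foldl_nil]
  refine ((runs_initRow hT hB).seq fun σ₁ hf₁ h₁ => Runs.assign_seq (by simp [hT.param2]; omega)
    (Runs.forLt (B := l) (T := fun _ => 200 * (r + C + 1))
      (Inv := fun i σ' => RowIs σ' aCur (G i).2 ∧ σ'.reg xV = (G i).1 ∧
        ∀ (j : ℕ) (h : j < z.length), j < i → σ'.mem aWalk j = z[j])
      ?_ ?_ ?_ ?_ ?_)).mono ?_ ?_
  · omega
  · simpa [hG0, RowIs, hT.param2] using h₁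
  · exact fun i σ' _ _ _ => fits_lam hT hB
  · rintro i σ' hi hf ⟨hR, hV, hW⟩ hx
    have hib : i < b.length := by omega
    have hiz : i < z.length := by omega
    have hbi' : σ'.reg xBI = bi := by
      rw [hf.reg _ (by decide)]
      simp [hf₁.reg xBI (by decide), hbi]
    have hbe' : σ'.reg xBE = be := by
      rw [hf.reg _ (by decide)]
      simp [hf₁.reg xBE (by decide), hbe]
    have he' := he i hib hiz
    rw [show nodeAt (back D A d) (t, finals A d t l) (z.take i) = G i by rw [hG]] at he'
    refine ((runs_chooseEdge hT hB hu hb hR hV hib hx hbi' hbe' hbeB he').seq fun σ₂ hf₂ h₂ =>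
      Runs.store_seq (by simp) (by simp) (Runs.seq (runs_stepRow (S := (G i).2) (e := z[i])
        hT hB ?_ ?_) fun σ₃ hf₃ h₃ => Runs.assign ?_ ⟨?_, ?_, ?_⟩)).time ?_
    · have := hf₂.mem aCur (by decide)
      simpa [RowIs, this] using hR
    · simpa using h₂
    · have hE : σ₃.reg xE = z[i] := by rw [hf₃.reg _ (by decide)]; simpa using h₂
      have := (D.src z[i]).2
      have := (z[i]).2
      have := hB.m
      simp [hE, hT.src]
      omega
    · simp
      omega
    · simpa [RowIs, hGs i hiz, back] using h₃
    · have hE : σ₃.reg xE = z[i] := by rw [hf₃.reg _ (by decide)]; simpa using h₂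
      simp [hE, hT.src, hGs i hiz, back]
    · intro j hj hji
      have h1 : σ₂.reg xI = i := (hf₂.reg _ (by decide)).trans hx
      have h4 := hf₂.mem aWalk (by decide)
      simp only [setReg_mem, hf₃.mem aWalk (by decide), setCell_mem, if_true, val_reg, h1, h₂]
      split_ifs with h5
      · simp [h5]
      · rw [h4]
        exact hW j hj (by omega)
  · decide
  · simp only [Finset.sum_const, Finset.card_range, smul_eq_mul, cost_input, cost_ofNat, cost_sub]
    nlinarith
  · rintro σ' - ⟨-, -, h⟩ i hi
    exact h i hi (by omega)

theorem runs_compare (hT : Tables D A s t d l B C w₁ P M) (hB : Bounds n m r l B w)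
    (hz : z.length = l) (hW : ∀ (i : ℕ) (h : i < z.length), σ.mem aWalk i = z[i]) :
    Runs w (callInput M u) compare σ (50 * (l + 1)) fun σ' =>
      (σ'.reg xFlag = 0 ↔ z = w₁) ∧ ∀ (i : ℕ) (h : i < z.length), σ'.mem aWalk i = z[i] := by
  have hc := hB.cap
  have hl := hB.l
  have hm := hB.m
  have hsm := hB.small
  have hF := hT.lengthF
  refine (Runs.assign_seq (by simp; omega) (Runs.forLt (B := l) (T := fun _ => 12)
    (Inv := fun i σ' => (σ'.reg xFlag = 0 ↔
      ∀ (j : ℕ) (h : j < z.length) (h' : j < w₁.length), j < i → z[j] = w₁[j]))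
      (by omega) (by simp) ?_ ?_ (by decide))).mono ?_ ?_
  · exact fun i σ' _ _ _ => fits_lam hT hB
  · intro i σ' hi hf h hx
    have hiz : i < z.length := by omega
    have hiw : i < w₁.length := by omega
    have h1 : σ'.mem aWalk i = z[i] := by
      rw [hf.mem _ (by decide)]
      simpa using hW i hiz
    have h2 := hT.first i hiw
    have h3 := (w₁[i]).2
    have key : (∀ (j : ℕ) (h : j < z.length) (h' : j < w₁.length), j < i + 1 → z[j] = w₁[j]) ↔
        z[i] = w₁[i] ∧
          ∀ (j : ℕ) (h : j < z.length) (h' : j < w₁.length), j < i → z[j] = w₁[j] := by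
      constructor
      · exact fun h => ⟨h i hiz hiw (by omega), fun j hj hj' hji => h j hj hj' (by omega)⟩
      · rintro ⟨h4, h5⟩ j hj hj' hji
        obtain hji | rfl : j < i ∨ j = i := by omega
        · exact h5 j hj hj' hji
        · exact h4
    refine (Runs.ite (T := 2) (T' := 2) (by simp [hx, h2]; omega)
      (fun hv => (Runs.skip ?_).time (by simp))
      (fun hv => (Runs.assign (by simp; omega) ?_).time (by simp))).time (by simp)
    · simp only [val_eq, val_read, val_reg, hx, h1, h2, val_input, callInput_precomputed, ne_eq,
        ite_eq_right_iff, one_ne_zero, imp_false, not_not, ← Fin.ext_iff] at hv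
      rw [key]
      simpa [hv] using h
    · simp only [val_eq, val_read, val_reg, hx, h1, h2, val_input, callInput_precomputed,
        ite_eq_right_iff, one_ne_zero, imp_false, ← Fin.ext_iff] at hv
      rw [key]
      simp [hv]
  · simp only [Finset.sum_const, Finset.card_range, smul_eq_mul, cost_input, cost_ofNat, cost_sub]
    omega
  · intro σ' hf h
    refine ⟨h.trans ⟨fun h' => List.ext_getElem (by omega) fun j h1 h2 => h' j h1 h2 (by omega),
      fun h' j _ _ _ => by simp [h']⟩, ?_⟩
    have := hf.mem aWalk (by decide)
    simpa [this] using hW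

theorem runs_copyFirst (hT : Tables D A s t d l B C w₁ P M) (hB : Bounds n m r l B w) :
    Runs w (callInput M u) copyFirst σ (50 * (l + 1)) fun σ' =>
      σ'.reg xFlag ≠ 0 ∧ ∀ (i : ℕ) (h : i < w₁.length), σ'.mem aWalk i = w₁[i] := by
  have hc := hB.cap
  have hl := hB.l
  have hm := hB.m
  have hsm := hB.small
  have hF := hT.lengthF
  refine (Runs.assign_seq (by simp; omega) (Runs.forLt (B := l) (T := fun _ => 6)
    (Inv := fun i σ' => σ'.reg xFlag ≠ 0 ∧
      ∀ (j : ℕ) (h : j < w₁.length), j < i → σ'.mem aWalk j = w₁[j])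
      (by omega) (by simp) ?_ ?_ (by decide))).mono ?_ ?_
  · exact fun i σ' _ _ _ => fits_lam hT hB
  · rintro i σ' hi hf ⟨h₀, h⟩ hx
    have hiw : i < w₁.length := by omega
    have h2 := hT.first i hiw
    have h3 := (w₁[i]).2
    refine (Runs.store (by simp) (by simp [hx, h2]; omega) ⟨by simpa using h₀,
      fun j hj hji => ?_⟩).time (by simp)
    simp only [setReg_mem, setCell_mem, if_true, val_reg, hx, val_input, callInput_precomputed, h2]
    split_ifs with h4
    · simp [h4]
    · exact h j hj (by omega)
  · simp only [Finset.sum_const, Finset.card_range, smul_eq_mul, cost_input, cost_ofNat, cost_sub]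
    omega
  · exact fun σ' hf h => ⟨h.1, fun i hi => h.2 i hi (by omega)⟩

/-- The sequence of numbers that stands for the walk from `s` with the edges `z`, backwards. -/
def encodeRev (D : Database (Fin k) (Fin n) (Fin m)) (s : Fin n) (z : List (Fin m)) : List ℕ :=
  (s : ℕ) :: z.reverse.flatMap fun e : Fin m => [(e : ℕ), (D.tgt e : ℕ)]

theorem runs_emitAll (hT : Tables D A s t d l B C w₁ P M) (hB : Bounds n m r l B w)
    (hz : z.length = l) (hW : ∀ (i : ℕ) (h : i < z.length), σ.mem aWalk i = z[i])
    (ho : σ.out = []) :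
    Runs w (callInput M u) emitAll σ (50 * (l + 1)) fun σ' => σ'.out = encodeRev D s z := by
  have hc := hB.cap
  have hl := hB.l
  have hm := hB.m
  have hn := hB.n
  have hsm := hB.small
  have hs := s.2
  refine (Runs.emit_seq (by simp [hT.param3]; omega) (Runs.forLt (B := l) (T := fun _ => 20)
    (Inv := fun i σ' => σ'.out = (s : ℕ) :: (z.reverse.take i).flatMap
      fun e : Fin m => [(e : ℕ), (D.tgt e : ℕ)])
      (by omega) (by simp [hT.param3, ho]) ?_ ?_ (by decide))).mono ?_ ?_
  · exact fun i σ' _ _ _ => fits_lam hT hB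
  · intro i σ' hi hf h hx
    have hiz : i < z.reverse.length := by simp; omega
    have hiz' : l - 1 - i < z.length := by omega
    have hrev : z.reverse[i] = z[l - 1 - i] := by simp [hz]
    have h1 : σ'.mem aWalk (l - 1 - i) = z[l - 1 - i] := by
      rw [hf.mem _ (by decide)]
      simpa using hW _ hiz'
    have h2 := hT.tgt z[l - 1 - i]
    have h3 := (z[l - 1 - i]).2
    have h4 := (D.tgt z[l - 1 - i]).2
    refine (Runs.assign_seq (by simp [hT.param0, hx]; omega) (Runs.emit_seq (by simp)
      (Runs.emit (by simp [hT.param0, hx, h1, h2]; omega) ?_))).time (by simp)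
    rw [List.take_succ_eq_append_getElem hiz, hrev]
    simp [hT.param0, hx, h1, h2, h]
  · simp only [Finset.sum_const, Finset.card_range, smul_eq_mul, cost_input, cost_ofNat, cost_sub]
    omega
  · intro σ' _ h
    rw [h, encodeRev, List.take_of_length_le (by simp [hz])]

theorem encodes_encodeRev : Encodes (encodeRev D s b) b := by
  intro i hi
  have key : ∀ (es : List (Fin m)) (j : ℕ) (h : j < es.length),
      (es.flatMap fun e : Fin m => [(e : ℕ), (D.tgt e : ℕ)])[2 * j]? = some (es[j] : ℕ) := by
    intro es
    induction es with
    | nil => simp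
    | cons e es ih =>
      intro j hj
      cases j with
      | zero => simp
      | succ j => simpa [mul_add] using ih j (by simpa using hj)
  have h1 : 2 * (b.length - i) - 1 = 2 * (b.length - 1 - i) + 1 := by omega
  have h2 := key b.reverse (b.length - 1 - i) (by simp; omega)
  rw [h1, encodeRev, List.getD_eq_getElem?_getD, List.getElem?_cons_succ, h2]
  have : b.length - 1 - (b.length - 1 - i) = i := by omega
  simp [this]

theorem runs_nextProg_of_zero (hw : 1 < cap w) (h : M tParam 0 = 0) (ho : σ.out = []) :
    Runs w (callInput M u) nextProg σ 10 fun σ' => σ'.out = [] :=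
  (Runs.ite (T := 0) (by simp [h]; omega) (fun hv => absurd (by simp [h]) hv)
    (fun _ => Runs.skip ho)).time (by simp)

theorem runs_nextProg_first (hT : Tables D A s t d l B C w₁ P M) (hB : Bounds n m r l B w)
    (ho : σ.out = []) :
    Runs w (callInput M []) nextProg σ (200 * (l + 1)) fun σ' => σ'.out = encodeRev D s w₁ := by
  have hc := hB.cap
  have hl := hB.l
  have hsm := hB.small
  refine (Runs.ite (T := 150 * (l + 1)) (T' := 0) (by simp [hT.param0]; omega)
    (fun _ => (Runs.seq (Runs.ite (T := 0) (by simp; omega) (fun hv => absurd (by simp) hv)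
      fun _ => runs_copyFirst hT hB) fun σ₁ hf₁ ⟨h₁, h₁'⟩ =>
      Runs.ite (T' := 0) (by simp) (fun _ => runs_emitAll hT hB hT.lengthF h₁' ?_)
        (fun hv => absurd hv (by simpa using h₁))).time ?_)
    (fun hv => absurd hv (by simp [hT.param0]))).time ?_
  · rw [hf₁.out (by decide), ho]
  · simp; omega
  · simp; omega

/-- A call after the output `b` writes the next branch in cyclic order, or nothing if this is the
first answer. -/
theorem runs_nextProg_succ (hT : Tables D A s t d l B C w₁ P M) (hB : Bounds n m r l B w)
    (hl1 : ∃ f ∈ A.accept, d (t, f) = l + 1) (hd : IsDist D A s d)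
    (hu : Encodes u b) (hu' : u.length ≠ 0) (hu'' : u.length < cap w)
    (hb : b ∈ enum (Usable D A d) (back D A d) l (t, finals A d t l))
    (hz : z ∈ enum (Usable D A d) (back D A d) l (t, finals A d t l))
    (hbz : z = (succ (Usable D A d) (back D A d) l (t, finals A d t l) b).getD
      (first (Usable D A d) (back D A d) l (t, finals A d t l)))
    (ho : σ.out = []) :
    Runs w (callInput M u) nextProg σ (700 * ((l + 1) * (r + C + 1)))
      fun σ' => σ'.out = if z = w₁ then [] else encodeRev D s z := by
  have hc := hB.cap
  have hl := hB.l
  have hm := hB.m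
  have hsm := hB.small
  have hbl := length_of_mem_enum hb
  have hzl := length_of_mem_enum hz
  have hlive := live_finals hl1
  set g := (b.foldl (scanStep (Usable D A d) (back D A d)) (0, (t, finals A d t l), 0, 0)).2.2
    with hg
  have hbe : g.2 ≤ B := by
    obtain ⟨-, h⟩ | ⟨b', e, h, -⟩ := foldl_scanStep (ok := Usable D A d) (child := back D A d) b 0
      (t, finals A d t l) (0, 0)
    · rw [hg, h]; simp
    · rw [hg, h]; exact (code_le (some e)).trans hm
  have he (i : ℕ) (hi : i < b.length) (hi' : i < z.length) := edge_of_scan (i := i) (w := b)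
    (bi := g.1) (be := g.2) (u := z)
    (live := Live d) (ok := Usable D A d) (child := back D A d) (a := (t, finals A d t l))
    (fun _ _ h => h.exists_usable hd) (fun _ _ _ h => h.back) (by rwa [hbl]) rfl (by rwa [hbl])
    (by rwa [hbl]) hi hi'
  have hnl : (l + 1) ≤ (l + 1) * (r + C + 1) := Nat.le_mul_of_pos_right _ (by omega)
  refine (Runs.ite (T := 650 * ((l + 1) * (r + C + 1))) (T' := 0) (by simp [hT.param0]; omega)
    (fun _ => (Runs.seq (Runs.ite (T' := 0) (by simp; omega)
      (fun _ => Runs.seq (runs_scan hT hB hu hb) fun σ₁ _ h₁ =>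
        Runs.seq (runs_build (bi := g.1) (be := g.2) hT hB hu hbl ?_ ?_ hbe hzl he)
          fun σ₂ _ h₂ => runs_compare hT hB hzl h₂)
      (fun hv => absurd hv (by simpa using hu'))) fun σ₁ hf₁ ⟨h₁, h₁'⟩ =>
      Runs.ite (by simp) (fun hv => (runs_emitAll hT hB hzl h₁' ?_).mono le_rfl ?_)
        (fun hv => Runs.skip ?_)).time ?_)
    (fun hv => absurd hv (by simp [hT.param0]))).time ?_
  · rw [← hg] at h₁; rw [← h₁]
  · rw [← hg] at h₁; rw [← h₁]
  · rw [hf₁.out (by decide), ho]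
  · intro σ' _ h
    rw [h, if_neg (fun h => hv (h₁.2 h))]
  · rw [if_pos (h₁.1 hv), hf₁.out (by decide), ho]
  · simp; omega
  · simp; omega

end DistinctWalks

/-! ### Breadth-first search in the product of the database and the automaton -/

namespace DistinctWalks

/-- The data of the breadth-first search: all pairs found so far, in the order in which they were
found, and the distance plus `1` of those pairs (`0` for the other ones). -/
structure Bfs (n r : ℕ) where
  queue : List (Fin n × Fin r)
  dist : Fin n × Fin r → ℕ

/-- Adds a pair to the queue, at distance `c - 1`, unless it was found before. -/
def relax {n r : ℕ} (c : ℕ) (g : Bfs n r) (y : Fin n × Fin r) : Bfs n r :=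
  if g.dist y = 0 then ⟨g.queue ++ [y], Function.update g.dist y c⟩ else g

/-- The distances are set exactly on the queue, and they are at most its length. -/
structure Bfs.WF {n r : ℕ} (g : Bfs n r) : Prop where
  nodup : g.queue.Nodup
  mem : ∀ y, y ∈ g.queue ↔ g.dist y ≠ 0
  le : ∀ y, g.dist y ≤ g.queue.length

variable {k n m r : ℕ} {D : Database (Fin k) (Fin n) (Fin m)} {A : NFA (Fin k) (Fin r)}
  {s : Fin n}

theorem Bfs.WF.length_le {g : Bfs n r} (h : g.WF) : g.queue.length ≤ n * r := by
  simpa using h.nodup.length_le_card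

theorem Bfs.WF.relax {g : Bfs n r} (h : g.WF) {c : ℕ} (hc : c ≠ 0) (hc' : c ≤ g.queue.length + 1)
    (y : Fin n × Fin r) : (relax c g y).WF := by
  unfold DistinctWalks.relax
  split_ifs with hy
  · refine ⟨?_, fun x => ?_, fun x => ?_⟩
    · refine List.nodup_append.2 ⟨h.nodup, by simp, fun a ha b hb => ?_⟩
      rintro rfl
      rw [List.mem_singleton] at hb
      subst hb
      exact (h.mem a).1 ha hy
    · by_cases hx : x = y
      · simp [hx, hc]
      · simp [hx, h.mem]
    · by_cases hx : x = y
      · simp [hx, hc']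
      · simpa [hx] using (h.le x).trans (Nat.le_succ _)
  · exact h

/-- Adding several pairs with the same distance prolongs the queue, and changes neither the
distances nor the order of the pairs found before. -/
theorem foldl_relax {g : Bfs n r} (h : g.WF) {c : ℕ} (hc : c ≠ 0) (hc' : c ≤ g.queue.length + 1)
    (ys : List (Fin n × Fin r)) : ∃ new, (ys.foldl (relax c) g).queue = g.queue ++ new ∧
      (ys.foldl (relax c) g).WF ∧ (∀ y ∈ new, (ys.foldl (relax c) g).dist y = c ∧ y ∈ ys) ∧
      (∀ y, g.dist y ≠ 0 → (ys.foldl (relax c) g).dist y = g.dist y) ∧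
      ∀ y ∈ ys, (ys.foldl (relax c) g).dist y ≠ 0 := by
  induction ys generalizing g with
  | nil => exact ⟨[], by simp, h, by simp, by simp, by simp⟩
  | cons y ys ih =>
    rw [List.foldl_cons]
    have hle : g.queue.length ≤ (relax c g y).queue.length := by
      unfold relax; split_ifs <;> simp
    obtain ⟨new, h1, h2, h3, h4, h5⟩ := ih (h.relax hc hc' y) (by omega)
    by_cases hy : g.dist y = 0
    · have hr : relax c g y = ⟨g.queue ++ [y], Function.update g.dist y c⟩ := by
        rw [relax, if_pos hy]
      have hy' : (ys.foldl (relax c) (relax c g y)).dist y = c := by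
        rw [h4] <;> simp [hr, hc]
      refine ⟨y :: new, by rw [h1, hr]; simp, h2, fun x hx => ?_, fun x hx => ?_, fun x hx => ?_⟩
      · obtain rfl | hx := List.mem_cons.1 hx
        · exact ⟨hy', by simp⟩
        · exact ⟨(h3 x hx).1, by simp [(h3 x hx).2]⟩
      · have : x ≠ y := by rintro rfl; exact hx hy
        rw [h4] <;> simp [hr, this, hx]
      · obtain rfl | hx := List.mem_cons.1 hx
        · rwa [hy']
        · exact h5 x hx
    · have hr : relax c g y = g := by rw [relax, if_neg hy]
      rw [hr] at h1 h2 h3 h4 h5 ⊢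
      refine ⟨new, h1, h2, fun x hx => ⟨(h3 x hx).1, by simp [(h3 x hx).2]⟩, h4, fun x hx => ?_⟩
      obtain rfl | hx := List.mem_cons.1 hx
      · rwa [h4 x hy]
      · exact h5 x hx

/-- The successors of a pair in the product. -/
def succs (R : MemoryRepresentation D A) (x : Fin n × Fin r) : List (Fin n × Fin r) :=
  (R.outgoing x.1).flatMap fun e => (R.labels e).flatMap fun a =>
    (R.delta x.2 a).map fun p => (D.tgt e, p)

theorem mem_succs {R : MemoryRepresentation D A} {x y : Fin n × Fin r} : y ∈ succs R x ↔
    ∃ e, D.src e = x.1 ∧ D.tgt e = y.1 ∧ Trans D A e x.2 y.2 := by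
  simp only [succs, List.mem_flatMap, R.mem_outgoing, R.mem_labels, List.mem_map, R.mem_delta,
    Trans]
  constructor
  · rintro ⟨e, h1, a, h2, p, h3, rfl⟩
    exact ⟨e, h1, rfl, a, h2, h3⟩
  · rintro ⟨e, h1, h2, a, h3, h4⟩
    exact ⟨e, h1, a, h3, y.2, h4, by rw [h2]⟩

/-- The invariant of the breadth-first search: the pairs in `don` have been processed, those in
`todo` have not. All distances so far are within `1` of those in `todo`. -/
structure BfsInv (R : MemoryRepresentation D A) (s : Fin n) (g : Bfs n r)
    (don todo : List (Fin n × Fin r)) : Prop where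
  wf : g.WF
  queue : g.queue = don ++ todo
  sorted : todo.Pairwise fun x y => g.dist x ≤ g.dist y
  close : ∀ x ∈ todo, ∀ y, g.dist y ≤ g.dist x + 1
  closed : ∀ x ∈ don, ∀ y ∈ succs R x, g.dist y ≠ 0 ∧ g.dist y ≤ g.dist x + 1
  sound : ∀ x j, g.dist x = j + 1 → Reach D A s j x
  start : ∀ q ∈ A.start, g.dist (s, q) = 1

theorem BfsInv.init (R : MemoryRepresentation D A) (s : Fin n) {l : List (Fin r)}
    (hl : ∀ q, q ∈ l ↔ q ∈ A.start) :
    BfsInv R s ((l.map fun q => (s, q)).foldl (relax 1) ⟨[], fun _ => 0⟩) []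
      ((l.map fun q => (s, q)).foldl (relax 1) ⟨[], fun _ => 0⟩).queue := by
  have h0 : (⟨[], fun _ => 0⟩ : Bfs n r).WF := ⟨by simp, by simp, by simp⟩
  obtain ⟨new, h1, h2, h3, h4, h5⟩ := foldl_relax h0 one_ne_zero (by simp)
    (l.map fun q => (s, q))
  rw [List.nil_append] at h1
  rw [← h1] at h3
  generalize (l.map fun q => (s, q)).foldl (relax 1) ⟨[], fun _ => 0⟩ = g at *
  have hd (y : Fin n × Fin r) (hy : g.dist y ≠ 0) : g.dist y = 1 := (h3 y ((h2.mem y).2 hy)).1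
  refine ⟨h2, rfl, ?_, fun x hx y => ?_, by simp, fun x j hx => ?_, fun q hq => ?_⟩
  · exact List.pairwise_of_forall_mem_list fun x hx y hy => by rw [(h3 x hx).1, (h3 y hy).1]
  · have := hd y
    omega
  · obtain rfl : j = 0 := by have := hd x (by omega); omega
    obtain ⟨q, hq, rfl⟩ := List.mem_map.1 (h3 x ((h2.mem x).2 (by omega))).2
    exact ⟨rfl, (hl q).1 hq⟩
  · exact hd _ (h5 _ (List.mem_map.2 ⟨q, (hl q).2 hq, rfl⟩))

theorem BfsInv.step {R : MemoryRepresentation D A} {g : Bfs n r} {x : Fin n × Fin r}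
    {don todo : List (Fin n × Fin r)} (h : BfsInv R s g don (x :: todo)) :
    ∃ new, BfsInv R s ((succs R x).foldl (relax (g.dist x + 1)) g) (don ++ [x]) (todo ++ new) := by
  obtain ⟨new, h1, h2, h3, h4, h5⟩ := foldl_relax h.wf (Nat.succ_ne_zero _)
    (Nat.succ_le_succ (h.wf.le x)) (succs R x)
  refine ⟨new, ?_⟩
  generalize (succs R x).foldl (relax (g.dist x + 1)) g = g' at *
  have hx : g.dist x ≠ 0 := (h.wf.mem x).1 (by rw [h.queue]; simp)
  have hmem (y) (hy : y ∈ don ++ x :: todo) : g.dist y ≠ 0 := (h.wf.mem y).1 (by rwa [h.queue])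
  -- pairs that were found before keep their distances, new ones are one step behind `x`
  have hold (y) (hy : g'.dist y ≠ 0) : (g.dist y ≠ 0 ∧ g'.dist y = g.dist y) ∨
      (g'.dist y = g.dist x + 1 ∧ y ∈ succs R x) := by
    rw [← h2.mem, h1, List.mem_append] at hy
    obtain hy | hy := hy
    · have := (h.wf.mem y).1 hy
      exact .inl ⟨this, h4 y this⟩
    · exact .inr (h3 y hy)
  have hle (y) : g'.dist y ≤ g.dist x + 1 := by
    by_cases hy : g'.dist y = 0
    · omega
    · obtain ⟨-, h6⟩ | ⟨h6, -⟩ := hold y hy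
      · rw [h6]; exact h.close x (by simp) y
      · omega
  have hsort := List.pairwise_cons.1 h.sorted
  have htodo (y) (hy : y ∈ todo) : g'.dist y = g.dist y := h4 y (hmem y (by simp [hy]))
  refine ⟨h2, by rw [h1, h.queue]; simp, ?_, fun y hy z => ?_, fun y hy z hz => ?_,
    fun y j hy => ?_, fun q hq => ?_⟩
  · refine List.pairwise_append.2 ⟨?_, ?_, fun y hy z hz => ?_⟩
    · refine hsort.2.imp_of_mem fun {y z} hy hz hyz => ?_
      rwa [htodo y hy, htodo z hz]
    · exact List.pairwise_of_forall_mem_list fun y hy z hz => by rw [(h3 y hy).1, (h3 z hz).1]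
    · rw [(h3 z hz).1]
      exact hle y
  · have h6 : g.dist x ≤ g'.dist y := by
      obtain hy | hy := List.mem_append.1 hy
      · rw [htodo y hy]
        exact hsort.1 y hy
      · rw [(h3 y hy).1]
        omega
    have := hle z
    omega
  · obtain hy | hy := List.mem_append.1 hy
    · obtain ⟨h6, h7⟩ := h.closed y hy z hz
      rw [h4 z h6, h4 y (hmem y (by simp [hy]))]
      exact ⟨h6, h7⟩
    · obtain rfl := List.mem_singleton.1 hy
      refine ⟨h5 z hz, ?_⟩
      rw [h4 y hx]
      exact hle z
  · obtain ⟨h6, h7⟩ | ⟨h6, h7⟩ := hold y (by omega)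
    · exact h.sound y j (by omega)
    · obtain ⟨e, he, he', ht⟩ := mem_succs.1 h7
      obtain rfl : j = g.dist x := by omega
      obtain ⟨i, hi⟩ : ∃ i, g.dist x = i + 1 := ⟨g.dist x - 1, by omega⟩
      rw [hi]
      exact ⟨e, x.2, by rw [he]; exact h.sound x i hi, he', ht⟩
  · rw [h4] <;> simp [h.start q hq]

/-- When the queue has been processed, the distances are right. -/
theorem BfsInv.isDist {R : MemoryRepresentation D A} {g : Bfs n r} {don : List (Fin n × Fin r)}
    (h : BfsInv R s g don []) : IsDist D A s g.dist := by
  have key (j : ℕ) : ∀ x, Reach D A s j x → g.dist x ≠ 0 ∧ g.dist x ≤ j + 1 := by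
    induction j with
    | zero =>
      rintro ⟨v, q⟩ ⟨rfl, hq⟩
      simp [h.start q hq]
    | succ j ih =>
      rintro x ⟨e, q', hr, ht, htr⟩
      obtain ⟨h1, h2⟩ := ih _ hr
      have h3 : (D.src e, q') ∈ don := by
        have := (h.wf.mem _).2 h1
        rwa [h.queue, List.append_nil] at this
      obtain ⟨h4, h5⟩ := h.closed _ h3 x (mem_succs.2 ⟨e, rfl, ht, htr⟩)
      exact ⟨h4, by omega⟩
  intro x j
  constructor
  · intro hx
    refine ⟨h.sound x j hx, fun i hi hr => ?_⟩
    have := (key i x hr).2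
    omega
  · rintro ⟨hr, hmin⟩
    obtain ⟨h1, h2⟩ := key j x hr
    obtain ⟨i, hi⟩ : ∃ i, g.dist x = i + 1 := ⟨g.dist x - 1, by omega⟩
    have h3 := h.sound x i hi
    have h4 : ¬ i < j := fun hij => hmin i hij h3
    omega

end DistinctWalks

/-! ### The search as a program -/

namespace DistinctWalks

open TreeEnum WordRAM

/-- Register: the position in the queue of the pair that is processed. -/
abbrev yHead : ℕ := 0
/-- Register: the length of the queue. -/
abbrev yTail : ℕ := 1
/-- Register: a vertex. -/
abbrev yV : ℕ := 2
/-- Register: a state. -/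
abbrev yQ : ℕ := 3
/-- Register: a distance plus `1`. -/
abbrev yD : ℕ := 4
/-- Register: the counter of the outermost loop. -/
abbrev yI : ℕ := 5
/-- Register: an edge. -/
abbrev yE : ℕ := 6
/-- Register: a vertex: the target of an edge in the search, the source of an edge afterwards. -/
abbrev yU : ℕ := 7
/-- Register: a position in a list of labels. -/
abbrev yJ : ℕ := 8
/-- Register: a label. -/
abbrev yA : ℕ := 9
/-- Register: a position in a list of transitions. -/
abbrev yL : ℕ := 10
/-- Register: a state after a transition. -/
abbrev yP : ℕ := 11
/-- Register: the position of a pair in the tables. -/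
abbrev yX : ℕ := 12
/-- Register: `λ + 1`, or `0` if there is no answer. -/
abbrev yAns : ℕ := 13
/-- Register: a final state at distance `λ` of the target. -/
abbrev yFinal : ℕ := 14
/-- Register: the number of entries of `tFrom` and `tTo`. -/
abbrev yCount : ℕ := 15

/-- Array of the preprocessing: the distances plus `1`, at position `v * |Q| + q`. -/
abbrev aDist : ℕ := 11
/-- Array of the preprocessing: the vertices of the pairs in the queue. -/
abbrev aQueueV : ℕ := 12
/-- Array of the preprocessing: the states of the pairs in the queue. -/
abbrev aQueueQ : ℕ := 13
/-- Array of the preprocessing: a state before `q` on a shortest path to `(v, q)` that ends with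
the edge stored in `tLast`, at position `v * |Q| + q`. -/
abbrev aParent : ℕ := 14

/-- The number of states. -/
abbrev numQ : Expr Accessor := .input .numStates 0 0 0

/-- Adds the pair `(yU, yP)` to the queue, with the distance `yD`, unless it was found before. -/
def relaxProg : Prog Accessor :=
  .assign yX (.reg yU * numQ + .reg yP) ;;
  .ite (.op .eq (.read aDist (.reg yX)) 0)
    (.store aDist (.reg yX) (.reg yD) ;; .store aQueueV (.reg yTail) (.reg yU) ;;
      .store aQueueQ (.reg yTail) (.reg yP) ;; .assign yTail (.reg yTail + 1))
    .skip

/-- Adds the successors of the pair `(yV, yQ)` to the queue. -/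
def expandProg : Prog Accessor :=
  forLt yI (.input .outdeg (.reg yV) 0 0)
    (.assign yE (.input .outgoing (.reg yV) (.reg yI) 0) ;; .assign yU (.input .tgt (.reg yE) 0 0) ;;
      forLt yJ (.input .lblCard (.reg yE) 0 0)
        (.assign yA (.input .lbl (.reg yE) (.reg yJ) 0) ;;
          forLt yL (.input .deltaCard (.reg yQ) (.reg yA) 0)
            (.assign yP (.input .delta (.reg yQ) (.reg yA) (.reg yL)) ;; relaxProg)))

/-- The breadth-first search. -/
def bfsProg : Prog Accessor :=
  .assign yU (.input .source 0 0 0) ;; .assign yD 1 ;;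
  forLt yP numQ (.ite (.input .isInitial (.reg yP) 0 0) relaxProg .skip) ;;
  .loop (.op .lt (.reg yHead) (.reg yTail))
    (.assign yV (.read aQueueV (.reg yHead)) ;; .assign yQ (.read aQueueQ (.reg yHead)) ;;
      .assign yD (.read aDist (.reg yV * numQ + .reg yQ) + 1) ;; expandProg ;;
      .assign yHead (.reg yHead + 1))

variable {k n m r : ℕ} {D : Database (Fin k) (Fin n) (Fin m)} {A : NFA (Fin k) (Fin r)}
  {R : MemoryRepresentation D A} {s t : Fin n} {B N w : ℕ} {σ : State}

section Input
variable (i j x : ℕ)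

theorem entry_eq {a : ℕ} {l : List (Fin a)} (h : x < l.length) : entry l x = l[x] := by
  simp [entry, h]

@[simp] theorem input_numEdges : R.input s t .numEdges i j x = m := rfl
@[simp] theorem input_numStates : R.input s t .numStates i j x = r := rfl
@[simp] theorem input_source : R.input s t .source i j x = s := rfl
@[simp] theorem input_target : R.input s t .target i j x = t := rfl
@[simp] theorem input_outdeg (v : Fin n) :
    R.input s t .outdeg v i j = (R.outgoing v).length := by
  simp [MemoryRepresentation.input]
theorem input_outgoing {v : Fin n} (h : x < (R.outgoing v).length) :
    R.input s t .outgoing v x i = (R.outgoing v)[x] := by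
  simp [MemoryRepresentation.input, entry_eq _ h]
@[simp] theorem input_src (e : Fin m) : R.input s t .src e i j = D.src e := by
  simp [MemoryRepresentation.input]
@[simp] theorem input_tgt (e : Fin m) : R.input s t .tgt e i j = D.tgt e := by
  simp [MemoryRepresentation.input]
@[simp] theorem input_lblCard (e : Fin m) : R.input s t .lblCard e i j = (R.labels e).length := by
  simp [MemoryRepresentation.input]
theorem input_lbl {e : Fin m} (h : x < (R.labels e).length) :
    R.input s t .lbl e x i = (R.labels e)[x] := by
  simp [MemoryRepresentation.input, entry_eq _ h]
@[simp] theorem input_deltaCard (q : Fin r) (a : Fin k) :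
    R.input s t .deltaCard q a i = (R.delta q a).length := by
  simp [MemoryRepresentation.input]
theorem input_delta {q : Fin r} {a : Fin k} (h : x < (R.delta q a).length) :
    R.input s t .delta q a x = (R.delta q a)[x] := by
  simp [MemoryRepresentation.input, entry_eq _ h]
open Classical in
@[simp] theorem input_isInitial (q : Fin r) :
    R.input s t .isInitial q i j = if q ∈ A.start then 1 else 0 := by
  simp [MemoryRepresentation.input]
open Classical in
@[simp] theorem input_isFinal (q : Fin r) :
    R.input s t .isFinal q i j = if q ∈ A.accept then 1 else 0 := by
  simp [MemoryRepresentation.input]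

end Input

/-- The numbers that the preprocessing computes are at most `B`, and `B` fits in a word; here `C`
is the number of transitions. -/
structure PrepBounds (k n m r C B w : ℕ) : Prop where
  nr : 2 * (n * r) + 2 ≤ B
  mr : m * r ≤ B
  mC : m * C ≤ B
  k : k ≤ B
  n : n ≤ B
  m : m ≤ B
  r : r ≤ B
  small : 16 ≤ B
  cap : B < cap w

variable {C : ℕ}

theorem length_outgoing_le (R : MemoryRepresentation D A) (v : Fin n) :
    (R.outgoing v).length ≤ m := by
  simpa using (R.outgoing_nodup v).length_le_card

theorem length_labels_le (R : MemoryRepresentation D A) (e : Fin m) :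
    (R.labels e).length ≤ k := by
  simpa using (R.labels_nodup e).length_le_card

theorem length_delta_le (R : MemoryRepresentation D A) (q : Fin r) (a : Fin k) :
    (R.delta q a).length ≤ r := by
  simpa using (R.delta_nodup q a).length_le_card

theorem idx_inj {n r : ℕ} {x y : Fin n × Fin r} :
    (x.1 : ℕ) * r + x.2 = y.1 * r + y.2 ↔ x = y := by
  constructor
  · intro h
    have hr : 0 < r := by have := x.2.2; omega
    have h1 := congrArg (· / r) h
    have h2 := congrArg (· % r) h
    simp only [Nat.mul_comm _ r, Nat.mul_add_div hr, Nat.div_eq_of_lt x.2.2,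
      Nat.div_eq_of_lt y.2.2, Nat.mul_add_mod, Nat.mod_eq_of_lt x.2.2, Nat.mod_eq_of_lt y.2.2,
      add_zero] at h1 h2
    exact Prod.ext (Fin.ext h1) (Fin.ext h2)
  · rintro rfl
    rfl

/-- The registers and arrays contain the data of the search, which are well-formed; the queue has
at least `N` elements, which allows adding pairs with distances up to `N + 1`. -/
structure BfsRep (N : ℕ) (g : Bfs n r) (σ : State) : Prop where
  dist : ∀ x : Fin n × Fin r, σ.mem aDist (x.1 * r + x.2) = g.dist x
  queueV : ∀ (i : ℕ) (h : i < g.queue.length), σ.mem aQueueV i = g.queue[i].1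
  queueQ : ∀ (i : ℕ) (h : i < g.queue.length), σ.mem aQueueQ i = g.queue[i].2
  tail : σ.reg yTail = g.queue.length
  wf : g.WF
  le : N ≤ g.queue.length

theorem BfsRep.setReg {g : Bfs n r} (h : BfsRep N g σ) {x : ℕ} (hx : x ≠ yTail) (v : ℕ) :
    BfsRep N g (σ.setReg x v) :=
  ⟨h.dist, h.queueV, h.queueQ, by simp [hx.symm, h.tail], h.wf, h.le⟩

theorem runs_relax (hB : PrepBounds k n m r C B w) {g : Bfs n r} (h : BfsRep N g σ)
    {y : Fin n × Fin r} (hU : σ.reg yU = y.1) (hP : σ.reg yP = y.2) {c : ℕ} (hD : σ.reg yD = c)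
    (hc : c ≠ 0) (hcN : c ≤ N + 1) :
    Runs w (R.input s t) relaxProg σ 30 (BfsRep N (relax c g y)) := by
  have hcap := hB.cap
  have hnr := hB.nr
  have hr := hB.r
  have hn := hB.n
  have hsm := hB.small
  have hlt := idx_lt y.1 y.2
  have hle := h.wf.length_le
  have hdist := h.dist y
  have hyr : (y.1 : ℕ) * r < cap w := by omega
  have hy1 := y.1.2
  have hy2 := y.2.2
  have hwf := h.wf.relax hc (by have := h.le; omega) y
  refine (Runs.assign_seq (by simp [hU, hP]; omega) (Runs.ite (T := 16) (T' := 1)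
    (by simp; omega) (fun hv => (Runs.store_seq (by simp) (by simp) (Runs.store_seq
      (by simp) (by simp) (Runs.store_seq (by simp) (by simp)
        (Runs.assign ?_ ⟨?_, ?_, ?_, ?_, ?_, ?_⟩)))).time (by simp))
    (fun hv => Runs.skip ?_))).time (by simp)
  · simp [h.tail]; omega
  · simp [hU, hP, hdist] at hv
    rw [relax, if_neg hv]
    exact h.setReg (by decide) _
  all_goals
    simp [hU, hP, hdist] at hv
    simp only [relax, hv, if_true] at hwf ⊢
  · intro x
    by_cases hx : x = y
    · simp [hx, hU, hP, hD]
    · have : ¬ ((x.1 : ℕ) * r + x.2 = y.1 * r + y.2) := fun h => hx (idx_inj.1 h)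
      simp [hU, hP, this, hx, h.dist]
  · intro i hi
    by_cases hx : i = g.queue.length
    · subst hx
      simp [h.tail, hU]
    · have hi' : i < g.queue.length := by simp at hi; omega
      simp [h.tail, hx, h.queueV i hi', hi']
  · intro i hi
    by_cases hx : i = g.queue.length
    · subst hx
      simp [h.tail, hP]
    · have hi' : i < g.queue.length := by simp at hi; omega
      simp [h.tail, hx, h.queueQ i hi', hi']
  · simp [h.tail]
  · exact hwf
  · have := h.le
    simp
    omega

/-- The number of steps of the automaton from `q` on the labels of `e`, and of these labels. -/
def edgeWeight (R : MemoryRepresentation D A) (q : Fin r) (e : Fin m) : ℕ :=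
  ((R.labels e).map fun a => (R.delta q a).length + 1).sum

theorem sum_map_le {α : Type*} {f g : α → ℕ} {c : ℕ} (h : ∀ a, f a ≤ c * g a) (l : List α) :
    (l.map f).sum ≤ c * (l.map g).sum := by
  induction l with
  | nil => simp
  | cons a l ih =>
    have := h a
    simp only [List.map_cons, List.sum_cons, Nat.mul_add]
    omega

theorem runs_expand (hB : PrepBounds k n m r C B w) {g : Bfs n r} (h : BfsRep N g σ)
    {x : Fin n × Fin r} (hV : σ.reg yV = x.1) (hQ : σ.reg yQ = x.2) {c : ℕ} (hD : σ.reg yD = c)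
    (hc : c ≠ 0) (hcN : c ≤ N + 1) :
    Runs w (R.input s t) expandProg σ
      (110 * (((R.outgoing x.1).map fun e => edgeWeight R x.2 e + 1).sum + 1))
      (BfsRep N ((succs R x).foldl (relax c) g)) := by
  have hcap := hB.cap
  have hm := hB.m
  have hn := hB.n
  have hr := hB.r
  have hk := hB.k
  have hsm := hB.small
  have hx1 := x.1.2
  have hx2 := x.2.2
  have hlo := length_outgoing_le R x.1
  have hset (i : ℕ) (hi : i ≠ yTail) : ∀ (g : Bfs n r) σ v, BfsRep N g σ →
    BfsRep N g (σ.setReg i v) := fun _ _ v h => h.setReg hi v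
  have hsucc : (succs R x).foldl (relax c) g = (R.outgoing x.1).foldl (fun g e =>
      (R.labels e).foldl (fun g a => (R.delta x.2 a).foldl (fun g p =>
        relax c g (D.tgt e, p)) g) g) g := by
    simp only [succs, List.foldl_flatMap, List.foldl_map]
  rw [hsucc]
  refine (Runs.forFold (T := fun e => 90 * (edgeWeight R x.2 e + 1)) (Rep := BfsRep N)
    (l := R.outgoing x.1) (by omega) h (hset _ (by decide)) ?_ ?_ (by decide)).time ?_
  · intro g σ' hf _
    have h1 : σ'.reg yV = x.1 := (hf.reg _ (by decide)).trans hV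
    simp [h1]
    omega
  · intro i hi g σ' hf hg hxi
    have h1 : σ'.reg yV = x.1 := (hf.reg _ (by decide)).trans hV
    have h2 : σ'.reg yQ = x.2 := (hf.reg _ (by decide)).trans hQ
    have h3 : σ'.reg yD = c := (hf.reg _ (by decide)).trans hD
    have ho := input_outgoing (s := s) (t := t) 0 i hi
    generalize (R.outgoing x.1)[i] = e at *
    have he := e.2
    have hte := (D.tgt e).2
    have hll := length_labels_le R e
    refine (Runs.assign_seq (by simp [h1, hxi, ho]; omega) (Runs.assign_seq
      (by simp [h1, hxi, ho]; omega) (Runs.forFold (T := fun a => 60 * ((R.delta x.2 a).length + 1))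
        (Rep := BfsRep N) (l := R.labels e) (by omega)
        ((hg.setReg (by decide) _).setReg (by decide) _) (hset _ (by decide)) ?_ ?_
        (by decide)))).time ?_
    · intro g σ₂ hf₂ _
      have h4 : σ₂.reg yE = e := by
        rw [hf₂.reg _ (by decide)]
        simp [h1, hxi, ho]
      simp [h4]
      omega
    · intro j hj g σ₂ hf₂ hg₂ hxj
      have h4 : σ₂.reg yE = e := by
        rw [hf₂.reg _ (by decide)]
        simp [h1, hxi, ho]
      have h5 : σ₂.reg yU = D.tgt e := by
        rw [hf₂.reg _ (by decide)]
        simp [h1, hxi, ho]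
      have h6 : σ₂.reg yQ = x.2 := by
        rw [hf₂.reg _ (by decide)]
        simp [h2]
      have h7 : σ₂.reg yD = c := by
        rw [hf₂.reg _ (by decide)]
        simp [h3]
      have hlb := input_lbl (s := s) (t := t) 0 j hj
      generalize (R.labels e)[j] = a at *
      have ha := a.2
      have hld := length_delta_le R x.2 a
      refine (Runs.assign_seq (by simp [h4, hxj, hlb]; omega) (Runs.forFold (T := fun _ => 40)
        (Rep := BfsRep N) (l := R.delta x.2 a) (by omega)
        (hg₂.setReg (by decide) _) (hset _ (by decide)) ?_ ?_ (by decide))).time ?_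
      · intro g σ₃ hf₃ _
        have h8 : σ₃.reg yA = a := by
          rw [hf₃.reg _ (by decide)]
          simp [h4, hxj, hlb]
        have h9 : σ₃.reg yQ = x.2 := by
          rw [hf₃.reg _ (by decide)]
          simp [h6]
        simp [h8, h9]
        omega
      · intro l hl g σ₃ hf₃ hg₃ hxl
        have h8 : σ₃.reg yA = a := by
          rw [hf₃.reg _ (by decide)]
          simp [h4, hxj, hlb]
        have h9 : σ₃.reg yQ = x.2 := by
          rw [hf₃.reg _ (by decide)]
          simp [h6]
        have h10 : σ₃.reg yU = D.tgt e := by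
          rw [hf₃.reg _ (by decide)]
          simp [h5]
        have h11 : σ₃.reg yD = c := by
          rw [hf₃.reg _ (by decide)]
          simp [h7]
        have hdl := input_delta (s := s) (t := t) l hl
        generalize (R.delta x.2 a)[l] = p at *
        have hp := p.2
        refine (Runs.assign_seq (by simp [h8, h9, hxl, hdl]; omega)
          (runs_relax (y := (D.tgt e, p)) (c := c) hB (hg₃.setReg (by decide) _)
            (by simp [h10]) (by simp [h8, h9, hxl, hdl]) (by simp [h11]) hc hcN)).time (by simp)
      · simp
        omega
    · have := sum_map_le (f := fun a => 60 * ((R.delta x.2 a).length + 1) + (1 + 1 + 1 + 1) + 7) (c := 80)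
        (g := fun a => (R.delta x.2 a).length + 1) (fun a => by omega) (R.labels e)
      simp only [cost_input, cost_reg, cost_ofNat, edgeWeight]
      omega
  · have := sum_map_le (f := fun e => 90 * (edgeWeight R x.2 e + 1) + (1 + 1 + 1 + 1) + 7) (c := 110)
      (g := fun e => edgeWeight R x.2 e + 1) (fun a => by omega) (R.outgoing x.1)
    simp only [cost_input, cost_reg, cost_ofNat]
    omega

end DistinctWalks

namespace DistinctWalks

open TreeEnum WordRAM

variable {k n m r : ℕ} {D : Database (Fin k) (Fin n) (Fin m)} {A : NFA (Fin k) (Fin r)}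
  {R : MemoryRepresentation D A} {s t : Fin n} {B C w : ℕ} {σ : State}

/-- The time that the search spends on a pair, up to a constant factor. -/
def nodeWeight (R : MemoryRepresentation D A) (x : Fin n × Fin r) : ℕ :=
  ((R.outgoing x.1).map fun e => edgeWeight R x.2 e + 1).sum + 1

theorem runs_bfsInit (hB : PrepBounds k n m r C B w) :
    Runs w (R.input s t)
      (.assign yU (.input .source 0 0 0) ;; .assign yD 1 ;;
        forLt yP numQ (.ite (.input .isInitial (.reg yP) 0 0) relaxProg .skip))
      State.zero (60 * (r + 1)) fun σ' => ∃ g todo, BfsInv R s g [] todo ∧ BfsRep 0 g σ' := by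
  classical
  have hcap := hB.cap
  have hn := hB.n
  have hr := hB.r
  have hsm := hB.small
  have hs := s.2
  have h0 : BfsRep 0 (⟨[], fun _ => 0⟩ : Bfs n r) State.zero :=
    ⟨fun _ => rfl, by simp, by simp, rfl, ⟨by simp, by simp, by simp⟩, by simp⟩
  refine (Runs.assign_seq (by simp; omega) (Runs.assign_seq (by simp; omega)
    (Runs.forFold (T := fun _ => 40) (Rep := BfsRep 0) (l := List.finRange r)
      (f := fun g q => if q ∈ A.start then relax 1 g (s, q) else g)
      (by simp; omega) ((h0.setReg (by decide) _).setReg (by decide) _)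
      (fun g σ v h => h.setReg (by decide) v) ?_ ?_ (by decide)))).mono ?_ ?_
  · intro g σ' _ _
    simp
    omega
  · intro i hi g σ' hf hg hxi
    have hi' : i < r := by simpa using hi
    have hfin : (List.finRange r)[i] = ⟨i, hi'⟩ := by simp
    have hini := input_isInitial (R := R) (s := s) (t := t) 0 0 ⟨i, hi'⟩
    have h1 : σ'.reg yU = s := by rw [hf.reg _ (by decide)]; simp
    have h2 : σ'.reg yD = 1 := by rw [hf.reg _ (by decide)]; simp
    rw [hfin]
    simp only at hini
    refine (Runs.ite (T := 30) (T' := 1) (by simp [hxi, hini]; omega)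
      (fun hv => ?_) (fun hv => Runs.skip ?_)).time (by simp)
    · simp [hxi, hini] at hv
      rw [if_pos hv]
      exact runs_relax (y := (s, ⟨i, hi'⟩)) hB hg h1 hxi h2 one_ne_zero (by simp)
    · simp [hxi, hini] at hv
      rwa [if_neg hv]
  · simp
    omega
  · intro σ' _ h
    have h2 := BfsInv.init R s (l := (List.finRange r).filter fun q => q ∈ A.start) (by simp)
    rw [List.foldl_map, List.foldl_filter] at h2
    simp only [decide_eq_true_eq] at h2
    exact ⟨_, _, h2, h⟩

theorem runs_bfs (hB : PrepBounds k n m r C B w) :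
    Runs w (R.input s t) bfsProg State.zero (200 * (∑ x, nodeWeight R x + r + 1)) fun σ' =>
      ∃ d : Fin n × Fin r → ℕ, IsDist D A s d ∧ (∀ x, d x ≤ n * r) ∧
        ∀ x : Fin n × Fin r, σ'.mem aDist (x.1 * r + x.2) = d x := by
  classical
  have hcap := hB.cap
  have hnr := hB.nr
  have hn := hB.n
  have hr := hB.r
  have hsm := hB.small
  have key : ∀ σ g todo, BfsInv R s g [] todo → BfsRep 0 g σ → σ.reg yHead = 0 →
      Runs w (R.input s t) (.loop (.op .lt (.reg yHead) (.reg yTail))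
        (.assign yV (.read aQueueV (.reg yHead)) ;; .assign yQ (.read aQueueQ (.reg yHead)) ;;
          .assign yD (.read aDist (.reg yV * numQ + .reg yQ) + 1) ;; expandProg ;;
          .assign yHead (.reg yHead + 1))) σ (150 * ∑ x, nodeWeight R x + 4) fun σ' =>
      ∃ d : Fin n × Fin r → ℕ, IsDist D A s d ∧ (∀ x, d x ≤ n * r) ∧
        ∀ x : Fin n × Fin r, σ'.mem aDist (x.1 * r + x.2) = d x := by
    intro σ g todo hinv hrep hhead
    -- The pairs that have not been processed pay for the rest of the search.
    refine (Runs.loop (G := Bfs n r × List (Fin n × Fin r)) (g := (g, []))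
      (Inv := fun g σ => (∃ todo, BfsInv R s g.1 g.2 todo) ∧ BfsRep 0 g.1 σ ∧
        σ.reg yHead = g.2.length)
      (Φ := fun g => ∑ x, if x ∈ g.2 then 0 else 150 * nodeWeight R x)
      (T := fun g => if h : g.2.length < g.1.queue.length then
        110 * nodeWeight R g.1.queue[g.2.length] + 22 else 0)
      ⟨⟨todo, hinv⟩, hrep, by simpa using hhead⟩ ?_ ?_).mono ?_ ?_
    · intro g σ' _
      simp only [fits_lt, fits_reg, true_and]
      split_ifs <;> omega
    · rintro ⟨g, don⟩ σ' ⟨⟨todo, hi⟩, hR, hh⟩ - hv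
      simp only [val_lt, val_reg, hh, hR.tail, ne_eq, ite_eq_right_iff, one_ne_zero, imp_false,
        not_not] at hv
      simp only at hi hR hh
      cases todo with
      | nil => simp [hi.queue] at hv
      | cons x todo =>
        have hqx : g.queue[don.length] = x := by simp [hi.queue]
        have hdon : x ∉ don := by
          have := hi.wf.nodup
          rw [hi.queue, List.nodup_append] at this
          exact fun h => this.2.2 x h x (by simp) rfl
        have hq1 := hR.queueV _ hv
        have hq2 := hR.queueQ _ hv
        have hdx := hR.dist x
        have hlt := idx_lt x.1 x.2
        have hlen := hR.wf.length_le
        have hdle := hR.wf.le x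
        have hx1 := x.1.2
        have hx2 := x.2.2
        have hxr : (x.1 : ℕ) * r < cap w := by omega
        rw [hqx] at hq1 hq2
        have hR' : BfsRep g.queue.length g σ' :=
          ⟨hR.dist, hR.queueV, hR.queueQ, hR.tail, hR.wf, le_rfl⟩
        simp only [hv, dif_pos, hqx]
        refine (Runs.assign_seq (by simp) (Runs.assign_seq (by simp) (Runs.assign_seq
          ?_ (Runs.seq (runs_expand (N := g.queue.length) (x := x) (c := g.dist x + 1) hB
            (((hR'.setReg (by decide) _).setReg (by decide) _).setReg (by decide) _)
            ?_ ?_ ?_ (by simp) (by omega)) fun σ₂ hf₂ h₂ => Runs.assign ?_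
            ⟨((succs R x).foldl (relax (g.dist x + 1)) g, don ++ [x]), ⟨?_, ?_, ?_⟩, ?_⟩)))).time
            ?_
        · simp [hh, hq1, hq2, hdx]
          omega
        · simp [hh, hq1]
        · simp [hh, hq2]
        · simp [hh, hq1, hq2, hdx]
        · have : σ₂.reg yHead = don.length := by
            rw [hf₂.reg _ (by decide)]
            simp [hh]
          simp [this]
          omega
        · simp only [nodeWeight, cost_read, cost_reg, cost_add, cost_mul, cost_input, cost_ofNat]
          omega
        · obtain ⟨new, h⟩ := hi.step
          exact ⟨_, h⟩
        · have h3 : BfsRep 0 ((succs R x).foldl (relax (g.dist x + 1)) g) σ₂ :=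
            ⟨h₂.dist, h₂.queueV, h₂.queueQ, h₂.tail, h₂.wf, by simp⟩
          exact h3.setReg (by decide) _
        · have : σ₂.reg yHead = don.length := by
            rw [hf₂.reg _ (by decide)]
            simp [hh]
          simp [this]
        · have h4 : (∑ y, if y ∈ don then 0 else 150 * nodeWeight R y) =
              150 * nodeWeight R x + ∑ y, if y ∈ don ++ [x] then 0 else 150 * nodeWeight R y := by
            rw [← Finset.add_sum_erase _ _ (Finset.mem_univ x),
              ← Finset.add_sum_erase (a := x) _
                (fun y => if y ∈ don ++ [x] then 0 else 150 * nodeWeight R y) (Finset.mem_univ x)]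
            simp only [hdon, if_false, List.mem_append, List.mem_singleton, or_true, if_true,
              zero_add]
            congr 1
            refine Finset.sum_congr rfl fun y hy => ?_
            simp [Finset.ne_of_mem_erase hy]
          have : 1 ≤ nodeWeight R x := Nat.succ_pos _
          simp only [h4, cost_op, cost_reg]
          omega
    · simp [Finset.mul_sum]
    · rintro σ' - ⟨⟨g, don⟩, ⟨⟨todo, hi⟩, hR, hh⟩, hv⟩
      simp only [val_lt, val_reg, hh, hR.tail, ite_eq_right_iff, one_ne_zero, imp_false, not_lt]
        at hv
      simp only at hi hR
      obtain rfl : todo = [] := by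
        rw [hi.queue, List.length_append] at hv
        exact List.eq_nil_of_length_eq_zero (by omega)
      exact ⟨g.dist, hi.isDist, fun x => (hi.wf.le x).trans hi.wf.length_le, hR.dist⟩
  obtain ⟨σ₁, n₁, hx₁, hn₁, g, todo, h1, h2⟩ := runs_bfsInit (R := R) (s := s) (t := t) hB
  -- The initialization consists of the first three of the four commands of `bfsProg`.
  cases hx₁ with
  | seq hx₁ hx₂ =>
    cases hx₂ with
    | seq hx₂ hx₃ =>
      have h3 := (Frame.of_exec hx₁).reg yHead (by decide)
      have h4 := (Frame.of_exec hx₂).reg yHead (by decide)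
      have h5 := (Frame.of_exec hx₃).reg yHead (by decide)
      obtain ⟨σ', n', hx', hn', h⟩ := key σ₁ g todo h1 h2 (by rw [h5, h4, h3]; rfl)
      exact ⟨σ', _, .seq hx₁ (.seq hx₂ (.seq hx₃ hx')), by omega, h⟩

end DistinctWalks

/-! ### The precomputed tables -/

namespace DistinctWalks

open TreeEnum WordRAM

/-- Computes `λ + 1` and a final state at distance `λ` of the target. The condition is a product and
a sum of truth values: `q` is final and reachable, and it is the first such state or closer than
the best one so far. -/
def minProg : Prog Accessor :=
  forLt yQ numQ
    (.assign yX (.read aDist (.input .target 0 0 0 * numQ + .reg yQ)) ;;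
      .ite (.input .isFinal (.reg yQ) 0 0 * (.op .lt 0 (.reg yX) *
          (.op .eq (.reg yAns) 0 + .op .lt (.reg yX) (.reg yAns))))
        (.assign yAns (.reg yX) ;; .assign yFinal (.reg yQ)) .skip)

/-- Computes the table of the final states at distance `λ` of the target. -/
def finalsProg : Prog Accessor :=
  forLt yQ numQ
    (.store tFin (.reg yQ) (.input .isFinal (.reg yQ) 0 0 *
      .op .eq (.read aDist (.input .target 0 0 0 * numQ + .reg yQ)) (.reg yAns)))

variable {k n m r : ℕ} {D : Database (Fin k) (Fin n) (Fin m)} {A : NFA (Fin k) (Fin r)}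
  {R : MemoryRepresentation D A} {s t : Fin n} {B C w : ℕ} {σ : State}
  {d : Fin n × Fin r → ℕ}

/-- The array `aDist` contains the distances `d`. -/
def DistRep (d : Fin n × Fin r → ℕ) (σ : State) : Prop :=
  ∀ x : Fin n × Fin r, σ.mem aDist (x.1 * r + x.2) = d x

/-- The number `a` is the minimum of the nonzero distances of the final states `q` with `q < i`,
and `f` is a state where it is attained; `a = 0` if there are none. -/
def IsAns (A : NFA (Fin k) (Fin r)) (d : Fin n × Fin r → ℕ) (t : Fin n) (i a f : ℕ) : Prop :=
  (a = 0 ∧ ∀ q ∈ A.accept, (q : ℕ) < i → d (t, q) = 0) ∨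
  (a ≠ 0 ∧ (∃ q ∈ A.accept, d (t, q) = a ∧ f = q) ∧
    ∀ q ∈ A.accept, (q : ℕ) < i → d (t, q) ≠ 0 → a ≤ d (t, q))

theorem runs_min (hB : PrepBounds k n m r C B w) (hd : DistRep d σ) (h0 : σ.reg yAns = 0) :
    Runs w (R.input s t) minProg σ (60 * (r + 1)) fun σ' =>
      IsAns A d t r (σ'.reg yAns) (σ'.reg yFinal) := by
  classical
  have hcap := hB.cap
  have hnr := hB.nr
  have hn := hB.n
  have hr := hB.r
  have hsm := hB.small
  have ht := t.2
  refine (Runs.forLt (B := r) (T := fun _ => 40)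
    (Inv := fun i σ' => IsAns A d t i (σ'.reg yAns) (σ'.reg yFinal)) (by omega) ?_ ?_ ?_
    (by decide)).time ?_
  · exact Or.inl ⟨by simpa using h0, by simp⟩
  · intro i σ' _ _ _
    simp
    omega
  · intro i σ' hi hf hI hx
    have hlt := idx_lt t (⟨i, hi⟩ : Fin r)
    have htr : (t : ℕ) * r < cap w := by omega
    have hdi : σ'.mem aDist (t * r + i) = d (t, ⟨i, hi⟩) := by
      rw [hf.mem _ (by decide)]
      exact hd (t, ⟨i, hi⟩)
    have hfin := input_isFinal (R := R) (s := s) (t := t) 0 0 ⟨i, hi⟩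
    simp only at hlt hfin
    refine (Runs.assign_seq ?_ (Runs.ite (T := 4) (T' := 1) ?_
      (fun hv => (Runs.assign_seq (by simp) (Runs.assign (by simp) ?_)).time (by simp))
      (fun hv => Runs.skip ?_))).time ?_
    · simp [hx]
      omega
    · simp [hx, hfin, hdi]
      split_ifs <;> simp <;> omega
    · simp [hx, hfin, hdi] at hv ⊢
      refine Or.inr ⟨by omega, ⟨⟨i, hi⟩, by tauto, rfl, rfl⟩, fun q hq hqi hq0 => ?_⟩
      obtain hqi | rfl : (q : ℕ) < i ∨ q = ⟨i, hi⟩ := by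
        rcases Nat.lt_succ_iff_lt_or_eq.1 hqi with h | h
        · exact Or.inl h
        · exact Or.inr (Fin.ext h)
      · rcases hI with ⟨_, h⟩ | ⟨h0, _, h⟩
        · exact absurd (h q hq hqi) hq0
        · have := h q hq hqi hq0
          omega
      · exact le_rfl
    · simp [hx, hfin, hdi] at hv ⊢
      rcases hI with ⟨h0, h⟩ | ⟨h0, hex, h⟩
      · refine Or.inl ⟨h0, fun q hq hqi => ?_⟩
        rcases Nat.lt_succ_iff_lt_or_eq.1 hqi with h' | h'
        · exact h q hq h'
        · obtain rfl : q = ⟨i, hi⟩ := Fin.ext h'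
          by_contra hne
          have := hv (Nat.pos_of_ne_zero hne) hq
          omega
      · refine Or.inr ⟨h0, hex, fun q hq hqi hq0 => ?_⟩
        rcases Nat.lt_succ_iff_lt_or_eq.1 hqi with h' | h'
        · exact h q hq h' hq0
        · obtain rfl : q = ⟨i, hi⟩ := Fin.ext h'
          have := hv (Nat.pos_of_ne_zero hq0) hq
          omega
    · simp
  · simp
    omega

open Classical in
theorem runs_finals (hB : PrepBounds k n m r C B w) (hd : DistRep d σ) :
    Runs w (R.input s t) finalsProg σ (60 * (r + 1)) fun σ' =>
      ∀ q : Fin r, σ'.mem tFin q = if q ∈ A.accept ∧ d (t, q) = σ.reg yAns then 1 else 0 := by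
  have hcap := hB.cap
  have hnr := hB.nr
  have hn := hB.n
  have hr := hB.r
  have hsm := hB.small
  have ht := t.2
  refine (Runs.forLt (B := r) (T := fun _ => 40) (Inv := fun i σ' => ∀ q : Fin r, (q : ℕ) < i →
      σ'.mem tFin q = if q ∈ A.accept ∧ d (t, q) = σ.reg yAns then 1 else 0)
    (by omega) (by simp) ?_ ?_ (by decide)).mono ?_ fun σ' _ h q => h q q.2
  · intro i σ' _ _ _
    simp
    omega
  · intro i σ' hi hf hI hx
    have hlt := idx_lt t (⟨i, hi⟩ : Fin r)
    have htr : (t : ℕ) * r < cap w := by omega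
    have hdi : σ'.mem aDist (t * r + i) = d (t, ⟨i, hi⟩) := by
      rw [hf.mem _ (by decide)]
      exact hd (t, ⟨i, hi⟩)
    have hans : σ'.reg yAns = σ.reg yAns := hf.reg _ (by decide)
    have hfin := input_isFinal (R := R) (s := s) (t := t) 0 0 ⟨i, hi⟩
    simp only at hlt hfin
    refine (Runs.store (by simp) ?_ ?_).time ?_
    · simp [hx, hfin, hdi]
      split_ifs <;> omega
    · intro q hq
      rcases Nat.lt_succ_iff_lt_or_eq.1 hq with h' | h'
      · have := hI q h'
        simp only [setReg_mem, setCell_mem, val_reg, hx, if_true, h'.ne, if_false, this]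
      · obtain rfl : q = ⟨i, hi⟩ := Fin.ext h'
        simp [hx, hfin, hdi, hans, ← ite_and, and_comm]
    · simp
  · simp
    omega

end DistinctWalks

/-! ### The precomputed edges of the product -/

namespace DistinctWalks

open TreeEnum WordRAM

/-- Adds the pair `(yQ, yP)` to the list of the edge `yE` if this edge of the product is on a
shortest path. -/
def pushProg : Prog Accessor :=
  .assign yX (.reg yV * numQ + .reg yP) ;;
  .ite (.op .eq (.read aDist (.reg yX)) (.reg yD + 1))
    (.store tFrom (.reg yCount) (.reg yQ) ;; .store tTo (.reg yCount) (.reg yP) ;;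
      .store tLast (.reg yX) (.reg yE + 1) ;; .store aParent (.reg yX) (.reg yQ) ;;
      .assign yCount (.reg yCount + 1))
    .skip

/-- Adds all pairs that start with the state `yQ` to the list of the edge `yE`. -/
def collectProg : Prog Accessor :=
  .assign yD (.read aDist (.reg yU * numQ + .reg yQ)) ;;
  .ite (.reg yD)
    (forLt yJ (.input .lblCard (.reg yE) 0 0)
      (.assign yA (.input .lbl (.reg yE) (.reg yJ) 0) ;;
        forLt yL (.input .deltaCard (.reg yQ) (.reg yA) 0)
          (.assign yP (.input .delta (.reg yQ) (.reg yA) (.reg yL)) ;; pushProg)))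
    .skip

/-- Computes the entries of the tables for the edge `yE`. -/
def edgeProg : Prog Accessor :=
  .assign yU (.input .src (.reg yE) 0 0) ;; .assign yV (.input .tgt (.reg yE) 0 0) ;;
  .store tSrc (.reg yE) (.reg yU) ;; .store tTgt (.reg yE) (.reg yV) ;;
  .store tStart (.reg yE) (.reg yCount) ;;
  forLt yQ numQ
    (.store tPrv (.reg yE * numQ + .reg yQ) (.read tLast (.reg yV * numQ + .reg yQ))) ;;
  forLt yQ numQ collectProg ;;
  .store tEnd (.reg yE) (.reg yCount)

/-- Computes the tables of the edges. -/
def edgesProg : Prog Accessor := forLt yE (.input .numEdges 0 0 0) edgeProg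

variable {k n m r : ℕ} {D : Database (Fin k) (Fin n) (Fin m)} {A : NFA (Fin k) (Fin r)}
  {R : MemoryRepresentation D A} {s t : Fin n} {B C w : ℕ} {σ : State}
  {d : Fin n × Fin r → ℕ}

/-- The list of the pair `(q', p)` if distances increase by `1` from `q'` to `p` along `e`, else the
empty list. -/
def stepPairs (D : Database (Fin k) (Fin n) (Fin m)) (d : Fin n × Fin r → ℕ) (e : Fin m)
    (q' p : Fin r) : List (Fin r × Fin r) :=
  if d (D.tgt e, p) = d (D.src e, q') + 1 then [(q', p)] else []

/-- The pairs of states that start with `q'` and are joined by `e` on shortest paths. -/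
def pairsFrom (R : MemoryRepresentation D A) (d : Fin n × Fin r → ℕ) (e : Fin m) (q' : Fin r) :
    List (Fin r × Fin r) :=
  if d (D.src e, q') ≠ 0 then
    (R.labels e).flatMap fun a => (R.delta q' a).flatMap fun p => stepPairs D d e q' p else []

/-- The pairs of states that are joined by `e` on shortest paths, in the order in which they are
found; a pair is repeated if it is joined by several labels. -/
def pairsOf (R : MemoryRepresentation D A) (d : Fin n × Fin r → ℕ) (e : Fin m) :
    List (Fin r × Fin r) :=
  (List.finRange r).flatMap fun q' => pairsFrom R d e q'

theorem mem_pairsOf {e : Fin m} {q' q : Fin r} :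
    (q', q) ∈ pairsOf R d e ↔ Good D A d e q' q := by
  simp only [pairsOf, pairsFrom, stepPairs, Good, Trans, List.mem_flatMap, List.mem_finRange,
    true_and]
  constructor
  · rintro ⟨q₁, h⟩
    split_ifs at h with h0
    · simp only [List.mem_flatMap] at h
      obtain ⟨a, ha, p, hp, h⟩ := h
      split_ifs at h with h1
      · simp only [List.mem_singleton, Prod.mk.injEq] at h
        obtain ⟨rfl, rfl⟩ := h
        exact ⟨h0, h1, a, (R.mem_labels _ _).1 ha, (R.mem_delta _ _ _).1 hp⟩
      · simp at h
    · simp at h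
  · rintro ⟨h0, h1, a, ha, hp⟩
    refine ⟨q', ?_⟩
    rw [if_pos h0]
    simp only [List.mem_flatMap]
    exact ⟨a, (R.mem_labels _ _).2 ha, q, (R.mem_delta _ _ _).2 hp, by simp [h1]⟩

theorem mem_snd_pairsOf {e : Fin m} {q : Fin r} :
    q ∈ (pairsOf R d e).map Prod.snd ↔ ∃ q', Good D A d e q' q := by
  simp only [List.mem_map, Prod.exists, exists_eq_right, mem_pairsOf]

/-- The number of transitions of the automaton. -/
def numTrans (R : MemoryRepresentation D A) : ℕ := ∑ q, ∑ a, (R.delta q a).length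

theorem sum_map_le_univ {α : Type*} [Fintype α] {l : List α} (hl : l.Nodup) (f : α → ℕ) :
    (l.map f).sum ≤ ∑ a, f a := by
  classical
  rw [← List.sum_toFinset f hl]
  exact Finset.sum_le_sum_of_subset (Finset.subset_univ _)

theorem sum_map_finRange {a : ℕ} (f : Fin a → ℕ) : ((List.finRange a).map f).sum = ∑ i, f i := by
  rw [Fin.sum_univ_def]

/-- As the labels of an edge are different, each transition contributes at most one pair. This is
why a level of the search tree is passed in time `O(|A|)`. -/
theorem length_pairsOf_le (e : Fin m) : (pairsOf R d e).length ≤ numTrans R := by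
  rw [pairsOf, List.length_flatMap, sum_map_finRange]
  refine Finset.sum_le_sum fun q _ => ?_
  rw [pairsFrom]
  split_ifs
  · rw [List.length_flatMap]
    refine le_trans ?_ (sum_map_le_univ (R.labels_nodup e) _)
    refine List.sum_le_sum fun a _ => ?_
    rw [List.length_flatMap]
    refine le_trans (b := ((R.delta q a).map fun _ => 1).sum) (List.sum_le_sum fun p _ => ?_)
      (by simp)
    rw [stepPairs]
    split_ifs <;> simp
  · simp

/-- While the edge `e` is treated: the list of all pairs found for the edges before `e` is `T`, and
`L` contains the pairs found for `e` so far. -/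
structure PairRep (D : Database (Fin k) (Fin n) (Fin m)) (A : NFA (Fin k) (Fin r))
    (d : Fin n × Fin r → ℕ) (e : Fin m) (T L : List (Fin r × Fin r)) (σ : State) : Prop where
  dist : DistRep d σ
  count : σ.reg yCount = (T ++ L).length
  fst : ∀ i (h : i < (T ++ L).length), σ.mem tFrom i = (T ++ L)[i].1
  snd : ∀ i (h : i < (T ++ L).length), σ.mem tTo i = (T ++ L)[i].2
  last : ∀ x : Fin n × Fin r, σ.mem tLast (x.1 * r + x.2) =
    if x.1 = D.tgt e ∧ x.2 ∈ L.map Prod.snd then (e : ℕ) + 1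
    else code (pick (Enters D A d x.1 x.2) e)
  parent : ∀ (x : Fin n × Fin r) (e' : Fin m), σ.mem tLast (x.1 * r + x.2) = e' + 1 →
    ∃ q' : Fin r, Good D A d e' q' x.2 ∧ D.tgt e' = x.1 ∧ σ.mem aParent (x.1 * r + x.2) = q'

theorem PairRep.setReg {e : Fin m} {T L : List (Fin r × Fin r)} (h : PairRep D A d e T L σ) {x : ℕ}
    (hx : x ≠ yCount) (v : ℕ) : PairRep D A d e T L (σ.setReg x v) :=
  ⟨h.dist, by simp [hx.symm, h.count], h.fst, h.snd, h.last, h.parent⟩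

theorem runs_push (hB : PrepBounds k n m r C B w) (hdB : ∀ x, d x ≤ n * r)
    {e : Fin m} {T L : List (Fin r × Fin r)} (h : PairRep D A d e T L σ) {q' p : Fin r}
    (hV : σ.reg yV = D.tgt e) (hQ : σ.reg yQ = q') (hP : σ.reg yP = p) (hE : σ.reg yE = e)
    (hD : σ.reg yD = d (D.src e, q'))
    (hg : d (D.tgt e, p) = d (D.src e, q') + 1 → Good D A d e q' p)
    (hlen : (T ++ (L ++ stepPairs D d e q' p)).length < cap w) :
    Runs w (R.input s t) pushProg σ 40 (PairRep D A d e T (L ++ stepPairs D d e q' p)) := by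
  have hcap := hB.cap
  have hnr := hB.nr
  have hn := hB.n
  have hr := hB.r
  have hm := hB.m
  have hsm := hB.small
  have hlt := idx_lt (D.tgt e) p
  have hte := (D.tgt e).2
  have he := e.2
  have hp := p.2
  have htr : (D.tgt e : ℕ) * r < cap w := by omega
  have h1 := h.dist (D.tgt e, p)
  have h2 := hdB (D.src e, q')
  simp only at h1
  refine (Runs.assign_seq (by simp [hV, hP]; omega) (Runs.ite (T := 18) (T' := 1)
    (by simp [hD]; omega) (fun hv => (Runs.store_seq (by simp) (by simp) (Runs.store_seq
      (by simp) (by simp) (Runs.store_seq (by simp) (by simp [hE]; omega) (Runs.store_seq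
      (by simp) (by simp) (Runs.assign ?_ ?_))))).time (by simp))
    (fun hv => Runs.skip ?_))).time (by simp)
  · simp [hV, hP, h1, hD] at hv
    simp [stepPairs, hv] at hlen
    simp [h.count]
    omega
  · simp [hV, hP, h1, hD] at hv
    have hgood := hg hv
    have hs : stepPairs D d e q' p = [(q', p)] := by simp [stepPairs, hv]
    rw [hs]
    refine ⟨fun x => by simpa using h.dist x, ?_, ?_, ?_, ?_, ?_⟩
    · simp [h.count]
      omega
    · intro i hi
      by_cases hx : i = (T ++ L).length
      · subst hx
        simp [h.count, hQ, List.getElem_append_right]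
      · have hi' : i < (T ++ L).length := by simp at hi hx ⊢; omega
        simp only [← List.append_assoc]
        rw [List.getElem_append_left hi']
        simp [h.count, h.fst i hi']
        simp at hx
        exact fun h => absurd h hx
    · intro i hi
      by_cases hx : i = (T ++ L).length
      · subst hx
        simp [h.count, hP, List.getElem_append_right]
      · have hi' : i < (T ++ L).length := by simp at hi hx ⊢; omega
        simp only [← List.append_assoc]
        rw [List.getElem_append_left hi']
        simp [h.count, h.snd i hi']
        simp at hx
        exact fun h => absurd h hx
    · intro x
      have hl := h.last x
      by_cases hx : x = (D.tgt e, p)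
      · subst hx
        simp [hV, hP, hE]
      · have hx' : ¬ ((x.1 : ℕ) * r + x.2 = D.tgt e * r + p) :=
          fun h => hx (idx_inj (y := (D.tgt e, p)).1 h)
        have hx2 : (x.1 = D.tgt e ∧ x.2 ∈ (L ++ [(q', p)]).map Prod.snd) ↔
            (x.1 = D.tgt e ∧ x.2 ∈ L.map Prod.snd) := by
          refine and_congr_right fun h1 => ?_
          rw [List.map_append, List.mem_append]
          refine or_iff_left fun h2 => hx (Prod.ext h1 (by simpa using h2))
        simp only [hx2, ← hl]
        simp [hV, hP, hx']
    · intro x e' he'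
      by_cases hx : x = (D.tgt e, p)
      · subst hx
        simp [hV, hP, hE] at he'
        obtain rfl : e = e' := Fin.ext he'
        exact ⟨q', hgood, rfl, by simp [hV, hP, hQ]⟩
      · have hx' : ¬ ((x.1 : ℕ) * r + x.2 = D.tgt e * r + p) :=
          fun h => hx (idx_inj (y := (D.tgt e, p)).1 h)
        simp [hV, hP, hx'] at he' ⊢
        exact h.parent x e' he'
  · simp [hV, hP, h1, hD] at hv
    simp only [stepPairs, hv, if_false, List.append_nil]
    exact h.setReg (by decide) _

theorem runs_collect (hB : PrepBounds k n m r C B w) (hdB : ∀ x, d x ≤ n * r)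
    {e : Fin m} {T L : List (Fin r × Fin r)} (h : PairRep D A d e T L σ) {q' : Fin r}
    (hU : σ.reg yU = D.src e) (hV : σ.reg yV = D.tgt e) (hQ : σ.reg yQ = q') (hE : σ.reg yE = e)
    (hlen : (T ++ (L ++ pairsFrom R d e q')).length < cap w) :
    Runs w (R.input s t) collectProg σ (100 * (edgeWeight R q' e + 1))
      (PairRep D A d e T (L ++ pairsFrom R d e q')) := by
  have hcap := hB.cap
  have hnr := hB.nr
  have hn := hB.n
  have hr := hB.r
  have hk := hB.k
  have hm := hB.m
  have hsm := hB.small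
  have hlt := idx_lt (D.src e) q'
  have hse := (D.src e).2
  have he := e.2
  have hq := q'.2
  have hsr : (D.src e : ℕ) * r < cap w := by omega
  have hd1 := h.dist (D.src e, q')
  have hll := length_labels_le R e
  simp only at hd1
  have hset (i : ℕ) (hi : i ≠ yCount) : ∀ L σ v, PairRep D A d e T L σ →
    PairRep D A d e T L (σ.setReg i v) := fun _ _ v h => h.setReg hi v
  refine (Runs.assign_seq (by simp [hU, hQ]; omega) (Runs.ite
    (T := 90 * edgeWeight R q' e + 10) (T' := 1) (by simp) (fun hv => ?_)
    (fun hv => Runs.skip ?_))).time (by simp; omega)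
  · simp [hU, hQ, hd1] at hv
    have hpf : pairsFrom R d e q' = (R.labels e).flatMap fun a =>
        (R.delta q' a).flatMap fun p => stepPairs D d e q' p := by
      rw [pairsFrom, if_pos hv]
    rw [hpf] at hlen ⊢
    refine (Runs.forAppend (T := fun a => 70 * ((R.delta q' a).length + 1)) (by omega)
      (h.setReg (by decide) _) (hset _ (by decide)) ?_ ?_ (by decide)).time ?_
    · intro L σ₁ hf₁ _
      have h4 : σ₁.reg yE = e := by rw [hf₁.reg _ (by decide)]; simp [hE]
      simp [h4]
      omega
    · intro j hj L₁ σ₁ hf₁ hlen₁ hL₁ hxj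
      have h4 : σ₁.reg yE = e := by rw [hf₁.reg _ (by decide)]; simp [hE]
      have h5 : σ₁.reg yV = D.tgt e := by rw [hf₁.reg _ (by decide)]; simp [hV]
      have h6 : σ₁.reg yQ = q' := by rw [hf₁.reg _ (by decide)]; simp [hQ]
      have h7 : σ₁.reg yD = d (D.src e, q') := by
        rw [hf₁.reg _ (by decide)]
        simp [hU, hQ, hd1]
      have hlb := input_lbl (s := s) (t := t) 0 j hj
      have hmem := (R.mem_labels _ _).1 (List.getElem_mem hj)
      generalize (R.labels e)[j] = a at *
      have ha := a.2
      have hld := length_delta_le R q' a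
      refine (Runs.assign_seq (by simp [h4, hxj, hlb]; omega) (Runs.forAppend (T := fun _ => 50)
        (by omega) (hL₁.setReg (by decide) _) (hset _ (by decide)) ?_ ?_ (by decide))).time ?_
      · intro L σ₂ hf₂ _
        have h8 : σ₂.reg yA = a := by rw [hf₂.reg _ (by decide)]; simp [h4, hxj, hlb]
        have h9 : σ₂.reg yQ = q' := by rw [hf₂.reg _ (by decide)]; simp [h6]
        simp [h8, h9]
        omega
      · intro l hl L₂ σ₂ hf₂ hlen₂ hL₂ hxl
        have h8 : σ₂.reg yA = a := by rw [hf₂.reg _ (by decide)]; simp [h4, hxj, hlb]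
        have h9 : σ₂.reg yQ = q' := by rw [hf₂.reg _ (by decide)]; simp [h6]
        have h10 : σ₂.reg yV = D.tgt e := by rw [hf₂.reg _ (by decide)]; simp [h5]
        have h11 : σ₂.reg yE = e := by rw [hf₂.reg _ (by decide)]; simp [h4]
        have h12 : σ₂.reg yD = d (D.src e, q') := by rw [hf₂.reg _ (by decide)]; simp [h7]
        have hdl := input_delta (s := s) (t := t) l hl
        have hmem' := (R.mem_delta _ _ _).1 (List.getElem_mem hl)
        generalize (R.delta q' a)[l] = p at *
        have hp := p.2
        refine (Runs.assign_seq (by simp [h8, h9, hxl, hdl]; omega)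
          (runs_push (q' := q') (p := p) hB hdB (hL₂.setReg (by decide) _)
            (by simp [h10]) (by simp [h9]) (by simp [h8, h9, hxl, hdl]) (by simp [h11])
            (by simp [h12]) (fun h => ⟨hv, h, a, hmem, hmem'⟩) ?_)).time (by simp)
        rw [List.length_append] at hlen ⊢
        omega
      · simp
        omega
    · have := sum_map_le (f := fun a => 70 * ((R.delta q' a).length + 1) + (1 + 1 + 1 + 1) + 7)
        (c := 90) (g := fun a => (R.delta q' a).length + 1) (fun a => by omega) (R.labels e)
      simp only [cost_input, cost_reg, cost_ofNat, edgeWeight]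
      omega
  · simp [hU, hQ, hd1] at hv
    simp only [pairsFrom, hv, ne_eq, not_true, if_false, List.append_nil]
    exact h.setReg (by decide) _

end DistinctWalks

namespace DistinctWalks

open TreeEnum WordRAM

variable {k n m r : ℕ} {D : Database (Fin k) (Fin n) (Fin m)} {A : NFA (Fin k) (Fin r)}
  {R : MemoryRepresentation D A} {s t : Fin n} {B C w : ℕ} {σ : State}
  {d : Fin n × Fin r → ℕ}

/-- The tables contain the correct entries for the edges `e < i`, and `T` is the list of the pairs
found for these edges. -/
structure EdgesRep (R : MemoryRepresentation D A) (d : Fin n × Fin r → ℕ) (i : ℕ)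
    (T : List (Fin r × Fin r)) (σ : State) : Prop where
  dist : DistRep d σ
  count : σ.reg yCount = T.length
  le : T.length ≤ i * numTrans R
  fst : ∀ j (h : j < T.length), σ.mem tFrom j = T[j].1
  snd : ∀ j (h : j < T.length), σ.mem tTo j = T[j].2
  last : ∀ x : Fin n × Fin r, σ.mem tLast (x.1 * r + x.2) = code (pick (Enters D A d x.1 x.2) i)
  parent : ∀ (x : Fin n × Fin r) (e' : Fin m), σ.mem tLast (x.1 * r + x.2) = e' + 1 →
    ∃ q' : Fin r, Good D A d e' q' x.2 ∧ D.tgt e' = x.1 ∧ σ.mem aParent (x.1 * r + x.2) = q'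
  src : ∀ e : Fin m, (e : ℕ) < i → σ.mem tSrc e = D.src e
  tgt : ∀ e : Fin m, (e : ℕ) < i → σ.mem tTgt e = D.tgt e
  prv : ∀ (e : Fin m) (q : Fin r), (e : ℕ) < i →
    σ.mem tPrv (e * r + q) = code (pick (Enters D A d (D.tgt e) q) e)
  tend : ∀ e : Fin m, (e : ℕ) < i → σ.mem tEnd e = σ.mem tStart e + (pairsOf R d e).length
  tend_le : ∀ e : Fin m, (e : ℕ) < i → σ.mem tEnd e ≤ T.length
  slice : ∀ (e : Fin m) (j : ℕ) (h : j < (pairsOf R d e).length), (e : ℕ) < i →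
    T[σ.mem tStart e + j]? = some (pairsOf R d e)[j]

/-- The time spent on an edge, up to a constant factor. -/
def rowWeight (R : MemoryRepresentation D A) (e : Fin m) : ℕ := ∑ q, (edgeWeight R q e + 1)

theorem le_rowWeight (e : Fin m) : r ≤ rowWeight R e := by
  calc r = ∑ _q : Fin r, 1 := by simp
    _ ≤ _ := Finset.sum_le_sum fun q _ => by omega

/-- While the edge `e` is treated, `tLast` still contains the greatest entering edges before `e`;
the row of its target is copied. -/
theorem runs_prv (hB : PrepBounds k n m r C B w) {e : Fin m} (hV : σ.reg yV = D.tgt e)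
    (hE : σ.reg yE = e)
    (hl : ∀ x : Fin n × Fin r, σ.mem tLast (x.1 * r + x.2) = code (pick (Enters D A d x.1 x.2) e))
    (hp : ∀ (e' : Fin m) (q : Fin r), (e' : ℕ) < e →
      σ.mem tPrv (e' * r + q) = code (pick (Enters D A d (D.tgt e') q) e')) :
    Runs w (R.input s t)
      (forLt yQ numQ
        (.store tPrv (.reg yE * numQ + .reg yQ) (.read tLast (.reg yV * numQ + .reg yQ)))) σ
      (50 * (r + 1)) fun σ' => ∀ (e' : Fin m) (q : Fin r), (e' : ℕ) < e + 1 →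
        σ'.mem tPrv (e' * r + q) = code (pick (Enters D A d (D.tgt e') q) e') := by
  have hcap := hB.cap
  have hnr := hB.nr
  have hmr := hB.mr
  have hm := hB.m
  have hn := hB.n
  have hr := hB.r
  have hsm := hB.small
  have ht := (D.tgt e).2
  have he := e.2
  refine (Runs.forLt (B := r) (T := fun _ => 20) (Inv := fun i σ' => ∀ (e' : Fin m) (q : Fin r),
    (e' : ℕ) < e ∨ e' = e ∧ (q : ℕ) < i →
      σ'.mem tPrv (e' * r + q) = code (pick (Enters D A d (D.tgt e') q) e')) (by omega)
    (by simpa using hp) ?_ ?_ (by decide)).mono ?_ ?_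
  · intro i σ' _ _ _
    simp
    omega
  · intro i σ' hi hf hI hx
    have hlt := idx_lt (D.tgt e) (⟨i, hi⟩ : Fin r)
    have hlt' := idx_lt e (⟨i, hi⟩ : Fin r)
    have h1 : σ'.reg yE = e := by rw [hf.reg _ (by decide), hE]
    have h2 : σ'.reg yV = D.tgt e := by rw [hf.reg _ (by decide), hV]
    have h3 := hl (D.tgt e, ⟨i, hi⟩)
    rw [← hf.mem _ (by decide)] at h3
    simp only at hlt hlt' h3
    have htr : (D.tgt e : ℕ) * r < cap w := by omega
    have her : (e : ℕ) * r < cap w := by omega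
    refine (Runs.store (by simp [h1, hx]; omega) (by simp [h2, hx]; omega) ?_).time (by simp)
    intro e' q hq
    by_cases h : e' = e ∧ (q : ℕ) = i
    · obtain ⟨rfl, h⟩ := h
      obtain rfl : q = ⟨i, hi⟩ := Fin.ext h
      simp [h1, h2, hx, h3]
    · have h' : ¬ ((e' : ℕ) * r + q = e * r + i) := fun h' => by
        have := idx_inj (x := (e', q)) (y := (e, ⟨i, hi⟩)).1 h'
        simp only [Prod.mk.injEq] at this
        exact h ⟨this.1, by simp [this.2]⟩
      simp [h1, h2, hx, h']
      refine hI e' q ?_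
      rcases hq with hq | ⟨rfl, hq⟩
      · exact Or.inl hq
      · refine Or.inr ⟨rfl, ?_⟩
        have : (q : ℕ) ≠ i := fun h2 => h ⟨rfl, h2⟩
        omega
  · simp
    omega
  · intro σ' _ h e' q he'
    refine h e' q ?_
    rcases Nat.lt_succ_iff_lt_or_eq.1 he' with h1 | h1
    · exact Or.inl h1
    · exact Or.inr ⟨Fin.ext h1, q.2⟩

/-- How the greatest entering edge changes when the edge `e` has been treated. -/
theorem pick_enters_succ {e : Fin m} {v : Fin n} {q : Fin r} :
    (if v = D.tgt e ∧ q ∈ (pairsOf R d e).map Prod.snd then (e : ℕ) + 1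
      else code (pick (Enters D A d v q) e)) = code (pick (Enters D A d v q) (e + 1)) := by
  have h : (v = D.tgt e ∧ q ∈ (pairsOf R d e).map Prod.snd) ↔ Enters D A d v q e := by
    rw [mem_snd_pairsOf, Enters, eq_comm]
  split_ifs with h'
  · rw [pick_succ_of (h.1 h')]
    rfl
  · rw [pick_succ_of_not fun h2 => h' (h.2 h2)]

theorem runs_edge (hB : PrepBounds k n m r (numTrans R) B w) (hdB : ∀ x, d x ≤ n * r)
    {e : Fin m} {T : List (Fin r × Fin r)} (h : EdgesRep R d e T σ) (hE : σ.reg yE = e) :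
    Runs w (R.input s t) edgeProg σ (250 * (rowWeight R e + 1))
      (EdgesRep R d (e + 1) (T ++ pairsOf R d e)) := by
  have hcap := hB.cap
  have hnr := hB.nr
  have hmr := hB.mr
  have hmC := hB.mC
  have hm := hB.m
  have hn := hB.n
  have hr := hB.r
  have hsm := hB.small
  have ht := (D.tgt e).2
  have hs := (D.src e).2
  have he := e.2
  have hle : (T ++ pairsOf R d e).length ≤ (e + 1) * numTrans R := by
    have := h.le
    have := length_pairsOf_le (R := R) (d := d) e
    rw [List.length_append, Nat.add_mul]
    omega
  have hleB : (T ++ pairsOf R d e).length ≤ B :=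
    hle.trans ((Nat.mul_le_mul_right _ he).trans hmC)
  have hrow := le_rowWeight (R := R) e
  refine (Runs.assign_seq (by simp [hE]; omega) (Runs.assign_seq (by simp [hE]; omega)
    (Runs.store_seq (by simp) (by simp) (Runs.store_seq (by simp) (by simp)
      (Runs.store_seq (by simp) (by simp) (Runs.seq
        (runs_prv (d := d) (A := A) (e := e) hB (by simp [hE]) (by simp [hE])
          (by simpa using h.last) (by simpa using h.prv)) fun σ₁ hf₁ h₁ => ?_)))))).time
    (T := _ + (_ + (_ + (_ + (_ + (_ + (150 * rowWeight R e + 50 * r + 50))))))) ?_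
  · have hlen := h.count
    have h0 : PairRep D A d e T [] σ₁ := by
      refine ⟨fun x => ?_, ?_, fun i hi => ?_, fun i hi => ?_, fun x => ?_, fun x e' he' => ?_⟩
      · rw [hf₁.mem _ (by decide)]
        exact h.dist x
      · rw [hf₁.reg _ (by decide)]
        simp [h.count]
      · rw [hf₁.mem _ (by decide)]
        simp at hi
        simp [h.fst i hi]
      · rw [hf₁.mem _ (by decide)]
        simp at hi
        simp [h.snd i hi]
      · rw [hf₁.mem _ (by decide)]
        simpa using h.last x
      · rw [hf₁.mem _ (by decide)] at he' ⊢
        exact h.parent x e' (by simpa using he')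
    have hU : σ₁.reg yU = D.src e := by rw [hf₁.reg _ (by decide)]; simp [hE]
    have hV : σ₁.reg yV = D.tgt e := by rw [hf₁.reg _ (by decide)]; simp [hE]
    have hE₁ : σ₁.reg yE = e := by rw [hf₁.reg _ (by decide)]; simp [hE]
    refine (Runs.seq (T' := 3) ((Runs.forAppend (T := fun q => 100 * (edgeWeight R q e + 1))
      (Rep := PairRep D A d e T) (g := []) (l := List.finRange r) (h := fun q => pairsFrom R d e q)
      ?_ h0 ?_ ?_ ?_ ?_).time (T' := 150 * rowWeight R e + 9) ?_) fun σ₂ hf₂ h₂ => ?_).time ?_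
    · simp
      omega
    · exact fun g σ v h => h.setReg (by decide) v
    · intro _ σ' _ _
      simp
      omega
    · intro i hi L σ' hf hlen' hL hx
      have hi' : i < r := by simpa using hi
      have hfin : (List.finRange r)[i] = ⟨i, hi'⟩ := by simp
      rw [hfin] at hlen' ⊢
      refine runs_collect (q' := ⟨i, hi'⟩) hB hdB hL (by rw [hf.reg _ (by decide), hU])
        (by rw [hf.reg _ (by decide), hV]) hx (by rw [hf.reg _ (by decide), hE₁]) ?_
      have : ([] ++ (List.finRange r).flatMap fun q => pairsFrom R d e q) = pairsOf R d e := rfl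
      rw [this] at hlen'
      rw [List.length_append] at hleB ⊢
      omega
    · decide
    · have := sum_map_le (f := fun q => 100 * (edgeWeight R q e + 1) + (1 + 1 + 1 + 1) + 7)
        (c := 150) (g := fun q => edgeWeight R q e + 1) (fun q => by omega) (List.finRange r)
      rw [sum_map_finRange (fun q => edgeWeight R q e + 1)] at this
      simp only [cost_input, cost_ofNat, rowWeight]
      omega
    · change PairRep D A d e T (pairsOf R d e) σ₂ at h₂
      have hE₂ : σ₂.reg yE = e := by rw [hf₂.reg _ (by decide), hE₁]
      have hstart : ∀ e' : Fin m, σ₂.mem tStart e' =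
          if e' = e then T.length else σ.mem tStart e' := by
        intro e'
        rw [hf₂.mem _ (by decide), hf₁.mem _ (by decide)]
        simp [hE, hlen, Fin.ext_iff]
      have hsrc : ∀ e' : Fin m, σ₂.mem tSrc e' =
          if e' = e then (D.src e : ℕ) else σ.mem tSrc e' := by
        intro e'
        rw [hf₂.mem _ (by decide), hf₁.mem _ (by decide)]
        simp [hE, Fin.ext_iff]
      have htgt : ∀ e' : Fin m, σ₂.mem tTgt e' =
          if e' = e then (D.tgt e : ℕ) else σ.mem tTgt e' := by
        intro e'
        rw [hf₂.mem _ (by decide), hf₁.mem _ (by decide)]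
        simp [hE, Fin.ext_iff]
      have hend : σ₂.mem tEnd = σ.mem tEnd := by
        rw [hf₂.mem _ (by decide), hf₁.mem _ (by decide)]
        funext i
        simp
      have hlt : ∀ e' : Fin m, (e' : ℕ) < e + 1 → e' = e ∨ e' ≠ e ∧ (e' : ℕ) < e := by
        intro e' h'
        rcases Nat.lt_succ_iff_lt_or_eq.1 h' with h1 | h1
        · exact Or.inr ⟨fun h2 => by simp [h2] at h1, h1⟩
        · exact Or.inl (Fin.ext h1)
      refine Runs.store (by simp) (by simp) ⟨fun x => by simpa using h₂.dist x,
        by simp [h₂.count], hle, fun i hi => by simpa using h₂.fst i hi,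
        fun i hi => by simpa using h₂.snd i hi, fun x => ?_, fun x => by simpa using h₂.parent x,
        fun e' he' => ?_, fun e' he' => ?_, fun e' q he' => ?_, fun e' he' => ?_, fun e' he' => ?_,
        fun e' j hj he' => ?_⟩
      · have := h₂.last x
        rw [pick_enters_succ] at this
        simpa using this
      · rcases hlt e' he' with rfl | ⟨h1, h2⟩
        · simp [hsrc]
        · simp [hsrc, h1, h.src e' h2]
      · rcases hlt e' he' with rfl | ⟨h1, h2⟩
        · simp [htgt]
        · simp [htgt, h1, h.tgt e' h2]
      · have := h₁ e' q he'
        rw [← hf₂.mem _ (by decide)] at this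
        simpa using this
      · rcases hlt e' he' with rfl | ⟨h1, h2⟩
        · simp [hE₂, hstart, h₂.count]
        · have h3 : (e' : ℕ) ≠ e := fun h3 => h1 (Fin.ext h3)
          simp [hE₂, hstart, hend, h1, h3, h.tend e' h2]
      · rcases hlt e' he' with rfl | ⟨h1, h2⟩
        · simp [hE₂, h₂.count]
        · have h3 : (e' : ℕ) ≠ e := fun h3 => h1 (Fin.ext h3)
          have := h.tend_le e' h2
          simp [hE₂, hend, h3]
          omega
      · rcases hlt e' he' with rfl | ⟨h1, h2⟩
        · simp [hstart, hj]
        · have := h.slice e' j hj h2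
          simp only [setCell_mem, if_false, hstart, h1]
          have h3 := (List.getElem?_eq_some_iff.1 this).1
          simpa [hstart, h1, List.getElem?_append_left h3] using this
    · omega
  · simp
    omega

end DistinctWalks

/-! ### The preprocessing -/

namespace DistinctWalks

open TreeEnum WordRAM

/-- Computes the first answer: follows the parents from a final state at distance `λ` of the
target. If there is no answer, the loop is not entered, as subtraction is truncated. -/
def firstProg : Prog Accessor :=
  .assign yV (.input .target 0 0 0) ;; .assign yQ (.reg yFinal) ;;
  forLt yI (.reg yAns - 1)
    (.assign yX (.reg yV * numQ + .reg yQ) ;; .assign yE (.read tLast (.reg yX) - 1) ;;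
      .store tFirst (.reg yI) (.reg yE) ;; .assign yQ (.read aParent (.reg yX)) ;;
      .assign yV (.read tSrc (.reg yE)))

/-- Stores the parameters. -/
def paramProg : Prog Accessor :=
  .store tParam 0 (.reg yAns) ;; .store tParam 1 numQ ;;
  .store tParam 2 (.input .target 0 0 0) ;; .store tParam 3 (.input .source 0 0 0)

/-- The preprocessing. -/
def prepProg : Prog Accessor :=
  bfsProg ;; minProg ;; finalsProg ;; edgesProg ;; firstProg ;; paramProg

variable {k n m r : ℕ} {D : Database (Fin k) (Fin n) (Fin m)} {A : NFA (Fin k) (Fin r)}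
  {R : MemoryRepresentation D A} {s t : Fin n} {B C w : ℕ} {σ : State}
  {d : Fin n × Fin r → ℕ}

theorem runs_edges (hB : PrepBounds k n m r (numTrans R) B w) (hdB : ∀ x, d x ≤ n * r)
    (hd : DistRep d σ) (hc : σ.reg yCount = 0) (hl : ∀ i, σ.mem tLast i = 0) :
    Runs w (R.input s t) edgesProg σ (300 * (∑ e, (rowWeight R e + 1) + 1))
      fun σ' => ∃ T, EdgesRep R d m T σ' := by
  have hcap := hB.cap
  have hm := hB.m
  refine (Runs.forLt (B := m) (Inv := fun i σ' => ∃ T, EdgesRep R d i T σ')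
    (T := fun i => if h : i < m then 250 * (rowWeight R ⟨i, h⟩ + 1) else 0) (by omega)
    ⟨[], fun x => by simpa using hd x, by simp [hc], by simp, by simp, by simp,
      fun x => by simp [hl, pick, below, code], by simp [hl], by simp, by simp, by simp, by simp,
      by simp, by simp⟩ ?_ ?_ (by decide)).time ?_
  · intro i σ' _ _ _
    simp
    omega
  · rintro i σ' hi - ⟨T, hT⟩ hx
    rw [dif_pos hi]
    refine (runs_edge (e := ⟨i, hi⟩) hB hdB hT hx).mono le_rfl fun σ₂ _ h => ?_
    exact ⟨_, fun x => by simpa using h.dist x, by simpa using h.count, h.le, h.fst, h.snd, h.last,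
      h.parent, h.src, h.tgt, h.prv, h.tend, h.tend_le, h.slice⟩
  · rw [Finset.sum_range]
    have h1 : ∀ e : Fin m, (if h : (e : ℕ) < m then 250 * (rowWeight R ⟨e, h⟩ + 1) else 0) +
        (Expr.input Accessor.numEdges 0 0 0).cost + 7 ≤ 300 * (rowWeight R e + 1) := by
      intro e
      simp
      omega
    have h2 := Finset.sum_le_sum fun e (_ : e ∈ Finset.univ) => h1 e
    rw [← Finset.mul_sum] at h2
    simp only [cost_input, cost_ofNat] at h2 ⊢
    omega

/-- Following parents is one path of the product. Its edges are a branch of the search tree: the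
state on the path is kept in the invariant as an element of the set `S` of the current node. -/
theorem runs_first (hB : PrepBounds k n m r (numTrans R) B w) (hd : IsDist D A s d)
    (hdB : ∀ x, d x ≤ n * r)
    {T : List (Fin r × Fin r)} (h : EdgesRep R d m T σ) {l : ℕ} (hA : σ.reg yAns = l + 1)
    {f : Fin r} (hf : f ∈ A.accept) (hdf : d (t, f) = l + 1) (hF : σ.reg yFinal = f) :
    Runs w (R.input s t) firstProg σ (80 * (l + 1)) fun σ' =>
      ∃ w₁ ∈ enum (Usable D A d) (back D A d) l (t, finals A d t l),
        ∀ (i : ℕ) (h : i < w₁.length), σ'.mem tFirst i = w₁[i] := by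
  have hcap := hB.cap
  have hnr := hB.nr
  have hm := hB.m
  have hn := hB.n
  have hr := hB.r
  have hsm := hB.small
  have ht := t.2
  have hl := hdB (t, f)
  refine (Runs.assign_seq (by simp; omega) (Runs.assign_seq (by simp) (Runs.forLt (B := l)
    (T := fun _ => 50) (Inv := fun i σ' => ∃ (v : Fin n) (q : Fin r) (S : Finset (Fin r))
      (u : List (Fin m)), d (v, q) = l - i + 1 ∧ q ∈ S ∧ σ'.reg yV = v ∧ σ'.reg yQ = q ∧
      u.length = i ∧ (∀ (j : ℕ) (h : j < u.length), σ'.mem tFirst j = u[j]) ∧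
      ∀ z ∈ enum (Usable D A d) (back D A d) (l - i) (v, S),
        u ++ z ∈ enum (Usable D A d) (back D A d) l (t, finals A d t l))
    (by omega) ?_ ?_ ?_ (by decide)))).mono ?_ ?_
  · exact ⟨t, f, finals A d t l, [], by simpa using hdf, by simp [finals, hf, hdf], by simp,
      by simp [hF], rfl, by simp, by simp⟩
  · intro i σ' _ hfr _
    have : σ'.reg yAns = l + 1 := by rw [hfr.reg _ (by decide)]; simp [hA]
    simp [this]
    omega
  · rintro i σ' hi hfr ⟨v, q, S, u, hdv, hq, hV, hQ, hul, hu, hz⟩ hx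
    obtain ⟨j, hj⟩ : ∃ j, l - i = j + 1 := ⟨l - i - 1, by omega⟩
    have hj' : l - (i + 1) = j := by omega
    rw [hj] at hdv hz
    rw [hj']
    have hlive : Live d (j + 1) (v, ({q} : Finset (Fin r))) := ⟨by simp, by simpa using hdv⟩
    obtain ⟨e₀, he₀⟩ := hlive.exists_usable hd
    have hent₀ : Enters D A d v q e₀ := by simpa [Usable] using he₀
    obtain ⟨e, he⟩ : ∃ e, pick (Enters D A d v q) m = some e := by
      cases hp : pick (Enters D A d v q) m with
      | none => exact absurd hent₀ (pick_eq_none.1 hp e₀ e₀.2)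
      | some e => exact ⟨e, rfl⟩
    have hent := (pick_some he).2
    have hlast : σ.mem tLast (v * r + q) = e + 1 := by
      have := h.last (v, q)
      rwa [he] at this
    obtain ⟨q', hg, -, hpar⟩ := h.parent (v, q) e hlast
    have hsrc := h.src e e.2
    have hm1 : σ'.mem tLast = σ.mem tLast := hfr.mem _ (by decide)
    have hm2 : σ'.mem aParent = σ.mem aParent := hfr.mem _ (by decide)
    have hm3 : σ'.mem tSrc = σ.mem tSrc := hfr.mem _ (by decide)
    simp only at hpar
    have hlt := idx_lt v q
    have hv := v.2
    have hq2 := q.2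
    have he2 := e.2
    have hvr : (v : ℕ) * r < cap w := by omega
    refine (Runs.assign_seq (by simp [hV, hQ]; omega) (Runs.assign_seq
      (by simp [hV, hQ, hm1, hlast]; omega) (Runs.store_seq (by simp) (by simp)
      (Runs.assign_seq (by simp) (Runs.assign (by simp) ?_))))).time (by simp)
    refine ⟨D.src e, q', pred D A d e S, u ++ [e], ?_, ?_, ?_, ?_, by simp [hul], ?_, ?_⟩
    · have h1 := hg.2.1
      rw [hent.1] at h1
      simp only at h1
      omega
    · simp only [pred, Finset.mem_filter, Finset.mem_univ, true_and]
      exact ⟨q, hq, hg⟩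
    · simp [hV, hQ, hm1, hlast, hm3, hsrc]
    · simp [hV, hQ, hm2, hpar]
    · intro j' hj'
      by_cases hjl : j' = u.length
      · subst hjl
        simp [hx, hul, hV, hQ, hm1, hlast]
      · have h2 : j' < u.length := by simp at hj'; omega
        have h3 : j' ≠ i := by omega
        simp [hx, h3, hu j' h2, List.getElem_append_left h2]
    · intro z hz'
      rw [List.append_assoc]
      exact hz _ (mem_enum_succ.2 ⟨e, z, rfl, ⟨q, hq, hent⟩, hz'⟩)
  · simp
    omega
  · rintro σ' - ⟨v, q, S, u, -, -, -, -, -, hu, hz⟩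
    refine ⟨u, ?_, hu⟩
    have := hz [] (by simp [enum])
    rwa [List.append_nil] at this

theorem runs_param (hB : PrepBounds k n m r C B w) :
    Runs w (R.input s t) paramProg σ 30 fun σ' => σ'.mem tParam 0 = σ.reg yAns ∧
      σ'.mem tParam 1 = r ∧ σ'.mem tParam 2 = t ∧ σ'.mem tParam 3 = s := by
  have hcap := hB.cap
  have hn := hB.n
  have hr := hB.r
  have hsm := hB.small
  have ht := t.2
  have hs := s.2
  exact (Runs.store_seq (by simp; omega) (by simp) (Runs.store_seq (by simp; omega)
    (by simp; omega) (Runs.store_seq (by simp; omega) (by simp; omega) (Runs.store (by simp; omega)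
      (by simp; omega) (by simp))))).time (by simp)

/-- The preprocessing computes correct tables, or finds out that there is no answer. -/
theorem runs_prep (hB : PrepBounds k n m r (numTrans R) B w) :
    Runs w (R.input s t) prepProg State.zero
      (400 * (∑ x, nodeWeight R x + ∑ e, (rowWeight R e + 1) + n * r + r + 5)) fun σ' =>
      σ'.out = [] ∧ ∃ d, IsDist D A s d ∧ (∀ x, d x ≤ n * r) ∧
        ((σ'.mem tParam 0 = 0 ∧ ∀ f ∈ A.accept, d (t, f) = 0) ∨
          ∃ l w₁, (∃ f ∈ A.accept, d (t, f) = l + 1) ∧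
            (∀ f ∈ A.accept, d (t, f) ≠ 0 → l + 1 ≤ d (t, f)) ∧
            w₁ ∈ enum (Usable D A d) (back D A d) l (t, finals A d t l) ∧
            Tables D A s t d l B (numTrans R) w₁ (pairsOf R d) σ'.mem) := by
  classical
  refine (Runs.seq (runs_bfs hB) (T' := 60 * (r + 1) + (60 * (r + 1) +
    (300 * (∑ e, (rowWeight R e + 1) + 1) + (80 * (n * r + 1) + 30))))
    (Q' := fun σ' => ∃ d, IsDist D A s d ∧ (∀ x, d x ≤ n * r) ∧
        ((σ'.mem tParam 0 = 0 ∧ ∀ f ∈ A.accept, d (t, f) = 0) ∨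
          ∃ l w₁, (∃ f ∈ A.accept, d (t, f) = l + 1) ∧
            (∀ f ∈ A.accept, d (t, f) ≠ 0 → l + 1 ≤ d (t, f)) ∧
            w₁ ∈ enum (Usable D A d) (back D A d) l (t, finals A d t l) ∧
            Tables D A s t d l B (numTrans R) w₁ (pairsOf R d) σ'.mem)) ?_).mono ?_ ?_
  · rintro σ₁ hf₁ ⟨d, hd, hdB, h₁⟩
    refine Runs.seq (runs_min (d := d) hB h₁ (hf₁.reg _ (by decide))) fun σ₂ hf₂ h₂ => ?_
    have hd₂ : DistRep d σ₂ := fun x => by rw [hf₂.mem _ (by decide)]; exact h₁ x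
    refine Runs.seq (runs_finals (d := d) hB hd₂) fun σ₃ hf₃ h₃ => ?_
    have hd₃ : DistRep d σ₃ := fun x => by rw [hf₃.mem _ (by decide)]; exact hd₂ x
    refine Runs.seq (runs_edges (d := d) hB hdB hd₃ ?_ ?_) fun σ₄ hf₄ h₄ => ?_
    · rw [hf₃.reg _ (by decide), hf₂.reg _ (by decide), hf₁.reg _ (by decide)]
      rfl
    · intro i
      rw [hf₃.mem _ (by decide), hf₂.mem _ (by decide), hf₁.mem _ (by decide)]
      rfl
    · obtain ⟨T, hT⟩ := h₄
      have hans₄ : σ₄.reg yAns = σ₂.reg yAns := by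
        rw [hf₄.reg _ (by decide), hf₃.reg _ (by decide)]
      have hfin₄ : σ₄.reg yFinal = σ₂.reg yFinal := by
        rw [hf₄.reg _ (by decide), hf₃.reg _ (by decide)]
      rcases h₂ with ⟨h0, h₂⟩ | ⟨h0, ⟨f, hf, hdf, hff⟩, hmin⟩
      · have hempty : Runs w (R.input s t) firstProg σ₄ (80 * (n * r + 1)) fun _ => True := by
          have := hB.cap
          have := hB.n
          have := hB.small
          have := t.2
          refine (Runs.assign_seq (by simp; omega) (Runs.assign_seq (by simp) (Runs.forLt (B := 0)
            (T := fun _ => 0) (Inv := fun _ _ => True) (by omega) trivial ?_ (by simp)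
            (by decide)))).time ?_
          · intro i σ' _ hf _
            have : σ'.reg yAns = 0 := by rw [hf.reg _ (by decide)]; simp [hans₄, h0]
            simp [this]
            omega
          · simp
            omega
        refine Runs.seq hempty fun σ₅ hf₅ _ => (runs_param hB).mono le_rfl ?_
        rintro σ₆ hf₆ ⟨hp0, -⟩
        refine ⟨d, hd, hdB, Or.inl ⟨?_, fun f hf => h₂ f hf f.2⟩⟩
        rw [hp0, hf₅.reg _ (by decide), hans₄, h0]
      · obtain ⟨l, hl⟩ : ∃ l, σ₂.reg yAns = l + 1 := ⟨_, (Nat.succ_pred_eq_of_ne_zero h0).symm⟩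
        rw [hl] at hdf hmin h₃ hans₄
        have hle := hdB (t, f)
        refine Runs.seq ((runs_first (T := T) (f := f) (d := d) (l := l) hB hd hdB hT hans₄ hf hdf
          (hfin₄.trans hff)).time (by omega)) fun σ₅ hf₅ h₅ => (runs_param hB).mono le_rfl ?_
        obtain ⟨w₁, hw₁, h₅⟩ := h₅
        rintro σ₆ hf₆ ⟨hp0, hp1, hp2, hp3⟩
        have hmem : ∀ a, a ∉ stores firstProg → a ∉ stores paramProg → σ₆.mem a = σ₄.mem a :=
          fun a h1 h2 => by rw [hf₆.mem a h2, hf₅.mem a h1]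
        refine ⟨d, hd, hdB, Or.inr ⟨l, w₁, ⟨f, hf, hdf⟩,
          fun f hf => hmin f hf f.2, hw₁, ?_, hp1, hp2, hp3, ?_, ?_, ?_, ?_, ?_, ?_, ?_, ?_, ?_,
          ?_, ?_, length_of_mem_enum hw₁, ?_⟩⟩
        · rw [hp0, hf₅.reg _ (by decide), hans₄]
        · intro e
          rw [hmem _ (by decide) (by decide)]
          exact hT.src e e.2
        · intro e
          rw [hmem _ (by decide) (by decide)]
          exact hT.tgt e e.2
        · intro q
          rw [hmem _ (by decide) (by decide), hf₄.mem _ (by decide), h₃ q]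
          simp [finals]
        · intro v q
          rw [hmem _ (by decide) (by decide)]
          exact hT.last (v, q)
        · intro e q
          rw [hmem _ (by decide) (by decide)]
          exact hT.prv e q e.2
        · intro e
          rw [hmem _ (by decide) (by decide), hmem _ (by decide) (by decide)]
          exact hT.tend e e.2
        · intro e
          rw [hmem _ (by decide) (by decide)]
          exact (hT.tend_le e e.2).trans (hT.le.trans hB.mC)
        · exact length_pairsOf_le
        · intro e i hi
          have h6 := hT.slice e i hi e.2
          obtain ⟨h7, h8⟩ := List.getElem?_eq_some_iff.1 h6
          rw [hmem _ (by decide) (by decide), hmem _ (by decide) (by decide), hT.fst _ h7, h8]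
        · intro e i hi
          have h6 := hT.slice e i hi e.2
          obtain ⟨h7, h8⟩ := List.getElem?_eq_some_iff.1 h6
          rw [hmem _ (by decide) (by decide), hmem _ (by decide) (by decide), hT.snd _ h7, h8]
        · intro e q' q
          exact mem_pairsOf
        · intro i hi
          rw [hf₆.mem _ (by decide)]
          exact h₅ i hi
  · omega
  · exact fun σ' hf h => ⟨hf.out (by decide), h⟩

end DistinctWalks

/-! ### Time bounds -/

namespace DistinctWalks

open TreeEnum WordRAM

variable {k n m r : ℕ} {D : Database (Fin k) (Fin n) (Fin m)} {A : NFA (Fin k) (Fin r)}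
  {R : MemoryRepresentation D A} {s t : Fin n} {B w : ℕ}

theorem sum_outgoing (R : MemoryRepresentation D A) (f : Fin m → ℕ) :
    ∑ v, ((R.outgoing v).map f).sum = ∑ e, f e := by
  classical
  rw [← Finset.sum_fiberwise Finset.univ D.src f]
  refine Finset.sum_congr rfl fun v _ => ?_
  rw [← List.sum_toFinset f (R.outgoing_nodup v)]
  refine Finset.sum_congr ?_ fun _ _ => rfl
  ext e
  simp [R.mem_outgoing]

/-- Each edge leaves one vertex, so it is passed once for each state. -/
theorem sum_nodeWeight (R : MemoryRepresentation D A) :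
    ∑ x, nodeWeight R x = n * r + ∑ e, rowWeight R e := by
  have h : ∀ q : Fin r, ∑ v : Fin n, nodeWeight R (v, q) = ∑ e, (edgeWeight R q e + 1) + n := by
    intro q
    simp only [nodeWeight]
    rw [Finset.sum_add_distrib, sum_outgoing R fun e => edgeWeight R q e + 1]
    simp
  rw [Fintype.sum_prod_type_right, Finset.sum_congr rfl fun q _ => h q, Finset.sum_add_distrib,
    Finset.sum_comm]
  simp only [rowWeight, Finset.sum_const, Finset.card_univ, Fintype.card_fin, smul_eq_mul]
  ring

/-- For each edge, a transition is used at most once, since the labels of an edge are different. -/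
theorem rowWeight_le (R : MemoryRepresentation D A) (e : Fin m) :
    rowWeight R e ≤ numTrans R + r * (D.lbl e).card + r := by
  have hlen : (R.labels e).length = (D.lbl e).card := by
    rw [← List.toFinset_card_of_nodup (R.labels_nodup e)]
    congr 1
    ext a
    simp [R.mem_labels]
  have h : ∀ q, edgeWeight R q e + 1 ≤ ∑ a, (R.delta q a).length + ((D.lbl e).card + 1) := by
    intro q
    have := sum_map_le_univ (R.labels_nodup e) fun a => (R.delta q a).length
    rw [edgeWeight, List.sum_map_add]
    simp [hlen]
    omega
  calc rowWeight R e ≤ ∑ q : Fin r, (∑ a, (R.delta q a).length + ((D.lbl e).card + 1)) :=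
        Finset.sum_le_sum fun q _ => h q
    _ = _ := by
      rw [Finset.sum_add_distrib, numTrans]
      simp
      ring

theorem numTrans_eq (R : MemoryRepresentation D A) :
    numTrans R = {x : Fin r × Fin k × Fin r | x.2.2 ∈ A.step x.1 x.2.1}.ncard := by
  classical
  have h : ∀ q a, (R.delta q a).length = ∑ p, if p ∈ A.step q a then 1 else 0 := by
    intro q a
    rw [← List.toFinset_card_of_nodup (R.delta_nodup q a), Finset.card_eq_sum_ones,
      ← Finset.sum_filter]
    refine Finset.sum_congr ?_ fun _ _ => rfl
    ext p
    simp [R.mem_delta]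
  rw [Set.ncard_eq_toFinset_card', numTrans, Finset.card_eq_sum_ones]
  simp only [h]
  rw [← Fintype.sum_prod_type' (f := fun q a => ∑ p, if p ∈ A.step q a then 1 else 0)]
  rw [Set.toFinset_ofPred, Finset.sum_filter, Fintype.sum_prod_type, Fintype.sum_prod_type]
  refine Finset.sum_congr rfl fun q _ => ?_
  rw [Fintype.sum_prod_type]

theorem numTrans_add_le (R : MemoryRepresentation D A) :
    k + r + numTrans R ≤ automatonSize A := by
  rw [numTrans_eq, automatonSize]
  simp only [Fintype.card_fin]
  omega

theorem cost_le (R : MemoryRepresentation D A) (s : Fin n) :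
    ∑ x, nodeWeight R x + ∑ e, (rowWeight R e + 1) + n * r + r + 5 ≤
      11 * (D.size * max 1 (automatonSize A)) := by
  have hA := numTrans_add_le R
  set K := max 1 (automatonSize A) with hK
  have hK1 : 1 ≤ K := le_max_left _ _
  have hK2 : k + r + numTrans R ≤ K := hA.trans (le_max_right _ _)
  have hn : 1 ≤ n := by have := s.2; omega
  have hS : D.size = n + m + ∑ e, (D.lbl e).card := by simp [Database.size]
  have h1 : ∑ e, rowWeight R e ≤ (m + ∑ e, (D.lbl e).card) * K := by
    calc ∑ e, rowWeight R e ≤ ∑ e, (K + (D.lbl e).card * K) := by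
          refine Finset.sum_le_sum fun e _ => (rowWeight_le R e).trans ?_
          have := Nat.mul_le_mul_right (D.lbl e).card (show r ≤ K by omega)
          rw [Nat.mul_comm (D.lbl e).card K]
          omega
      _ = _ := by
        rw [Finset.sum_add_distrib, ← Finset.sum_mul]
        simp
        ring
  have h2 : n * r ≤ n * K := Nat.mul_le_mul_left _ (by omega)
  have h3 : m ≤ m * K := Nat.le_mul_of_pos_right _ hK1
  have h4 : K ≤ n * K := Nat.le_mul_of_pos_left _ hn
  rw [sum_nodeWeight, Finset.sum_add_distrib, hS]
  simp only [Finset.sum_const, Finset.card_univ, Fintype.card_fin, smul_eq_mul, mul_one]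
  rw [Nat.add_mul] at h1
  rw [Nat.add_mul, Nat.add_mul]
  omega

/-- All numbers that the programs compute are quadratic in the size of the input. -/
theorem prepBounds (R : MemoryRepresentation D A) (s : Fin n)
    (hw : 6 * (Nat.log 2 (D.size + automatonSize A) + 1) ≤ w) :
    PrepBounds k n m r (numTrans R) (16 * (D.size + automatonSize A) ^ 2) w := by
  have hA := numTrans_add_le R
  set X := D.size + automatonSize A with hX
  have hS : D.size = n + m + ∑ e, (D.lbl e).card := by simp [Database.size]
  have hn : 1 ≤ n := by have := s.2; omega
  have hsq : X ≤ X ^ 2 := Nat.le_self_pow two_ne_zero X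
  have hmul : ∀ a b, a ≤ X → b ≤ X → a * b ≤ X ^ 2 := fun a b ha hb => by
    rw [pow_two]
    exact Nat.mul_le_mul ha hb
  have h1 := hmul n r (by omega) (by omega)
  have h2 := hmul m r (by omega) (by omega)
  have h3 := hmul m (numTrans R) (by omega) (by omega)
  refine ⟨by omega, by omega, by omega, by omega, by omega, by omega, by omega, by omega, ?_⟩
  -- With `Y = 2 ^ (log X + 1)`, `16 * X ^ 2 < Y ^ 4 * Y ^ 2`, as `2 ≤ Y` and `X < Y`.
  set y := Nat.log 2 X + 1 with hy
  have hXy : X < 2 ^ y := Nat.lt_pow_succ_log_self one_lt_two X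
  have h4 : X ^ 2 < (2 ^ y) ^ 2 := Nat.pow_lt_pow_left hXy two_ne_zero
  have h5 : 2 ^ 4 ≤ 2 ^ (4 * y) := Nat.pow_le_pow_right two_pos (by omega)
  calc 16 * X ^ 2 < 16 * (2 ^ y) ^ 2 := by omega
    _ ≤ 2 ^ (4 * y) * (2 ^ y) ^ 2 := Nat.mul_le_mul_right _ h5
    _ = 2 ^ (6 * y) := by rw [← pow_mul, ← pow_add]; congr 1; ring
    _ ≤ cap w := Nat.pow_le_pow_right two_pos hw

theorem PrepBounds.bounds {C l : ℕ} (hB : PrepBounds k n m r C B w) (hl : l + 1 ≤ n * r) :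
    Bounds n m r l B w := by
  have := hB.nr
  exact ⟨by omega, hB.mr, hB.n, hB.m, hB.r, by omega, hB.small, hB.cap⟩

/-! ### The enumeration of the answers -/

/-- Reversed edge sequences of walks from `s`, as walks. -/
theorem exists_walks {s : Fin n} {L : List (List (Fin m))}
    (h : ∀ z ∈ L, D.IsWalk s z.reverse) :
    ∃ l : List (Walk D), (∀ x ∈ l, x.src = s) ∧ l.map (fun x => x.edges.reverse) = L := by
  induction L with
  | nil => exact ⟨[], by simp, rfl⟩
  | cons z L ih =>
    obtain ⟨l, h1, h2⟩ := ih fun z hz => h z (by simp [hz])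
    exact ⟨⟨s, z.reverse, h z (by simp)⟩ :: l, by simpa using h1, by simp [h2]⟩

theorem encode_eq {x : Walk D} (h : x.src = s) : x.encode = encodeRev D s x.edges.reverse := by
  rw [Walk.encode, encodeRev, h, List.reverse_reverse]

theorem length_encodeRev (z : List (Fin m)) : (encodeRev D s z).length = 2 * z.length + 1 := by
  simp [encodeRev, mul_comm]

/-- The constant `5000` bounds `400 * 11` for the preprocessing plus `200` for the first call, and
`700 * 4` for the other calls. -/
theorem memorylessEnumerates (hB : PrepBounds k n m r (numTrans R) B w) :
    MemorylessEnumerates w (R.input s t) prepProg nextProg (shortestWalks D A s t) Walk.encode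
      (5000 * (D.size * max 1 (automatonSize A)))
      (5000 * (max 1 (shortestLength D A s t) * max 1 (automatonSize A))) := by
  have hcost := cost_le R s
  have hA := numTrans_add_le R
  obtain ⟨σ₀, n₀, hx₀, hn₀, hout, d, hd, hdB, hcase⟩ := runs_prep (s := s) (t := t) hB
  have hnr : n * r ≤ D.size * max 1 (automatonSize A) := by
    refine Nat.mul_le_mul ?_ (le_trans (by omega) (le_max_right _ _))
    simp [Database.size]
    omega
  have hcap := hB.cap
  have hsm := hB.small
  rcases hcase with ⟨h0, hall⟩ | ⟨l, w₁, hex, hmin, hw₁, hT⟩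
  · refine ⟨σ₀, n₀, [], hx₀, hout, List.nodup_nil, ?_, fun i hi σ ho => ?_⟩
    · simp [shortestWalks_eq_empty hd hall]
    · obtain rfl : i = 0 := by simpa using hi
      obtain ⟨σ', n', hx, hn, h⟩ := runs_nextProg_of_zero (w := w) (u := [])
        (by omega) h0 ho
      refine ⟨σ', n', hx, h, ?_, fun _ => by omega⟩
      have : 1 ≤ max 1 (shortestLength D A s t) * max 1 (automatonSize A) :=
        Nat.mul_pos (by simp) (by simp)
      omega
  · have hlive := live_finals hex
    have hl : l + 1 ≤ n * r := by
      obtain ⟨f, -, hf⟩ := hex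
      exact hf ▸ hdB (t, f)
    have hBd := hB.bounds hl
    have hlen := shortestLength_eq hd hex hmin
    have hE1 := fun j a (h : Live d (j + 1) a) => h.exists_usable (A := A) hd
    have hE2 := fun j a e (h : Live d (j + 1) a) => h.back (D := D) (A := A) (e := e)
    obtain ⟨L, hperm, hhead, hfol⟩ := (follows_enum hE1 hE2 hlive).rotate
      (head_enum hE1 hE2 hlive) hw₁
    have hmem : ∀ z, z ∈ L ↔ z ∈ enum (Usable D A d) (back D A d) l (t, finals A d t l) :=
      fun z => hperm.mem_iff
    obtain ⟨W, hsrc, rfl⟩ := exists_walks (D := D) (s := s) (L := L) fun z hz => by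
      obtain ⟨-, q, -, hr⟩ := (mem_enum_iff hd hlive).1 ((hmem z).1 hz)
      exact hr.1
    have hnodup : (W.map fun x => x.edges.reverse).Nodup := hperm.nodup_iff.2 (nodup_enum _ _)
    have hdelay : (l + 1) * (r + numTrans R + 1) ≤
        4 * (max 1 (shortestLength D A s t) * max 1 (automatonSize A)) := by
      rw [hlen]
      calc (l + 1) * (r + numTrans R + 1) ≤ (2 * max 1 l) * (2 * max 1 (automatonSize A)) :=
            Nat.mul_le_mul (by omega) (by omega)
        _ = _ := by ring
    have hdelay' : l + 1 ≤ (l + 1) * (r + numTrans R + 1) :=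
      Nat.le_mul_of_pos_right _ (by omega)
    refine ⟨σ₀, n₀, W, hx₀, hout, hnodup.of_map, fun x => ?_, fun i hi σ ho => ?_⟩
    · rw [mem_shortestWalks hd hex hmin, ← hmem, List.mem_map]
      constructor
      · exact fun hx => ⟨hsrc x hx, x, hx, rfl⟩
      · rintro ⟨hx, y, hy, hxy⟩
        obtain rfl : y = x := Walk.ext ((hsrc y hy).trans hx.symm) (List.reverse_injective hxy)
        exact hy
    · cases i with
      | zero =>
        obtain ⟨σ', n', hx, hn, h⟩ := runs_nextProg_first (w := w) hT hBd ho
        refine ⟨σ', n', hx, ?_, by omega, fun _ => by omega⟩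
        cases W with
        | nil => simp at hhead
        | cons y W =>
          simp only [List.map_cons, List.head?_cons, Option.some.injEq] at hhead
          simp [h, encode_eq (hsrc y (by simp)), hhead]
      | succ j =>
        have hj : j < W.length := hi
        have hjL : j < (W.map fun x => x.edges.reverse).length := by simpa using hj
        have hfj := hfol.getElem j hjL
        have hbL := List.getElem_mem hjL
        rw [List.getElem_map] at hfj hbL
        generalize hz : (succ (Usable D A d) (back D A d) l (t, finals A d t l)
          W[j].edges.reverse).getD (first (Usable D A d) (back D A d) l (t, finals A d t l)) = z
          at hfj
        have hzL : z ∈ W.map fun x => x.edges.reverse := by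
          cases hc : (W.map fun x => x.edges.reverse)[j + 1]? with
          | none =>
            rw [hc, Option.none_or, Option.some.injEq] at hfj
            exact hfj ▸ (hmem _).2 hw₁
          | some y =>
            rw [hc, Option.some_or, Option.some.injEq] at hfj
            exact hfj ▸ List.mem_of_getElem? hc
        have hbl := length_of_mem_enum ((hmem _).1 hbL)
        have hprev : (previous W (j + 1)).elim [] Walk.encode =
            encodeRev D s W[j].edges.reverse := by
          simp [previous, hj, encode_eq (hsrc W[j] (List.getElem_mem hj))]
        obtain ⟨σ', n', hx, hn, h⟩ := runs_nextProg_succ (w := w) hT hBd hex hd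
          (encodes_encodeRev (D := D) (s := s)) (by simp [length_encodeRev])
          (by have := hBd.l; rw [length_encodeRev, hbl]; omega) ((hmem _).1 hbL) ((hmem z).1 hzL)
          hz.symm ho
        rw [hprev]
        refine ⟨σ', n', hx, ?_, by omega, by simp⟩
        rw [h]
        by_cases hjl : j + 1 < W.length
        · have hzj : z = W[j + 1].edges.reverse := by simpa [hjl] using hfj
          -- The first answer occurs only at the beginning of the enumeration.
          have hne : z ≠ w₁ := by
            intro hzw
            have h0 : (W.map fun x => x.edges.reverse)[0]? = some w₁ := by
              rw [← List.head?_eq_getElem?, hhead]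
            have h1 : (W.map fun x => x.edges.reverse)[j + 1]? = some w₁ := by
              simp [hjl, ← hzw, hzj]
            have := (List.nodup_iff_getElem?_ne_getElem?.1 hnodup) 0 (j + 1) (by omega)
              (by simpa using hjl)
            exact this (h0.trans h1.symm)
          rw [if_neg hne, List.getElem?_eq_getElem hjl, Option.elim_some,
            encode_eq (hsrc W[j + 1] (List.getElem_mem hjl)), hzj]
        · have hzw : z = w₁ := by simpa [hjl] using hfj
          simp [hzw, hjl]

end DistinctWalks

theorem mainTheorem2 :
    ∃ (prep : Prog Accessor) (next : Prog CallAccessor) (c : ℕ),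
      ∀ (k n m r : ℕ) (D : Database (Fin k) (Fin n) (Fin m)) (A : NFA (Fin k) (Fin r))
        (R : MemoryRepresentation D A) (s t : Fin n) (w : ℕ),
        c * (Nat.log 2 (D.size + automatonSize A) + 1) ≤ w →
        MemorylessEnumerates w (R.input s t) prep next (shortestWalks D A s t) Walk.encode
          (c * (D.size * max 1 (automatonSize A)))
          (c * (max 1 (shortestLength D A s t) * max 1 (automatonSize A))) :=
  ⟨DistinctWalks.prepProg, DistinctWalks.nextProg, 5000, fun _ _ _ _ _ _ R s _ _ hw =>
    DistinctWalks.memorylessEnumerates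
      (DistinctWalks.prepBounds R s ((Nat.mul_le_mul_right _ (by norm_num)).trans hw))⟩
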